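/- **Setting.** Let $G=(V,E)$ be a finite simple graph with $V=\{0,\dots,n-1\}$, $n\ge 1$, $m=|E|$, and let $Q=\{0,\dots,q-1\}$, $q\ge 2$. For $v\in V$ put $N_v^+=\{v\}\cup\{u:\{u,v\}\in E\}$. Let $\{P_v^\tau\}$ be a collection of local update distributions: $P_v^\tau$ is a probability distribution on $Q$ for every $v\in V$ and every $\tau\in Q^{N_v^+}$. The continuous-time single-site dynamics $(X_t)_{t\ge 0}$ on $Q^V$ started from $X_0$ evolves as follows: the sites hold independent rate-1 Poisson clocks, and whenever the clock at $v$ rings, the spin of $v$ is replaced by an independent draw from $P_v^\tau$, where $\tau$ is the current configuration on $N_v^+$. Dobrushin's influence matrix is $\rho(u,v)=\max d_{\mathrm{TV}}(P_v^\tau,P_v^{\tau'})$, where the maximum is over all $\tau,\tau'\in Q^{N_v^+}$ that agree everywhere except possibly at $u$, and $\|\rho\|_p=\sup_{x\ne0}\|\rho x\|_p/\|x\|_p$. **Machine model.** A CRCW-PRAM with arbitrary write: synchronous processors run one common program on a shared memory of integer and real cells, with unit-cost arithmetic and comparisons, with fresh independent random numbers (uniform in $\{0,\dots,k-1\}$,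 uniform in $[0,1]$, exponential of rate 1), and with a unit-cost oracle which, given $v\in V$, $\tau\in Q^{N_v^+}$ (stored in the shared memory) and $x\in Q$, returns the value $P_v^\tau(x)$. When several processors write to one cell, the value of an arbitrary one of them is stored. The input consists of $n,q,m$, the list of edges of $G$ (in any order), $X_0$ and $T$. The depth is the number of parallel time steps; the number of processors is the largest number of processors active in one step. **Theorem.** There is a single CRCW-PRAM algorithm (a fixed program) with the following properties, no matter how write conflicts are resolved. 1. For every $c_0>0$, all $G,q,\{P_v^\tau\}$ as above, every $X_0\in Q^V$ and every $T$ with $0<T\le n^{c_0}$, the algorithm terminates almost surely and returns a random configuration $X\in Q^V$ that is distributed exactly as $X_T$, where $(X_t)_{t\ge0}$ is the continuous-time single-site dynamics started from $X_0$. 2. For every $c_1>0$ there is a constant $K_1=K_1(c_1)$, and for all $C\ge 0$ and $c_0>0$ there is moreover a constant $K_2=K_2(c_0,c_1,C)$, such that for all inputs as in part 1 for which $\|\rho\|_p\le C$ for some $p\in[1,\infty]$, with probability at least $1-n^{-c_1}$ the algorithm has depth at most $K_2\,(T+\log n)$ and uses at most $K_1\,(m+nq^2\log^2 n)\log n$ processors.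 -/

import Mathlib

open MeasureTheory ProbabilityTheory
open scoped ENNReal NNReal

noncomputable section

namespace PRAM

/-! ### The machine: a randomized oracle CRCW-PRAM over integers and reals

The machine has a shared memory that consists of integer arrays and real arrays, and processors
`0, 1, 2, ...` that run the same program in lock-step. In one parallel step the processors
`0, ..., k - 1` read the shared memory, compute, and each of them may write one cell. When several
processors write the same cell, the value of an arbitrary one of them is stored. -/

/-- The two types of machine words. -/
inductive Ty where
  | nat
  | real

/-- The values of the two types. -/
def Ty.Val : Ty → Type
  | .nat => ℕ
  | .real => ℝ

/-- What one processor can compute locally. Array names are literals of the program; indices are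
computed. `monus` is truncated subtraction, `quo` and `rem` are integer division with remainder,
and the two comparisons return `1` or `0`. -/
inductive Expr : Ty → Type where
  | lit (c : ℕ) : Expr .nat
  | pid : Expr .nat
  | readN (a : ℕ) (i : Expr .nat) : Expr .nat
  | add (x y : Expr .nat) : Expr .nat
  | monus (x y : Expr .nat) : Expr .nat
  | mul (x y : Expr .nat) : Expr .nat
  | quo (x y : Expr .nat) : Expr .nat
  | rem (x y : Expr .nat) : Expr .nat
  | ltN (x y : Expr .nat) : Expr .nat
  | ltR (x y : Expr .real) : Expr .nat
  | ofNat (x : Expr .nat) : Expr .real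
  | readR (a : ℕ) (i : Expr .nat) : Expr .real
  | addR (x y : Expr .real) : Expr .real
  | subR (x y : Expr .real) : Expr .real
  | mulR (x y : Expr .real) : Expr .real
  | divR (x y : Expr .real) : Expr .real
  /-- The oracle call `(v, τ, x)`, where `τ u` is held in cell `base + u` of the integer
  array `a`. -/
  | query (v : Expr .nat) (a : ℕ) (base x : Expr .nat) : Expr .real

/-- The number of elementary operations in an expression. -/
def Expr.cost : {t : Ty} → Expr t → ℕ
  | _, .lit _ => 1
  | _, .pid => 1
  | _, .readN _ i => i.cost + 1
  | _, .add x y => x.cost + y.cost + 1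
  | _, .monus x y => x.cost + y.cost + 1
  | _, .mul x y => x.cost + y.cost + 1
  | _, .quo x y => x.cost + y.cost + 1
  | _, .rem x y => x.cost + y.cost + 1
  | _, .ltN x y => x.cost + y.cost + 1
  | _, .ltR x y => x.cost + y.cost + 1
  | _, .ofNat x => x.cost + 1
  | _, .readR _ i => i.cost + 1
  | _, .addR x y => x.cost + y.cost + 1
  | _, .subR x y => x.cost + y.cost + 1
  | _, .mulR x y => x.cost + y.cost + 1
  | _, .divR x y => x.cost + y.cost + 1
  | _, .query v _ b x => v.cost + b.cost + x.cost + 1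

/-- What a processor does at the end of a parallel step: it writes a computed integer or real, or
a fresh random number, into the cell with index `idx` of array `a`. The three random numbers are:
uniform in `{0, ..., bound - 1}`, uniform in `[0,1]`, and exponential of rate `1`. -/
inductive Action where
  | setN (a : ℕ) (idx : Expr .nat) (val : Expr .nat)
  | setR (a : ℕ) (idx : Expr .nat) (val : Expr .real)
  | randN (a : ℕ) (idx : Expr .nat) (bound : Expr .nat)
  | randR (a : ℕ) (idx : Expr .nat)
  | randE (a : ℕ) (idx : Expr .nat)

/-- The number of elementary operations of an action. -/
def Action.cost : Action → ℕ
  | .setN _ i x => i.cost + x.cost + 1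
  | .setR _ i x => i.cost + x.cost + 1
  | .randN _ i b => i.cost + b.cost + 1
  | .randR _ i => i.cost + 1
  | .randE _ i => i.cost + 1

/-- Programs. `par count guard act`: all processors with number less than `count` evaluate
`guard`, and those that find it nonzero perform `act`. The expression `count`, and the conditions
of `ite` and `loop` (a while loop), are evaluated by processor `0`. -/
inductive Prog where
  | skip
  | par (count guard : Expr .nat) (act : Action)
  | seq (p₁ p₂ : Prog)
  | ite (cond : Expr .nat) (p₁ p₂ : Prog)
  | loop (cond : Expr .nat) (body : Prog)

/-- The shared memory: cell `i` of array `a`, for integers and for reals. -/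
structure Store where
  nat : ℕ → ℕ → ℕ
  real : ℕ → ℕ → ℝ

/-- Oracles: the query `(v, τ, x)` is answered by a real. -/
abbrev Oracle := ℕ → (ℕ → ℕ) → ℕ → ℝ

/-- The value of an expression for processor `i`. -/
def Expr.eval (O : Oracle) (s : Store) (i : ℕ) : {t : Ty} → Expr t → t.Val
  | _, .lit c => c
  | _, .pid => i
  | _, .readN a j => s.nat a (j.eval O s i)
  | _, .add x y => Nat.add (x.eval O s i) (y.eval O s i)
  | _, .monus x y => Nat.sub (x.eval O s i) (y.eval O s i)
  | _, .mul x y => Nat.mul (x.eval O s i) (y.eval O s i)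
  | _, .quo x y => Nat.div (x.eval O s i) (y.eval O s i)
  | _, .rem x y => Nat.mod (x.eval O s i) (y.eval O s i)
  | _, .ltN x y =>
      let a : ℕ := x.eval O s i
      let b : ℕ := y.eval O s i
      (if a < b then 1 else 0 : ℕ)
  | _, .ltR x y =>
      let a : ℝ := x.eval O s i
      let b : ℝ := y.eval O s i
      open Classical in (if a < b then 1 else 0 : ℕ)
  | _, .ofNat x =>
      let a : ℕ := x.eval O s i
      (a : ℝ)
  | _, .readR a j => s.real a (j.eval O s i)
  | _, .addR x y =>
      let a : ℝ := x.eval O s i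
      let b : ℝ := y.eval O s i
      (a + b : ℝ)
  | _, .subR x y =>
      let a : ℝ := x.eval O s i
      let b : ℝ := y.eval O s i
      (a - b : ℝ)
  | _, .mulR x y =>
      let a : ℝ := x.eval O s i
      let b : ℝ := y.eval O s i
      (a * b : ℝ)
  | _, .divR x y =>
      let a : ℝ := x.eval O s i
      let b : ℝ := y.eval O s i
      (a / b : ℝ)
  | _, .query v a b x =>
      let base : ℕ := b.eval O s i
      O (v.eval O s i) (fun u => s.nat a (base + u)) (x.eval O s i)

/-- The value of an integer expression. -/
def evalN (O : Oracle) (s : Store) (i : ℕ) (e : Expr .nat) : ℕ := e.eval O s i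

/-- The value of a real expression. -/
def evalR (O : Oracle) (s : Store) (i : ℕ) (e : Expr .real) : ℝ := e.eval O s i

/-- The coin tosses: an independent uniform element of `[0,1]` for every time and processor. -/
abbrev Tape := ℕ × ℕ → unitInterval

/-- The distribution of the coin tosses. -/
def tapeMeasure : Measure Tape := Measure.infinitePi fun _ => (volume : Measure unitInterval)

/-- A resolution of write conflicts: it picks, at every time and for every cell (given by its
index in the array that is being written), one of the processors that write to it. -/
abbrev Resolver := ℕ → ℕ → ∀ S : Finset ℕ, S.Nonempty → {i : ℕ // i ∈ S}

open Classical in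
/-- Concurrent write to an array `old`: processor `i < k` with `g i ≠ 0` writes `val i` into
cell `idx i`; `pick` decides the conflicts. -/
def concurrentWrite {α : Type} (pick : ℕ → ∀ S : Finset ℕ, S.Nonempty → {i : ℕ // i ∈ S})
    (k : ℕ) (g idx : ℕ → ℕ) (val : ℕ → α) (old : ℕ → α) : ℕ → α := fun j =>
  if h : ((Finset.range k).filter fun i => g i ≠ 0 ∧ idx i = j).Nonempty
  then val (pick j _ h).1 else old j

/-- The effect on the memory of an action performed by the processors `i < k` with `g i ≠ 0`,
where `U i` is the fresh uniform element of `[0,1]` of processor `i`. -/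
def Action.exec (O : Oracle) (pick : ℕ → ∀ S : Finset ℕ, S.Nonempty → {i : ℕ // i ∈ S})
    (U : ℕ → unitInterval) (s : Store) (k : ℕ) (g : ℕ → ℕ) : Action → Store
  | .setN a idx x =>
      { s with
        nat := Function.update s.nat a <| concurrentWrite pick k g
          (fun i => evalN O s i idx) (fun i => evalN O s i x) (s.nat a) }
  | .setR a idx x =>
      { s with
        real := Function.update s.real a <| concurrentWrite pick k g
          (fun i => evalN O s i idx) (fun i => evalR O s i x) (s.real a) }
  | .randN a idx b =>
      { s with
        nat := Function.update s.nat a <| concurrentWrite pick k g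
          (fun i => evalN O s i idx) (fun i => Nat.floor ((U i : ℝ) * (evalN O s i b : ℝ))) (s.nat a) }
  | .randR a idx =>
      { s with
        real := Function.update s.real a <| concurrentWrite pick k g
          (fun i => evalN O s i idx) (fun i => (U i : ℝ)) (s.real a) }
  | .randE a idx =>
      { s with
        real := Function.update s.real a <| concurrentWrite pick k g
          (fun i => evalN O s i idx) (fun i => -Real.log (U i : ℝ)) (s.real a) }

/-- A configuration of the machine: the programs that remain to be executed, the memory, the
number of transitions made, the depth (parallel time) and the number of processors used so far. -/
structure Config where
  todo : List Prog
  store : Store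
  time : ℕ
  depth : ℕ
  procs : ℕ

/-- One transition of the machine. A configuration with nothing left to do has halted. -/
def Config.next (O : Oracle) (r : Resolver) (ω : Tape) (c : Config) : Config :=
  match c.todo with
  | [] => c
  | .skip :: l => { c with todo := l, time := c.time + 1 }
  | .seq p₁ p₂ :: l => { c with todo := p₁ :: p₂ :: l, time := c.time + 1 }
  | .ite e p₁ p₂ :: l =>
      { c with
        todo := (if evalN O c.store 0 e ≠ 0 then p₁ else p₂) :: l
        time := c.time + 1
        depth := c.depth + e.cost + 1 }
  | .loop e p :: l =>
      { c with
        todo := if evalN O c.store 0 e ≠ 0 then p :: .loop e p :: l else l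
        time := c.time + 1
        depth := c.depth + e.cost + 1 }
  | .par e g act :: l =>
      { todo := l
        store := act.exec O (r c.time) (fun i => ω (c.time, i)) c.store
          (evalN O c.store 0 e) (fun i => evalN O c.store i g)
        time := c.time + 1
        depth := c.depth + e.cost + g.cost + act.cost + 1
        procs := max c.procs (evalN O c.store 0 e) }

/-- The configuration after `N` transitions, for program `A` and initial memory `s`. -/
def run (A : Prog) (O : Oracle) (r : Resolver) (ω : Tape) (s : Store) (N : ℕ) : Config :=
  (Config.next O r ω)^[N] ⟨[A], s, 0, 0, 1⟩

/-- The run halts in configuration `c`. -/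
def HaltsIn (A : Prog) (O : Oracle) (r : Resolver) (ω : Tape) (s : Store) (c : Config) : Prop :=
  c.todo = [] ∧ ∃ N, run A O r ω s N = c

end PRAM

namespace SingleSite

variable {n q m : ℕ}

/-! ### Single-site dynamics -/

/-- The inclusive neighbourhood of `v`. -/
abbrev Nbhd (G : SimpleGraph (Fin n)) (v : Fin n) : Type := {u : Fin n // u = v ∨ G.Adj v u}

/-- Local update distributions: a distribution on the spins for every site `v` and every
configuration on the inclusive neighbourhood of `v`. -/
abbrev LocalRule (G : SimpleGraph (Fin n)) (q : ℕ) : Type :=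
  ∀ v : Fin n, (Nbhd G v → Fin q) → PMF (Fin q)

/-- Total variation distance. -/
def tvDist (μ ν : PMF (Fin q)) : ℝ := (1 / 2) * ∑ x, |(μ x).toReal - (ν x).toReal|

/-- Dobrushin's influence matrix. -/
def influence {G : SimpleGraph (Fin n)} (P : LocalRule G q) : Matrix (Fin n) (Fin n) ℝ :=
  fun u v =>
    ⨆ a : {a : (Nbhd G v → Fin q) × (Nbhd G v → Fin q) //
        ∀ w : Nbhd G v, (w : Fin n) ≠ u → a.1 w = a.2 w},
      tvDist (P v a.1.1) (P v a.1.2)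

/-- The operator norm of a matrix that is induced by the `ℓ_p` norm. -/
def lpOpNorm (p : ℝ≥0∞) (M : Matrix (Fin n) (Fin n) ℝ) : ℝ≥0∞ :=
  ⨆ x : {x : Fin n → ℝ // x ≠ 0},
    ENNReal.ofReal (‖(WithLp.toLp p (M.mulVec x.1) : PiLp p fun _ : Fin n => ℝ)‖ /
      ‖(WithLp.toLp p x.1 : PiLp p fun _ : Fin n => ℝ)‖)

/-! ### The continuous-time dynamics

Site `v` carries a rate-`1` Poisson clock: the waiting times `g (v, 0), g (v, 1), ...` between its
rings are independent exponential variables of rate `1`. The spin that site `v` takes at ring `i`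
when the configuration on its inclusive neighbourhood is `τ` is a draw `z ⟨v, i, τ⟩` from `P v τ`;
all waiting times and all draws are independent. -/

/-- The waiting times of all clocks. -/
abbrev Gaps (n : ℕ) : Type := Fin n × ℕ → ℝ

/-- The draws for all rings and all configurations that the neighbourhood could have. -/
abbrev Draws (G : SimpleGraph (Fin n)) (q : ℕ) : Type :=
  (Σ v : Fin n, ℕ × (Nbhd G v → Fin q)) → Fin q

instance expMeasure_one_isProbabilityMeasure : IsProbabilityMeasure (expMeasure 1) :=
  isProbabilityMeasure_expMeasure one_pos

/-- The joint distribution of the clocks and of the draws. -/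
def dynMeasure {G : SimpleGraph (Fin n)} (P : LocalRule G q) : Measure (Gaps n × Draws G q) :=
  (Measure.infinitePi fun _ : Fin n × ℕ => expMeasure 1).prod
    (Measure.infinitePi fun a : (Σ v : Fin n, ℕ × (Nbhd G v → Fin q)) =>
      (P a.1 a.2.2).toMeasure)

/-- The time of ring `i` (counted from `0`) of the clock at site `v`. -/
def ringTime (g : Gaps n) (a : Fin n × ℕ) : ℝ := ∑ j ∈ Finset.range (a.2 + 1), g (a.1, j)

open Classical in
/-- The rings up to time `t` in the order of time. (Almost surely there are finitely many and
no two are at the same time; the list is empty if there are infinitely many.) -/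
def ringList (g : Gaps n) (t : ℝ) : List (Fin n × ℕ) :=
  if h : {a : Fin n × ℕ | ringTime g a ≤ t}.Finite
  then h.toFinset.toList.insertionSort (fun a b => ringTime g a ≤ ringTime g b)
  else []

/-- The update of site `a.1` at its ring number `a.2`. -/
def redraw {G : SimpleGraph (Fin n)} (z : Draws G q) (σ : Fin n → Fin q) (a : Fin n × ℕ) :
    Fin n → Fin q :=
  Function.update σ a.1 (z ⟨a.1, a.2, fun u => σ u.1⟩)

/-- The continuous-time single-site dynamics started from `X₀`: the configuration at time `t`. -/
def state {G : SimpleGraph (Fin n)} (X₀ : Fin n → Fin q) (t : ℝ)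
    (w : Gaps n × Draws G q) : Fin n → Fin q :=
  (ringList w.1 t).foldl (redraw w.2) X₀

/-! ### Input and output of an algorithm -/

/-- `E` lists every edge of `G` exactly once, in any order and with any orientation. -/
def IsEdgeList (G : SimpleGraph (Fin n)) (E : Fin m → Fin n × Fin n) : Prop :=
  Function.Injective (fun e => s((E e).1, (E e).2)) ∧
    Set.range (fun e => s((E e).1, (E e).2)) = G.edgeSet

/-- The evaluation oracle: it returns the probability of `x` under `P v τ`. It looks at `τ` only
on the inclusive neighbourhood of `v`, and returns `0` on meaningless queries. -/
def oracle {G : SimpleGraph (Fin n)} (P : LocalRule G q) : PRAM.Oracle := fun v τ x =>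
  open Classical in
  if h : ∃ (hv : v < n) (_ : x < q), ∀ u : Nbhd G ⟨v, hv⟩, τ u.1 < q
  then (P ⟨v, h.1⟩ (fun u => ⟨τ u.1, h.2.2 u⟩) ⟨x, h.2.1⟩).toReal
  else 0

/-- The array of numbers that starts with the given `k` entries and is `0` elsewhere. -/
def pad {k : ℕ} (f : Fin k → ℕ) : ℕ → ℕ := fun i => if h : i < k then f ⟨i, h⟩ else 0

/-- The initial memory. Integer array `0` holds `n`, `q`, `m`, integer array `1` holds the initial
configuration, integer arrays `2` and `3` hold the endpoints of the edges, and cell `0` of real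
array `0` holds the time `T`. All other cells are `0`. -/
def input (X₀ : Fin n → Fin q) (E : Fin m → Fin n × Fin n) (T : ℝ) : PRAM.Store where
  nat := fun a => match a with
    | 0 => pad ![n, q, m]
    | 1 => pad fun v => (X₀ v : ℕ)
    | 2 => pad fun e => ((E e).1 : ℕ)
    | 3 => pad fun e => ((E e).2 : ℕ)
    | _ => fun _ => 0
  real := fun a i => if a = 0 ∧ i = 0 then T else 0

/-- The output is read from the first `n` cells of integer array `1`. -/
def Outputs (c : PRAM.Config) (σ : Fin n → Fin q) : Prop := ∀ v : Fin n, c.store.nat 1 v = σ v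

end SingleSite

end

/-!
The algorithm generates, for every site, the times at which its clock rings up to time `T`, and for every
ring one independent exponential variable per spin. A ring at `v` that sees the configuration `τ` chooses
the spin `x` for which the exponential variable divided by `P v τ x` is smallest; by the usual race of
exponential clocks this is a draw from `P v τ`. The same variables serve all `τ`. Once they are fixed,
the dynamics is the solution of a system of equations, one for each ring, that expresses the spin after
the ring by earlier spins (`truth`, `state_eq_truth`).

Time is divided into phases of length at most `⌈log₂ n⌉ + 1`, shortened by halving until no site rings
more often in a phase than that. In each phase, all the spins after its rings are guessed, and all the
equations are evaluated in parallel, over and over again (`sweep`), until nothing changes. When this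
happens, the guesses solve the system, whose solution is unique (`iterate_sweep_guess_of_settled`), so the
output is exact for almost every realization of the random numbers (`algorithm_spec`, `ae_haltsIn`). Since
a ring sees only one configuration, it does not matter for the law of the output that the draws for
different configurations are dependent (`prod_race_state_eq`, `tapeMeasure_outputs`).

The running time depends on the number of sweeps. Two races with the same exponential variables have
different winners with probability at most twice the total variation distance of the two distributions
(`expVector_winner_ne`). If two successive sweeps disagree at a ring, the two before them therefore
disagreed at an earlier ring that influences it, and so on: a disagreement after `l` sweeps gives rise to a
chain of rings with increasing times, weighted by influences (`raceMeasure_guesses_ne_le`). As the clocks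
have rate `1`, the expected weight of the chains in a window of length `t` is `t ^ l / l!` times entries
of powers of twice the influence matrix (`lintegral_chainSum_le`), which are at most
`n ^ 2 * (2 * C) ^ l` in total, in whichever of the `ℓ_p` norms the matrix is bounded by `C`
(`sum_chainCoeff_le`). So a multiple of `log n` sweeps per phase suffices with high probability, without
any assumption that `C` is small.

The bound on chains, with the identity in place of the influence matrix, also controls the number of rings
of a clock in a window (`gapMeasure_rings_le`). It shows that phases are shortened only by a constant
factor, so that there are `O(T / log n + 1)` of them (`failure_le`, `tapeMeasure_resources`).
-/


/-! ### A program logic for the machine -/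

noncomputable section

namespace PRAM

/-- The memory after integer array `a` has been replaced by `A`. -/
def Store.putNat (s : Store) (a : ℕ) (A : ℕ → ℕ) : Store :=
  { s with nat := Function.update s.nat a A }

/-- The memory after real array `a` has been replaced by `A`. -/
def Store.putReal (s : Store) (a : ℕ) (A : ℕ → ℝ) : Store :=
  { s with real := Function.update s.real a A }

@[simp] lemma Store.putNat_nat (s : Store) (a b : ℕ) (A : ℕ → ℕ) :
    (s.putNat a A).nat b = if b = a then A else s.nat b := by
  simp [Store.putNat, Function.update_apply]

@[simp] lemma Store.putNat_real (s : Store) (a : ℕ) (A : ℕ → ℕ) :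
    (s.putNat a A).real = s.real := rfl

@[simp] lemma Store.putReal_real (s : Store) (a b : ℕ) (A : ℕ → ℝ) :
    (s.putReal a A).real b = if b = a then A else s.real b := by
  simp [Store.putReal, Function.update_apply]

@[simp] lemma Store.putReal_nat (s : Store) (a : ℕ) (A : ℕ → ℝ) :
    (s.putReal a A).nat = s.nat := rfl

instance (k : ℕ) : OfNat (Expr .nat) k := ⟨.lit k⟩
instance : Add (Expr .nat) := ⟨.add⟩
instance : Sub (Expr .nat) := ⟨.monus⟩
instance : Mul (Expr .nat) := ⟨.mul⟩
instance : Div (Expr .nat) := ⟨.quo⟩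
instance : Mod (Expr .nat) := ⟨.rem⟩
instance : Add (Expr .real) := ⟨.addR⟩
instance : Mul (Expr .real) := ⟨.mulR⟩
instance : Div (Expr .real) := ⟨.divR⟩

/-- Negation of a condition. -/
def Expr.not (x : Expr .nat) : Expr .nat := 1 - x

section Eval

variable (O : Oracle) (s : Store) (i : ℕ)

@[simp] lemma evalN_ofNat (k : ℕ) : evalN O s i (ofNat(k) : Expr .nat) = ofNat(k) := rfl
@[simp] lemma evalN_pid : evalN O s i .pid = i := rfl
@[simp] lemma evalN_readN (a : ℕ) (j : Expr .nat) :
    evalN O s i (.readN a j) = s.nat a (evalN O s i j) := rfl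
@[simp] lemma evalN_add (x y : Expr .nat) :
    evalN O s i (x + y) = evalN O s i x + evalN O s i y := rfl
@[simp] lemma evalN_sub (x y : Expr .nat) :
    evalN O s i (x - y) = evalN O s i x - evalN O s i y := rfl
@[simp] lemma evalN_mul (x y : Expr .nat) :
    evalN O s i (x * y) = evalN O s i x * evalN O s i y := rfl
@[simp] lemma evalN_div (x y : Expr .nat) :
    evalN O s i (x / y) = evalN O s i x / evalN O s i y := rfl
@[simp] lemma evalN_mod (x y : Expr .nat) :
    evalN O s i (x % y) = evalN O s i x % evalN O s i y := rfl
@[simp] lemma evalN_ltN (x y : Expr .nat) :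
    evalN O s i (.ltN x y) = if evalN O s i x < evalN O s i y then 1 else 0 := rfl
open Classical in
@[simp] lemma evalN_ltR (x y : Expr .real) :
    evalN O s i (.ltR x y) = if evalR O s i x < evalR O s i y then 1 else 0 := rfl
@[simp] lemma evalN_not (x : Expr .nat) :
    evalN O s i x.not = if evalN O s i x = 0 then 1 else 0 := by
  change 1 - evalN O s i x = _
  split_ifs <;> omega
@[simp] lemma evalR_ofNat (x : Expr .nat) : evalR O s i (.ofNat x) = (evalN O s i x : ℝ) := rfl
@[simp] lemma evalR_readR (a : ℕ) (j : Expr .nat) :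
    evalR O s i (.readR a j) = s.real a (evalN O s i j) := rfl
@[simp] lemma evalR_add (x y : Expr .real) :
    evalR O s i (x + y) = evalR O s i x + evalR O s i y := rfl
@[simp] lemma evalR_mul (x y : Expr .real) :
    evalR O s i (x * y) = evalR O s i x * evalR O s i y := rfl
@[simp] lemma evalR_div (x y : Expr .real) :
    evalR O s i (x / y) = evalR O s i x / evalR O s i y := rfl
@[simp] lemma evalR_query (v : Expr .nat) (a : ℕ) (b x : Expr .nat) :
    evalR O s i (.query v a b x) =
      O (evalN O s i v) (fun u => s.nat a (evalN O s i b + u)) (evalN O s i x) := rfl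

end Eval

lemma concurrentWrite_of_writer {α : Type}
    {pick : ℕ → ∀ S : Finset ℕ, S.Nonempty → {i : ℕ // i ∈ S}} {k : ℕ} {g idx : ℕ → ℕ}
    {val old : ℕ → α}
    (hcons : ∀ i < k, ∀ j < k, g i ≠ 0 → g j ≠ 0 → idx i = idx j → val i = val j)
    {i : ℕ} (hi : i < k) (hg : g i ≠ 0) :
    concurrentWrite pick k g idx val old (idx i) = val i := by
  unfold concurrentWrite
  have h : ((Finset.range k).filter fun i' => g i' ≠ 0 ∧ idx i' = idx i).Nonempty :=
    ⟨i, by simp [hi, hg]⟩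
  have hm := (pick (idx i) _ h).2
  rw [Finset.mem_filter, Finset.mem_range] at hm
  rw [dif_pos h]
  exact hcons _ hm.1 _ hi hm.2.1 hg hm.2.2

lemma concurrentWrite_of_no_writer {α : Type}
    {pick : ℕ → ∀ S : Finset ℕ, S.Nonempty → {i : ℕ // i ∈ S}} {k : ℕ} {g idx : ℕ → ℕ}
    {val old : ℕ → α} {j : ℕ} (hj : ∀ i < k, g i ≠ 0 → idx i ≠ j) :
    concurrentWrite pick k g idx val old j = old j := by
  unfold concurrentWrite
  rw [dif_neg]
  rintro ⟨i, hi⟩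
  rw [Finset.mem_filter, Finset.mem_range] at hi
  exact hj i hi.1 hi.2.1 hi.2.2

variable (O : Oracle) (r : Resolver) (ω : Tape)

/-- The machine gets from one configuration to another. -/
def Reach (c c' : Config) : Prop := ∃ N, (Config.next O r ω)^[N] c = c'

variable {O r ω}

lemma Reach.trans {c₁ c₂ c₃ : Config} (h₁ : Reach O r ω c₁ c₂) (h₂ : Reach O r ω c₂ c₃) :
    Reach O r ω c₁ c₃ := by
  obtain ⟨N, rfl⟩ := h₁
  obtain ⟨N', rfl⟩ := h₂
  exact ⟨N' + N, Function.iterate_add_apply _ _ _ _⟩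

lemma Reach.next (c : Config) : Reach O r ω c (c.next O r ω) := ⟨1, rfl⟩

/-- The unit in which depth is counted: no statement of the programs below costs more. -/
def unitCost : ℕ := 1000

variable (O r ω)

/-- Started at time `t` in memory `s`, the program `p` terminates, its depth is at most `D` units,
it uses at most `K` processors, and the resulting memory and time satisfy `Q`. -/
def Triple (p : Prog) (s : Store) (t D K : ℕ) (Q : Store → ℕ → Prop) : Prop :=
  ∃ s' t' d k, d ≤ unitCost * D ∧ k ≤ K ∧ Q s' t' ∧
    ∀ l d₀ k₀, Reach O r ω ⟨p :: l, s, t, d₀, k₀⟩ ⟨l, s', t', d₀ + d, max k₀ k⟩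

variable {O r ω}

lemma Triple.mono {p : Prog} {s : Store} {t D D' K : ℕ} {Q Q' : Store → ℕ → Prop}
    (h : Triple O r ω p s t D K Q) (hD : D ≤ D') (hQ : ∀ s t, Q s t → Q' s t) :
    Triple O r ω p s t D' K Q' := by
  obtain ⟨s', t', d, k, hd, hk, hq, hr⟩ := h
  exact ⟨s', t', d, k, hd.trans (Nat.mul_le_mul_left _ hD), hk, hQ _ _ hq, hr⟩

lemma Triple.haltsIn {p : Prog} {s : Store} {D K : ℕ} {Q : Store → ℕ → Prop}
    (h : Triple O r ω p s 0 D K Q) :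
    ∃ c, HaltsIn p O r ω s c ∧ Q c.store c.time ∧ c.depth ≤ unitCost * D ∧ c.procs ≤ max 1 K := by
  obtain ⟨s', t', d, k, hd, hk, hq, hr⟩ := h
  obtain ⟨N, hN⟩ := hr [] 0 1
  exact ⟨_, ⟨rfl, N, hN⟩, hq, by simpa using hd, max_le_max_left 1 hk⟩

/-- A program has at most one final configuration: the machine stays where it has halted. -/
lemma HaltsIn.unique {p : Prog} {s : Store} {c c' : Config} (h : HaltsIn p O r ω s c)
    (h' : HaltsIn p O r ω s c') : c = c' := by
  have key : ∀ (c : Config), c.todo = [] → ∀ k, (Config.next O r ω)^[k] c = c := by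
    intro c hc k
    apply Function.iterate_fixed
    unfold Config.next
    simp [hc]
  obtain ⟨h1, N, hN⟩ := h
  obtain ⟨h1', N', hN'⟩ := h'
  unfold run at hN hN'
  rcases le_total N N' with hle | hle
  · obtain ⟨k, rfl⟩ := Nat.exists_eq_add_of_le' hle
    rw [Function.iterate_add_apply, hN, key c h1] at hN'
    exact hN'
  · obtain ⟨k, rfl⟩ := Nat.exists_eq_add_of_le' hle
    rw [Function.iterate_add_apply, hN', key c' h1'] at hN
    exact hN.symm

/-- Sequential composition of a list of programs. -/
def Prog.ofList : List Prog → Prog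
  | [] => .skip
  | p :: l => .seq p (Prog.ofList l)

lemma Triple.nil {s : Store} {t D K : ℕ} {Q : Store → ℕ → Prop} (h : Q s (t + 1)) :
    Triple O r ω (Prog.ofList []) s t D K Q :=
  ⟨s, t + 1, 0, 0, Nat.zero_le _, Nat.zero_le _, h, fun l d₀ k₀ => by
    simpa [Config.next, Prog.ofList] using
      Reach.next (O := O) (r := r) (ω := ω) ⟨Prog.skip :: l, s, t, d₀, k₀⟩⟩

lemma Triple.cons {p : Prog} {ps : List Prog} {s : Store} {t D₁ D₂ D K : ℕ}
    {Q₁ Q : Store → ℕ → Prop} (h₁ : Triple O r ω p s (t + 1) D₁ K Q₁)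
    (h₂ : ∀ s' t', Q₁ s' t' → Triple O r ω (Prog.ofList ps) s' t' D₂ K Q)
    (hD : D₁ + D₂ ≤ D) :
    Triple O r ω (Prog.ofList (p :: ps)) s t D K Q := by
  obtain ⟨s₁, t₁, d₁, k₁, hd₁, hk₁, hq₁, hr₁⟩ := h₁
  obtain ⟨s₂, t₂, d₂, k₂, hd₂, hk₂, hq₂, hr₂⟩ := h₂ _ _ hq₁
  refine ⟨s₂, t₂, d₁ + d₂, max k₁ k₂, ?_, max_le hk₁ hk₂, hq₂, fun l d₀ k₀ => ?_⟩
  · calc d₁ + d₂ ≤ unitCost * (D₁ + D₂) := by rw [mul_add]; exact add_le_add hd₁ hd₂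
      _ ≤ _ := Nat.mul_le_mul_left _ hD
  · refine (Reach.next _).trans ?_
    have h := (hr₁ (Prog.ofList ps :: l) d₀ k₀).trans (hr₂ l (d₀ + d₁) (max k₀ k₁))
    rw [max_assoc, add_assoc] at h
    exact h

/-- A parallel step that leads to memory `s'`. -/
lemma Triple.par {e g : Expr .nat} {act : Action} {s s' : Store} {t K : ℕ}
    {Q : Store → ℕ → Prop}
    (hc : e.cost + g.cost + act.cost + 1 ≤ unitCost) (hK : evalN O s 0 e ≤ K)
    (hs : act.exec O (r t) (fun i => ω (t, i)) s (evalN O s 0 e) (fun i => evalN O s i g) = s')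
    (hQ : Q s' (t + 1)) :
    Triple O r ω (.par e g act) s t 1 K Q :=
  ⟨s', t + 1, _, _, hc.trans (by simp), hK, hQ, fun l d₀ k₀ => by
    have h := Reach.next (O := O) (r := r) (ω := ω) ⟨Prog.par e g act :: l, s, t, d₀, k₀⟩
    simp only [Config.next, hs] at h
    simpa only [add_assoc] using h⟩

/-- Concurrent writes to an integer array in which conflicting values agree. -/
lemma Triple.setN {e g idx : Expr .nat} {val : Expr .nat} {a : ℕ} {ps : List Prog} {s : Store}
    {t D K : ℕ} {Q : Store → ℕ → Prop}
    (hc : e.cost + g.cost + (Action.setN a idx val).cost + 1 ≤ unitCost)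
    (hK : evalN O s 0 e ≤ K)
    (hcons : ∀ i < evalN O s 0 e, ∀ j < evalN O s 0 e, evalN O s i g ≠ 0 → evalN O s j g ≠ 0 →
      evalN O s i idx = evalN O s j idx → evalN O s i val = evalN O s j val)
    (h : ∀ A : ℕ → ℕ,
      (∀ i < evalN O s 0 e, evalN O s i g ≠ 0 → A (evalN O s i idx) = evalN O s i val) →
      (∀ j, (∀ i < evalN O s 0 e, evalN O s i g ≠ 0 → evalN O s i idx ≠ j) → A j = s.nat a j) →
      Triple O r ω (Prog.ofList ps) (s.putNat a A) (t + 2) D K Q) :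
    Triple O r ω (Prog.ofList (.par e g (.setN a idx val) :: ps)) s t (D + 1) K Q :=
  Triple.cons (Triple.par (Q := fun s' t' => s' = s.putNat a _ ∧ t' = t + 2) hc hK rfl ⟨rfl, rfl⟩)
    (by
      rintro _ _ ⟨rfl, rfl⟩
      exact h _ (fun i hi hg => concurrentWrite_of_writer hcons hi hg)
        fun j hj => concurrentWrite_of_no_writer hj) (add_comm 1 D).le

lemma Triple.setR {e g idx : Expr .nat} {val : Expr .real} {a : ℕ} {ps : List Prog} {s : Store}
    {t D K : ℕ} {Q : Store → ℕ → Prop}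
    (hc : e.cost + g.cost + (Action.setR a idx val).cost + 1 ≤ unitCost)
    (hK : evalN O s 0 e ≤ K)
    (hcons : ∀ i < evalN O s 0 e, ∀ j < evalN O s 0 e, evalN O s i g ≠ 0 → evalN O s j g ≠ 0 →
      evalN O s i idx = evalN O s j idx → evalR O s i val = evalR O s j val)
    (h : ∀ A : ℕ → ℝ,
      (∀ i < evalN O s 0 e, evalN O s i g ≠ 0 → A (evalN O s i idx) = evalR O s i val) →
      (∀ j, (∀ i < evalN O s 0 e, evalN O s i g ≠ 0 → evalN O s i idx ≠ j) → A j = s.real a j) →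
      Triple O r ω (Prog.ofList ps) (s.putReal a A) (t + 2) D K Q) :
    Triple O r ω (Prog.ofList (.par e g (.setR a idx val) :: ps)) s t (D + 1) K Q :=
  Triple.cons (Triple.par (Q := fun s' t' => s' = s.putReal a _ ∧ t' = t + 2) hc hK rfl ⟨rfl, rfl⟩)
    (by
      rintro _ _ ⟨rfl, rfl⟩
      exact h _ (fun i hi hg => concurrentWrite_of_writer hcons hi hg)
        fun j hj => concurrentWrite_of_no_writer hj) (add_comm 1 D).le

lemma Triple.randE {e g idx : Expr .nat} {a : ℕ} {ps : List Prog} {s : Store}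
    {t D K : ℕ} {Q : Store → ℕ → Prop}
    (hc : e.cost + g.cost + (Action.randE a idx).cost + 1 ≤ unitCost)
    (hK : evalN O s 0 e ≤ K)
    (hcons : ∀ i < evalN O s 0 e, ∀ j < evalN O s 0 e, evalN O s i g ≠ 0 → evalN O s j g ≠ 0 →
      evalN O s i idx = evalN O s j idx → -Real.log (ω (t + 1, i) : ℝ) = -Real.log (ω (t + 1, j) : ℝ))
    (h : ∀ A : ℕ → ℝ,
      (∀ i < evalN O s 0 e, evalN O s i g ≠ 0 → A (evalN O s i idx) = -Real.log (ω (t + 1, i) : ℝ)) →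
      (∀ j, (∀ i < evalN O s 0 e, evalN O s i g ≠ 0 → evalN O s i idx ≠ j) → A j = s.real a j) →
      Triple O r ω (Prog.ofList ps) (s.putReal a A) (t + 2) D K Q) :
    Triple O r ω (Prog.ofList (.par e g (.randE a idx) :: ps)) s t (D + 1) K Q :=
  Triple.cons (Triple.par (Q := fun s' t' => s' = s.putReal a _ ∧ t' = t + 2) hc hK rfl ⟨rfl, rfl⟩)
    (by
      rintro _ _ ⟨rfl, rfl⟩
      exact h _ (fun i hi hg => concurrentWrite_of_writer hcons hi hg)
        fun j hj => concurrentWrite_of_no_writer hj) (add_comm 1 D).le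

/-- Processor `0` sets a register (cell `0` of an integer array). -/
lemma Triple.setReg {val : Expr .nat} {a : ℕ} {ps : List Prog} {s : Store} {t D K : ℕ}
    {Q : Store → ℕ → Prop} (hc : val.cost + 5 ≤ unitCost) (hK : 1 ≤ K)
    (h : ∀ A : ℕ → ℕ, A 0 = evalN O s 0 val →
      Triple O r ω (Prog.ofList ps) (s.putNat a A) (t + 2) D K Q) :
    Triple O r ω (Prog.ofList (.par 1 1 (.setN a 0 val) :: ps)) s t (D + 1) K Q := by
  refine Triple.setN ?_ (by simpa using hK) ?_ fun A hw _ => h A ?_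
  · change 1 + 1 + (1 + val.cost + 1) + 1 ≤ unitCost
    omega
  · intro i hi j hj _ _ _
    rw [evalN_ofNat, Nat.lt_one_iff] at hi hj
    rw [hi, hj]
  · simpa using hw 0 (by simp) (by simp)

/-- Processors with number less than `e` for which `g` holds raise the flag in cell `0` of
integer array `a`. -/
lemma Triple.raise {e g : Expr .nat} {a : ℕ} {ps : List Prog} {s : Store} {t D K : ℕ}
    {Q : Store → ℕ → Prop} (hc : e.cost + g.cost + 4 ≤ unitCost) (hK : evalN O s 0 e ≤ K)
    (h : ∀ A : ℕ → ℕ, (∀ i < evalN O s 0 e, evalN O s i g ≠ 0 → A 0 = 1) →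
      ((∀ i < evalN O s 0 e, evalN O s i g = 0) → A 0 = s.nat a 0) →
      Triple O r ω (Prog.ofList ps) (s.putNat a A) (t + 2) D K Q) :
    Triple O r ω (Prog.ofList (.par e g (.setN a 0 1) :: ps)) s t (D + 1) K Q := by
  refine Triple.setN ?_ hK (fun i _ j _ _ _ _ => by simp) fun A hw ho => h A ?_ ?_
  · change e.cost + g.cost + (1 + 1 + 1) + 1 ≤ unitCost
    omega
  · intro i hi hg
    simpa using hw i hi hg
  · intro hn
    exact ho 0 fun i hi hg => absurd (hn i hi) hg

/-- While loops. The invariant counts the iterations, `N` bounds their number. -/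
lemma Triple.loop {e : Expr .nat} {p : Prog} {s : Store} {t D K : ℕ} {Q : Store → ℕ → Prop}
    (Inv : ℕ → Store → ℕ → Prop) (N : ℕ) (hc : e.cost + 1 ≤ unitCost) (h0 : Inv 0 s t)
    (step : ∀ i s t, Inv i s t → (evalN O s 0 e = 0 ∧ Q s (t + 1)) ∨
      (evalN O s 0 e ≠ 0 ∧ i < N ∧ Triple O r ω p s (t + 1) D K (Inv (i + 1)))) :
    Triple O r ω (.loop e p) s t (N * (D + 1) + 1) K Q := by
  suffices H : ∀ j i s t, i + j = N → Inv i s t →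
      Triple O r ω (.loop e p) s t (j * (D + 1) + 1) K Q from H N 0 s t (zero_add N) h0
  have hexit : ∀ j s t, evalN O s 0 e = 0 → Q s (t + 1) →
      Triple O r ω (.loop e p) s t (j * (D + 1) + 1) K Q := by
    intro j s t h hq
    refine ⟨s, t + 1, e.cost + 1, 0, ?_, Nat.zero_le _, hq, fun l d₀ k₀ => ?_⟩
    · exact hc.trans (Nat.le_mul_of_pos_right _ (Nat.succ_pos _))
    · have := Reach.next (O := O) (r := r) (ω := ω) ⟨Prog.loop e p :: l, s, t, d₀, k₀⟩
      simpa [Config.next, h, add_assoc] using this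
  intro j
  induction j with
  | zero =>
    intro i s t hi hinv
    rcases step i s t hinv with ⟨h, hq⟩ | ⟨_, hlt, _⟩
    · exact hexit 0 s t h hq
    · omega
  | succ j ih =>
    intro i s t hi hinv
    rcases step i s t hinv with ⟨h, hq⟩ | ⟨h, hlt, s₁, t₁, d₁, k₁, hd₁, hk₁, hq₁, hr₁⟩
    · exact hexit _ s t h hq
    · obtain ⟨s₂, t₂, d₂, k₂, hd₂, hk₂, hq₂, hr₂⟩ := ih (i + 1) s₁ t₁ (by omega) hq₁
      refine ⟨s₂, t₂, (e.cost + 1) + d₁ + d₂, max k₁ k₂, ?_, max_le hk₁ hk₂, hq₂,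
        fun l d₀ k₀ => ?_⟩
      · calc (e.cost + 1) + d₁ + d₂
            ≤ unitCost + unitCost * D + unitCost * (j * (D + 1) + 1) := by gcongr
          _ = _ := by ring
      · refine (Reach.next _).trans ?_
        have h' := (hr₁ (Prog.loop e p :: l) (d₀ + (e.cost + 1)) k₀).trans
          (hr₂ l (d₀ + (e.cost + 1) + d₁) (max k₀ k₁))
        rw [max_assoc] at h'
        simpa [Config.next, h, add_assoc] using h'

end PRAM

end


/-! ### The dynamics as a system of equations -/

noncomputable section

namespace SingleSite

variable {n q m : ℕ}

/-- Ring times of all clocks: `S v k` is the time of the `k`-th ring at `v`, counted from `1`, with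
`S v 0 = 0`. The conditions hold almost surely. -/
structure IsClock (S : Fin n → ℕ → ℝ) : Prop where
  zero : ∀ v, S v 0 = 0
  mono : ∀ v, StrictMono (S v)
  unbounded : ∀ v t, ∃ k, t < S v k
  inj : ∀ u v j k, S u (j + 1) = S v (k + 1) → u = v

/-- The number of rings at `u` before time `t`. -/
def before (S : Fin n → ℕ → ℝ) (u : Fin n) (t : ℝ) : ℕ := sInf {k | t ≤ S u (k + 1)}

/-- The number of rings at `u` up to time `t`. -/
def upTo (S : Fin n → ℕ → ℝ) (u : Fin n) (t : ℝ) : ℕ := sInf {k | t < S u (k + 1)}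

namespace IsClock

variable {S : Fin n → ℕ → ℝ} (hS : IsClock S)
include hS

lemma pos (v : Fin n) (k : ℕ) : 0 < S v (k + 1) := by
  rw [← hS.zero v]; exact hS.mono v (Nat.succ_pos k)

lemma lt_before {u : Fin n} {t : ℝ} {k : ℕ} : k < before S u t ↔ S u (k + 1) < t := by
  constructor
  · intro h
    simpa using Nat.notMem_of_lt_sInf h
  · intro h
    by_contra hk
    push Not at hk
    obtain ⟨j, hj⟩ := hS.unbounded u t
    have hne : {k | t ≤ S u (k + 1)}.Nonempty :=
      ⟨j, hj.le.trans ((hS.mono u).monotone (Nat.le_succ j))⟩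
    have h1 : t ≤ S u (before S u t + 1) := Nat.sInf_mem hne
    exact absurd (h1.trans ((hS.mono u).monotone (Nat.succ_le_succ hk))) (not_le.mpr h)

lemma lt_upTo {u : Fin n} {t : ℝ} {k : ℕ} : k < upTo S u t ↔ S u (k + 1) ≤ t := by
  constructor
  · intro h
    simpa using Nat.notMem_of_lt_sInf h
  · intro h
    by_contra hk
    push Not at hk
    obtain ⟨j, hj⟩ := hS.unbounded u t
    have hne : {k | t < S u (k + 1)}.Nonempty :=
      ⟨j, hj.trans_le ((hS.mono u).monotone (Nat.le_succ j))⟩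
    have h1 : t < S u (upTo S u t + 1) := Nat.sInf_mem hne
    exact absurd (h1.trans_le ((hS.mono u).monotone (Nat.succ_le_succ hk))) (not_lt.mpr h)

lemma le_upTo {u : Fin n} {t : ℝ} (ht : 0 ≤ t) {k : ℕ} : k ≤ upTo S u t ↔ S u k ≤ t := by
  rcases k with _ | k
  · simp [hS.zero, ht]
  · exact hS.lt_upTo

lemma le_before {u : Fin n} {t : ℝ} (ht : 0 < t) {k : ℕ} : k ≤ before S u t ↔ S u k < t := by
  rcases k with _ | k
  · simp [hS.zero, ht]
  · exact hS.lt_before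

lemma apply_before_lt {u : Fin n} {t : ℝ} (ht : 0 < t) : S u (before S u t) < t :=
  (hS.le_before ht).1 le_rfl

lemma before_mono {u : Fin n} {s t : ℝ} (h : s ≤ t) : before S u s ≤ before S u t := by
  by_contra hlt
  push Not at hlt
  exact absurd ((hS.lt_before.1 hlt).trans_le h) (fun h' => (lt_irrefl _ (hS.lt_before.2 h')))

lemma before_self (v : Fin n) (i : ℕ) : before S v (S v (i + 1)) = i := by
  apply le_antisymm
  · by_contra h
    push Not at h
    exact lt_irrefl _ (hS.lt_before.1 h)
  · by_contra h
    push Not at h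
    have := hS.lt_before.2 (hS.mono v (Nat.succ_lt_succ h))
    exact lt_irrefl _ this

lemma before_le_upTo {u : Fin n} {s t : ℝ} (h : s ≤ t) : before S u s ≤ upTo S u t := by
  by_contra hlt
  push Not at hlt
  have := hS.lt_before.1 hlt
  exact lt_irrefl _ (hS.lt_upTo.2 (this.le.trans h))

lemma upTo_mono {u : Fin n} {s t : ℝ} (h : s ≤ t) : upTo S u s ≤ upTo S u t := by
  by_contra hlt
  push Not at hlt
  exact lt_irrefl _ (hS.lt_upTo.2 ((hS.lt_upTo.1 hlt).trans h))

lemma upTo_zero (u : Fin n) : upTo S u 0 = 0 := by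
  by_contra h
  exact absurd (hS.lt_upTo.1 (Nat.pos_of_ne_zero h)) (not_le.mpr (hS.pos u 0))

end IsClock

/-- One synchronous sweep over all rings. `F v k` is the current guess of the spin of `v` after its
`k`-th ring; the ring `k = i + 1` applies the update function `f v i` to the configuration that the
guesses predict just before that ring. -/
def sweep (S : Fin n → ℕ → ℝ) (f : Fin n → ℕ → (Fin n → Fin q) → Fin q)
    (F : Fin n → ℕ → Fin q) : Fin n → ℕ → Fin q
  | v, 0 => F v 0
  | v, i + 1 => f v i fun u => F u (before S u (S v (i + 1)))

variable (S : Fin n → ℕ → ℝ) (f : Fin n → ℕ → (Fin n → Fin q) → Fin q)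

/-- The number of rings, at all sites, strictly before the `k`-th ring at `v`. -/
def depthOf (v : Fin n) (k : ℕ) : ℕ := ∑ u, before S u (S v k)

/-- The spin of `v` after its `k`-th ring, in the dynamics started from `X₀`. A value is settled once
more sweeps have been made than there are rings before it, so the number of sweeps in the definition
is large enough, and the result satisfies the equations `truth_zero` and `truth_succ`. -/
def truth (X₀ : Fin n → Fin q) (v : Fin n) (k : ℕ) : Fin q :=
  (sweep S f)^[depthOf S v k + 1] (fun v _ => X₀ v) v k

/-- The correct spins up to time `b`, followed by the guess `z₀`. -/
def guess (X₀ : Fin n → Fin q) (z₀ : Fin q) (b : ℝ) (v : Fin n) (k : ℕ) : Fin q :=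
  open Classical in if S v k ≤ b then truth S f X₀ v k else z₀

variable {S f}

lemma iterate_sweep_zero (F : Fin n → ℕ → Fin q) (r : ℕ) (v : Fin n) :
    (sweep S f)^[r] F v 0 = F v 0 := by
  induction r with
  | zero => rfl
  | succ r ih => rw [Function.iterate_succ_apply']; exact ih

lemma iterate_sweep_succ (F : Fin n → ℕ → Fin q) (r : ℕ) (v : Fin n) (i : ℕ) :
    (sweep S f)^[r + 1] F v (i + 1) =
      f v i fun u => (sweep S f)^[r] F u (before S u (S v (i + 1))) := by
  rw [Function.iterate_succ_apply']; rfl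

lemma depthOf_before_lt (hS : IsClock S) {u v : Fin n} {i : ℕ}
    (h : before S u (S v (i + 1)) ≠ 0) :
    depthOf S u (before S u (S v (i + 1))) < depthOf S v (i + 1) := by
  have hlt := hS.apply_before_lt (u := u) (hS.pos v i)
  refine Finset.sum_lt_sum (fun w _ => hS.before_mono hlt.le) ⟨u, Finset.mem_univ _, ?_⟩
  obtain ⟨j, hj⟩ := Nat.exists_eq_succ_of_ne_zero h
  have h1 : before S u (S u (before S u (S v (i + 1)))) = j := by
    rw [hj]; exact hS.before_self u j
  omega

/-- The sweeps determine a value once there are more of them than rings before it. -/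
lemma iterate_sweep_eq (hS : IsClock S) {F F' : Fin n → ℕ → Fin q} (h0 : ∀ v, F v 0 = F' v 0) :
    ∀ (N : ℕ) (v : Fin n) (k r r' : ℕ), depthOf S v k ≤ N → N < r → N < r' →
      (sweep S f)^[r] F v k = (sweep S f)^[r'] F' v k := by
  intro N
  induction N using Nat.strong_induction_on with
  | _ N ih =>
    intro v k r r' hd hr hr'
    rcases k with _ | i
    · rw [iterate_sweep_zero, iterate_sweep_zero, h0]
    obtain ⟨r, rfl⟩ := Nat.exists_eq_succ_of_ne_zero (by omega : r ≠ 0)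
    obtain ⟨r', rfl⟩ := Nat.exists_eq_succ_of_ne_zero (by omega : r' ≠ 0)
    rw [iterate_sweep_succ, iterate_sweep_succ]
    congr 1
    funext u
    by_cases hb : before S u (S v (i + 1)) = 0
    · rw [hb, iterate_sweep_zero, iterate_sweep_zero, h0]
    · have hlt := depthOf_before_lt hS hb
      exact ih (depthOf S u (before S u (S v (i + 1)))) (by omega) _ _ _ _ le_rfl
        (by omega) (by omega)

section Truth

variable {X₀ : Fin n → Fin q} {z₀ : Fin q}

lemma truth_zero (v : Fin n) : truth S f X₀ v 0 = X₀ v := by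
  rw [truth, iterate_sweep_zero]

lemma truth_succ (hS : IsClock S) (v : Fin n) (i : ℕ) :
    truth S f X₀ v (i + 1) = f v i fun u => truth S f X₀ u (before S u (S v (i + 1))) := by
  unfold truth
  rw [iterate_sweep_succ]
  congr 1
  funext u
  by_cases hb : before S u (S v (i + 1)) = 0
  · rw [hb, iterate_sweep_zero, iterate_sweep_zero]
  · exact iterate_sweep_eq hS (fun _ => rfl) _ _ _ _ _ le_rfl (depthOf_before_lt hS hb)
      (Nat.lt_succ_self _)

lemma guess_zero (hS : IsClock S) {b : ℝ} (hb : 0 ≤ b) (v : Fin n) :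
    guess S f X₀ z₀ b v 0 = X₀ v := by
  rw [guess, if_pos (by rw [hS.zero]; exact hb), truth_zero]

lemma guess_of_le {b : ℝ} {v : Fin n} {k : ℕ} (h : S v k ≤ b) :
    guess S f X₀ z₀ b v k = truth S f X₀ v k := if_pos h

lemma guess_of_lt {b : ℝ} {v : Fin n} {k : ℕ} (h : b < S v k) :
    guess S f X₀ z₀ b v k = z₀ := if_neg (not_le.mpr h)

/-- Sweeps do not spoil the values that are correct from the beginning. -/
lemma iterate_sweep_guess_of_le (hS : IsClock S) {b : ℝ} (r : ℕ) {v : Fin n} {k : ℕ}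
    (h : S v k ≤ b) :
    (sweep S f)^[r] (guess S f X₀ z₀ b) v k = truth S f X₀ v k := by
  induction r generalizing v k with
  | zero => exact guess_of_le h
  | succ r ih =>
    rcases k with _ | i
    · rw [iterate_sweep_zero, guess_of_le h]
    · rw [iterate_sweep_succ, truth_succ hS]
      congr 1
      funext u
      exact ih ((hS.apply_before_lt (hS.pos v i)).le.trans h)

/-- However wrong the guesses are, sufficiently many sweeps correct them. -/
lemma iterate_sweep_guess_of_depth (hS : IsClock S) {b : ℝ} (hb : 0 ≤ b) {r : ℕ} {v : Fin n}
    {k : ℕ} (h : depthOf S v k < r) :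
    (sweep S f)^[r] (guess S f X₀ z₀ b) v k = truth S f X₀ v k :=
  iterate_sweep_eq hS (fun v => guess_zero hS hb v) _ _ _ _ _ le_rfl h (Nat.lt_succ_self _)

/-- A sweep that changes nothing up to time `b'` shows that the guesses are correct up to `b'`. -/
lemma iterate_sweep_guess_of_settled (hS : IsClock S) {b b' : ℝ} (hb : 0 ≤ b) {r : ℕ}
    (h : ∀ v k, S v k ≤ b' → (sweep S f)^[r + 1] (guess S f X₀ z₀ b) v k =
      (sweep S f)^[r] (guess S f X₀ z₀ b) v k) {v : Fin n} {k : ℕ} (hk : S v k ≤ b') :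
    (sweep S f)^[r] (guess S f X₀ z₀ b) v k = truth S f X₀ v k := by
  have key : ∀ j v k, S v k ≤ b' → (sweep S f)^[r + j] (guess S f X₀ z₀ b) v k =
      (sweep S f)^[r] (guess S f X₀ z₀ b) v k := by
    intro j
    induction j with
    | zero => intro v k _; rfl
    | succ j ih =>
      intro v k hk
      rcases k with _ | i
      · rw [iterate_sweep_zero, iterate_sweep_zero]
      · rw [← h v _ hk, ← add_assoc, iterate_sweep_succ, iterate_sweep_succ]
        congr 1
        funext u
        exact ih u _ ((hS.apply_before_lt (hS.pos v i)).le.trans hk)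
  rw [← key (depthOf S v k + 1) v k hk]
  exact iterate_sweep_guess_of_depth hS hb (by omega)

/-- The guesses for the rings up to time `t` depend only on the updates up to time `t`. -/
lemma iterate_sweep_congr (hS : IsClock S) {f' : Fin n → ℕ → (Fin n → Fin q) → Fin q}
    {F F' : Fin n → ℕ → Fin q} {t : ℝ} (hf : ∀ u j, S u (j + 1) ≤ t → f u j = f' u j)
    (hF : ∀ u k, S u k ≤ t → F u k = F' u k) (r : ℕ) {v : Fin n} {k : ℕ} (hk : S v k ≤ t) :
    (sweep S f)^[r] F v k = (sweep S f')^[r] F' v k := by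
  induction r generalizing v k with
  | zero => exact hF v k hk
  | succ r ih =>
    rcases k with _ | i
    · rw [iterate_sweep_zero, iterate_sweep_zero, hF v 0 hk]
    · rw [iterate_sweep_succ, iterate_sweep_succ, hf v i hk]
      congr 1
      funext u
      exact ih ((hS.apply_before_lt (hS.pos v i)).le.trans hk)

lemma iterate_sweep_guess_congr (hS : IsClock S)
    {f' : Fin n → ℕ → (Fin n → Fin q) → Fin q} {t b : ℝ}
    (hf : ∀ u j, S u (j + 1) ≤ t → f u j = f' u j) (r : ℕ) {v : Fin n} {k : ℕ}
    (hk : S v k ≤ t) :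
    (sweep S f)^[r] (guess S f X₀ z₀ b) v k = (sweep S f')^[r] (guess S f' X₀ z₀ b) v k := by
  refine iterate_sweep_congr hS hf (fun u j hj => ?_) r hk
  unfold guess
  split_ifs
  · exact iterate_sweep_congr hS hf (fun _ _ _ => rfl) _ hj
  · rfl

end Truth

/-- The update function that applies the draws `z`. -/
def drawRule {G : SimpleGraph (Fin n)} (z : Draws G q) (v : Fin n) (i : ℕ)
    (σ : Fin n → Fin q) : Fin q := z ⟨v, i, fun u => σ u.1⟩

/-- The times of the rings as sums of waiting times. -/
def clock (g : Gaps n) (v : Fin n) (k : ℕ) : ℝ := ∑ j ∈ Finset.range k, g (v, j)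

lemma ringTime_eq_clock (g : Gaps n) (a : Fin n × ℕ) : ringTime g a = clock g a.1 (a.2 + 1) := rfl

/-- Performing the first `c u` updates of every site `u` in the order of their times gives the solution
of the system of equations. The list `l` is required to be closed under passing to earlier rings. -/
lemma foldl_redraw_eq_truth {G : SimpleGraph (Fin n)} {g : Gaps n} (hS : IsClock (clock g))
    (z : Draws G q) (X₀ : Fin n → Fin q) (l : List (Fin n × ℕ)) :
    ∀ c : Fin n → ℕ, l.Pairwise (fun a b => ringTime g a < ringTime g b) →
      (∀ b ∈ l, ∀ a, ringTime g a < ringTime g b → a ∈ l) →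
      (∀ u j, (u, j) ∈ l ↔ j < c u) →
      ∀ v, l.foldl (redraw z) X₀ v = truth (clock g) (drawRule z) X₀ v (c v) := by
  induction l using List.reverseRecOn with
  | nil =>
    intro c _ _ hc v
    have : c v = 0 := by
      by_contra h
      simpa using (hc v 0).2 (Nat.pos_of_ne_zero h)
    rw [this, truth_zero]
    rfl
  | append_singleton l a ih =>
    intro c hp hd hc v
    obtain ⟨w, i⟩ := a
    rw [List.pairwise_append] at hp
    have hlast : ∀ b ∈ l, ringTime g b < ringTime g (w, i) := fun b hb =>
      hp.2.2 b hb _ (by simp)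
    have hmem : ∀ b, b ∈ l ↔ ringTime g b < ringTime g (w, i) := by
      refine fun b => ⟨hlast b, fun h => ?_⟩
      have := hd (w, i) (by simp) b h
      simp only [List.mem_append, List.mem_singleton] at this
      rcases this with h' | rfl
      · exact h'
      · exact absurd h (lt_irrefl _)
    have hcw : c w = i + 1 := by
      have h1 : i < c w := (hc w i).1 (by simp)
      have h2 : ¬ i + 1 < c w := fun h => by
        have h3 := (hc w (i + 1)).2 h
        simp only [List.mem_append, List.mem_singleton, Prod.mk.injEq, true_and] at h3
        rcases h3 with h3 | h3
        · have h4 := hlast _ h3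
          rw [ringTime_eq_clock, ringTime_eq_clock] at h4
          exact absurd h4 (not_lt.mpr ((hS.mono w).monotone (by simp)))
        · omega
      omega
    have hbef : ∀ u, before (clock g) u (clock g w (i + 1)) = Function.update c w i u := by
      intro u
      have hlt : ∀ j, j < before (clock g) u (clock g w (i + 1)) ↔ (u, j) ∈ l := fun j => by
        rw [hS.lt_before, hmem]; rfl
      have hlt' : ∀ j, (u, j) ∈ l ↔ j < Function.update c w i u := by
        intro j
        have h1 := hc u j
        simp only [List.mem_append, List.mem_singleton, Prod.mk.injEq] at h1
        by_cases huw : u = w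
        · subst huw
          rw [Function.update_self]
          have h3 : j = i → (u, j) ∉ l := by
            rintro rfl hin
            exact lt_irrefl _ (hlast _ hin)
          constructor
          · intro h
            have := h1.1 (Or.inl h)
            by_contra hji
            exact h3 (by omega) h
          · intro h
            rcases h1.2 (by omega) with h' | ⟨-, h'⟩
            · exact h'
            · omega
        · rw [Function.update_of_ne huw, ← h1]
          simp [huw]
      have h : ∀ j, j < before (clock g) u (clock g w (i + 1)) ↔ j < Function.update c w i u :=
        fun j => (hlt j).trans (hlt' j)
      have h1 := h (before (clock g) u (clock g w (i + 1)))
      have h2 := h (Function.update c w i u)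
      omega
    have hl := ih (Function.update c w i) hp.1
      (fun b hb a ha => (hmem a).2 (ha.trans (hlast b hb)))
      (fun u j => by rw [← hbef, hS.lt_before, hmem]; rfl)
    rw [List.foldl_append, List.foldl_cons, List.foldl_nil]
    simp only [redraw]
    by_cases hv : v = w
    · subst hv
      rw [Function.update_self, hcw, truth_succ hS, drawRule]
      congr 3
      funext u
      rw [hl, hbef]
    · rw [Function.update_of_ne hv, hl, Function.update_of_ne hv]

/-- The configuration at time `T` in terms of the system of equations. -/
lemma state_eq_truth {G : SimpleGraph (Fin n)} {w : Gaps n × Draws G q}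
    (hS : IsClock (clock w.1)) (X₀ : Fin n → Fin q) (T : ℝ) (v : Fin n) :
    state X₀ T w v = truth (clock w.1) (drawRule w.2) X₀ v (upTo (clock w.1) v T) := by
  classical
  have hfin : {a : Fin n × ℕ | ringTime w.1 a ≤ T}.Finite := by
    refine Set.Finite.subset (s := ⋃ u : Fin n, (fun j => (u, j)) '' Set.Iio (upTo (clock w.1) u T))
      (Set.finite_iUnion fun u => (Set.finite_Iio _).image _) ?_
    rintro ⟨u, j⟩ h
    exact Set.mem_iUnion.2 ⟨u, j, hS.lt_upTo.2 h, rfl⟩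
  have hinj : ∀ a b : Fin n × ℕ, ringTime w.1 a = ringTime w.1 b → a = b := by
    rintro ⟨u, j⟩ ⟨v, k⟩ h
    obtain rfl := hS.inj u v j k h
    have := (hS.mono u).injective h
    simp_all
  have hmem : ∀ a, a ∈ ringList w.1 T ↔ ringTime w.1 a ≤ T := by
    intro a
    rw [ringList, dif_pos hfin, List.mem_insertionSort]
    simp
  have hsort : (ringList w.1 T).Pairwise (fun a b => ringTime w.1 a < ringTime w.1 b) := by
    rw [ringList, dif_pos hfin]
    have : Std.Total (fun a b : Fin n × ℕ => ringTime w.1 a ≤ ringTime w.1 b) :=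
      ⟨fun a b => le_total _ _⟩
    have : IsTrans _ (fun a b : Fin n × ℕ => ringTime w.1 a ≤ ringTime w.1 b) :=
      ⟨fun a b c => le_trans⟩
    have h1 := List.pairwise_insertionSort
      (fun a b : Fin n × ℕ => ringTime w.1 a ≤ ringTime w.1 b) hfin.toFinset.toList
    have h2 : (hfin.toFinset.toList.insertionSort
        (fun a b => ringTime w.1 a ≤ ringTime w.1 b)).Nodup :=
      (List.perm_insertionSort _ _).nodup_iff.2 (Finset.nodup_toList _)
    refine (h1.and h2).imp ?_
    rintro a b ⟨hab, hne⟩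
    exact lt_of_le_of_ne hab fun h => hne (hinj a b h)
  exact foldl_redraw_eq_truth hS w.2 X₀ (ringList w.1 T) (fun u => upTo (clock w.1) u T) hsort
    (fun b hb a ha => (hmem a).2 (ha.le.trans ((hmem b).1 hb)))
    (fun u j => by rw [hmem, hS.lt_upTo]; rfl) v

end SingleSite

end


/-! ### The algorithm

The memory is laid out as follows. An array with one entry per ring and site is stored in row-major
order, with the site as the last coordinate.

Integer arrays: `0` to `3` hold the input; `4` the number of generated rings per site; `5` a flag;
`6` the width, that is, the number of rings per site that a phase can treat; `7` a counter; `8` and `9`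
the number of rings of every site up to the beginning and up to the end of the current phase; `10` the spins after every ring;
`11` the pointers of the arc processors; `12` the configurations that the rings see; `13` the marks of
the spins that have lost a race; `14` a power of `2`; `15` and `16` the sources and targets of the arcs.

Real arrays: `0` holds the time horizon; `1` the ring times; `2` the exponential variables of the races;
`3` the waiting times; `4` the time up to which phases have been planned; `5` the length of a phase. -/

noncomputable section

namespace SingleSite

open PRAM (Expr Action Prog Store Triple Oracle Resolver Tape evalN evalR unitCost)
open PRAM.Expr (readN readR ltN ltR ofNat query pid)
open PRAM.Prog (par loop)
open PRAM.Action (setN setR randE)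

variable {n q m : ℕ}

namespace Algorithm

/-- The number of sites. -/
def sites : Expr .nat := readN 0 0
/-- The number of spins. -/
def spins : Expr .nat := readN 0 1
/-- The number of arcs: every edge in both orientations, and a loop at every site. -/
def arcs : Expr .nat := 2 * readN 0 2 + readN 0 0
/-- The number of rings that have been generated for every site. -/
def rings : Expr .nat := readN 4 0
/-- A flag that controls the loops. -/
def flag : Expr .nat := readN 5 0
/-- The number of rings per site that a phase can treat. -/
def width : Expr .nat := readN 6 0
/-- The end of the time horizon. -/
def horizon : Expr .real := readR 0 0
/-- The end of the current phase, or of the previous one while the current one is being planned. -/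
def bound : Expr .real := readR 4 0
/-- The length of a phase. -/
def len : Expr .real := readR 5 0

/-- Generation of one more ring, and of the random numbers for its update, at every site. The flag is
raised if some clock has not passed the time horizon yet. -/
def generate : List Prog :=
  [par sites 1 (randE 3 pid),
   par sites 1 (setR 1 ((rings + 1) * sites + pid)
     (readR 1 (rings * sites + pid) + readR 3 pid)),
   par (sites * spins) 1 (randE 2 (rings * (sites * spins) + pid)),
   par 1 1 (setN 4 0 (rings + 1)),
   par 1 1 (setN 5 0 0),
   par sites (ltR horizon (readR 1 (rings * sites + pid))).not (setN 5 0 1)]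

/-- Preparation of the phases: the width is set to `⌈log₂ n⌉ + 1`, the arcs are listed, the spins
before the first ring are set to the input, and the length of a phase is set to the width. -/
def prepare : List Prog :=
  [par 1 1 (setN 6 0 1),
   par 1 1 (setN 14 0 1),
   loop (ltN (readN 14 0) sites) (.ofList
     [par 1 1 (setN 14 0 (2 * readN 14 0)), par 1 1 (setN 6 0 (width + 1))]),
   par (readN 0 2) 1 (setN 15 pid (readN 2 pid)),
   par (readN 0 2) 1 (setN 16 pid (readN 3 pid)),
   par (readN 0 2) 1 (setN 15 (readN 0 2 + pid) (readN 3 pid)),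
   par (readN 0 2) 1 (setN 16 (readN 0 2 + pid) (readN 2 pid)),
   par sites 1 (setN 15 (2 * readN 0 2 + pid) pid),
   par sites 1 (setN 16 (2 * readN 0 2 + pid) pid),
   par sites 1 (setN 10 pid (readN 1 pid)),
   par 1 1 (setR 5 0 (ofNat width))]

/-- The processors of a phase are divided into slots. A processor whose site is `v` and whose slot
at that site is `j` is in charge of ring `done v + j`, counted from `0`. -/
def slotSite (slot : Expr .nat) : Expr .nat := slot % sites

/-- The ring that a slot is in charge of, counted from `0`. -/
def slotRing (slot : Expr .nat) : Expr .nat := readN 8 (slotSite slot) + slot / sites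

/-- Whether the ring of a slot belongs to the current phase. -/
def slotValid (slot : Expr .nat) : Expr .nat := ltN (slotRing slot) (readN 9 (slotSite slot))

/-- The index of the ring of a slot in the array of the random numbers and configurations. -/
def slotKey (slot : Expr .nat) : Expr .nat := slotRing slot * sites + slotSite slot

/-- The index of the ring of a slot in the arrays of times and spins. -/
def slotCell (slot : Expr .nat) : Expr .nat := (slotRing slot + 1) * sites + slotSite slot

/-- The site of the ring that an arc processor is in charge of. -/
def arcSrc : Expr .nat := readN 15 (pid % arcs)
/-- The site that the ring of an arc processor looks at. -/
def arcDst : Expr .nat := readN 16 (pid % arcs)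
/-- The ring that an arc processor is in charge of, counted from `0`. -/
def arcRing : Expr .nat := readN 8 arcSrc + pid / arcs
/-- Whether the ring of an arc processor belongs to the current phase. -/
def arcValid : Expr .nat := ltN arcRing (readN 9 arcSrc)

/-- If some site has more rings in the current phase than a phase can treat, the flag is raised and
the length of the phase is halved. -/
def shorten : List Prog :=
  [par 1 1 (setN 5 0 0),
   par sites (ltN (readN 8 pid + width) rings *
     (ltR (bound + len) (readR 1 ((readN 8 pid + width + 1) * sites + pid))).not) (setN 5 0 1),
   par 1 flag (setR 5 0 (len / ofNat 2))]

/-- One step of the search for the last ring at the target of an arc before a given ring at its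
source: the pointer moves on by one as long as the next ring is still earlier. -/
def scan : List Prog :=
  [par (arcs * width) (arcValid * ltN (readN 11 pid) (readN 9 arcDst) *
     ltR (readR 1 ((readN 11 pid + 1) * sites + arcDst))
       (readR 1 ((arcRing + 1) * sites + arcSrc)))
     (setN 11 pid (readN 11 pid + 1)),
   par 1 1 (setN 7 0 (readN 7 0 + 1))]

/-- The likelihood of spin `x` at the ring of a slot. -/
def likelihood (slot x : Expr .nat) : Expr .real :=
  query (slotSite slot) 12 (slotKey slot * sites) x

/-- The random number for spin `x` at the ring of a slot. -/
def racer (slot x : Expr .nat) : Expr .real := readR 2 (slotKey slot * spins + x)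

/-- One sweep over all rings of the phase. The configurations that the rings see are gathered along
the arcs; the spins of every ring run their race, every pair of spins being compared by a processor of
its own that marks the loser; the spin without a mark is the new one. The flag is raised if the new spin
differs from the old one anywhere. -/
def round : List Prog :=
  [par (arcs * width) arcValid (setN 12 ((arcRing * sites + arcSrc) * sites + arcDst)
     (readN 10 (readN 11 pid * sites + arcDst))),
   par (sites * width * spins) 1 (setN 13 pid 0),
   par (sites * width * spins * spins) (slotValid (pid / spins / spins) *
     ltR (racer (pid / spins / spins) (pid % spins) *
         likelihood (pid / spins / spins) (pid / spins % spins))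
       (racer (pid / spins / spins) (pid / spins % spins) *
         likelihood (pid / spins / spins) (pid % spins)))
     (setN 13 (pid / spins) 1),
   par 1 1 (setN 5 0 0),
   par (sites * width * spins) (slotValid (pid / spins) * (readN 13 pid).not *
     (ltN (readN 10 (slotCell (pid / spins))) (pid % spins) +
       ltN (pid % spins) (readN 10 (slotCell (pid / spins))))) (setN 5 0 1),
   par (sites * width * spins) (slotValid (pid / spins) * (readN 13 pid).not)
     (setN 10 (slotCell (pid / spins)) (pid % spins))]

/-- One phase. It is shortened if necessary, its end is computed, and so are the number of rings of
every site up to its end and the pointers. Then sweeps are made until nothing changes any more. -/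
def phase : List Prog :=
  [par 1 1 (setN 5 0 1),
   loop flag (.ofList shorten),
   par 1 1 (setR 4 0 (bound + len)),
   par 1 (ltR horizon bound) (setR 4 0 horizon),
   par sites 1 (setN 9 pid (readN 8 pid)),
   par (sites * width) (ltN (slotRing pid) rings * (ltR bound (readR 1 (slotCell pid))).not *
     ltR bound (readR 1 ((slotRing pid + 2) * sites + slotSite pid)))
     (setN 9 (slotSite pid) (slotRing pid + 1)),
   par (arcs * width) 1 (setN 11 pid (readN 8 arcDst)),
   par 1 1 (setN 7 0 0),
   loop (ltN (readN 7 0) width) (.ofList scan),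
   par 1 1 (setN 5 0 1),
   loop flag (.ofList round),
   par sites 1 (setN 8 pid (readN 9 pid))]

end Algorithm

open Algorithm in
/-- The algorithm: generation of the rings until all clocks have passed the time horizon, then phases
up to the time horizon, and finally the output of the last spin of every site. -/
def algorithm : Prog := .ofList
  [par 1 1 (setN 5 0 1),
   loop flag (.ofList generate),
   .ofList prepare,
   loop (ltR bound horizon) (.ofList phase),
   par sites 1 (setN 1 pid (readN 10 (readN 8 pid * sites + pid)))]

section Eval

open Algorithm

variable (O : Oracle) (s : Store) (i : ℕ)

@[simp] lemma evalN_sites : evalN O s i sites = s.nat 0 0 := rfl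
@[simp] lemma evalN_spins : evalN O s i spins = s.nat 0 1 := rfl
@[simp] lemma evalN_arcs : evalN O s i arcs = 2 * s.nat 0 2 + s.nat 0 0 := rfl
@[simp] lemma evalN_rings : evalN O s i rings = s.nat 4 0 := rfl
@[simp] lemma evalN_flag : evalN O s i flag = s.nat 5 0 := rfl
@[simp] lemma evalN_width : evalN O s i width = s.nat 6 0 := rfl
@[simp] lemma evalR_horizon : evalR O s i horizon = s.real 0 0 := rfl
@[simp] lemma evalR_bound : evalR O s i bound = s.real 4 0 := rfl
@[simp] lemma evalR_len : evalR O s i len = s.real 5 0 := rfl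

end Eval

/-- The memory after the preparation, as far as the phases rely on it: the sizes, the number `I` of
generated rings per site, the width `L` of a phase, the arcs, the time horizon, the ring times `S`
and the random numbers `e` of the updates. -/
structure Env (G : SimpleGraph (Fin n)) (q m I L : ℕ) (T : ℝ) (S : Fin n → ℕ → ℝ)
    (e : Fin n × ℕ → Fin q → ℝ) (s : Store) : Prop where
  sites_eq : s.nat 0 0 = n
  spins_eq : s.nat 0 1 = q
  edges_eq : s.nat 0 2 = m
  rings_eq : s.nat 4 0 = I
  width_eq : s.nat 6 0 = L
  arc : ∀ w < 2 * m + n, ∃ v u : Fin n, s.nat 15 w = v ∧ s.nat 16 w = u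
  arc_of_nbhd : ∀ (v : Fin n) (u : Nbhd G v), ∃ w < 2 * m + n, s.nat 15 w = v ∧ s.nat 16 w = u.1
  horizon_eq : s.real 0 0 = T
  time_eq : ∀ k ≤ I, ∀ v : Fin n, s.real 1 (k * n + v) = S v k
  race_eq : ∀ i < I, ∀ (v : Fin n) (x : Fin q), s.real 2 ((i * n + v) * q + x) = e (v, i) x

section Env

variable {G : SimpleGraph (Fin n)} {I L : ℕ} {T : ℝ} {S : Fin n → ℕ → ℝ}
  {e : Fin n × ℕ → Fin q → ℝ} {s : Store}

lemma Env.putNat (h : Env G q m I L T S e s) (a : ℕ) (A : ℕ → ℕ)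
    (ha : 0 ≠ a ∧ 4 ≠ a ∧ 6 ≠ a ∧ 15 ≠ a ∧ 16 ≠ a) : Env G q m I L T S e (s.putNat a A) := by
  obtain ⟨h0, h4, h6, h15, h16⟩ := ha
  constructor <;> simp only [Store.putNat_nat, Store.putNat_real, h0, h4, h6, h15, h16, if_false]
  exacts [h.sites_eq, h.spins_eq, h.edges_eq, h.rings_eq, h.width_eq, h.arc, h.arc_of_nbhd,
    h.horizon_eq, h.time_eq, h.race_eq]

lemma Env.putReal (h : Env G q m I L T S e s) (a : ℕ) (A : ℕ → ℝ)
    (ha : 0 ≠ a ∧ 1 ≠ a ∧ 2 ≠ a) : Env G q m I L T S e (s.putReal a A) := by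
  obtain ⟨h0, h1, h2⟩ := ha
  constructor <;> simp only [Store.putReal_nat, Store.putReal_real, h0, h1, h2, if_false]
  exacts [h.sites_eq, h.spins_eq, h.edges_eq, h.rings_eq, h.width_eq, h.arc, h.arc_of_nbhd,
    h.horizon_eq, h.time_eq, h.race_eq]

end Env

/-- Row-major indices determine their coordinates. -/
lemma index_inj {k a b : ℕ} {u v : ℕ} (hu : u < k) (hv : v < k) (h : a * k + u = b * k + v) :
    a = b ∧ u = v := by
  have h1 : (a * k + u) % k = u := by rw [Nat.mul_add_mod', Nat.mod_eq_of_lt hu]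
  have h2 : (b * k + v) % k = v := by rw [Nat.mul_add_mod', Nat.mod_eq_of_lt hv]
  have huv : u = v := by rw [← h1, ← h2, h]
  subst huv
  exact ⟨Nat.eq_of_mul_eq_mul_right (by omega) (Nat.add_right_cancel h), rfl⟩

lemma index_lt {k a b u : ℕ} (hu : u < k) (ha : a < b) : a * k + u < b * k := by
  calc a * k + u < a * k + k := by omega
    _ = (a + 1) * k := by ring
    _ ≤ b * k := Nat.mul_le_mul_right _ ha

/-! ### Generation of the clocks -/

/-- The memory and the time after `i` rounds of the generation. A round takes `14` units of time, since
the tests of a loop and the executions of a list take time, too. This is where the positions on the tape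
of the random numbers come from. -/
structure GenInv (s₀ : Store) (n q : ℕ) (T : ℝ) (g : Gaps n) (e : Fin n × ℕ → Fin q → ℝ) (i : ℕ)
    (s : Store) (t : ℕ) : Prop where
  time_eq : t = 14 * i + 3
  nat_eq : ∀ a, a ≠ 4 → a ≠ 5 → s.nat a = s₀.nat a
  rings_eq : s.nat 4 0 = i
  real_eq : ∀ a, a ≠ 1 → a ≠ 2 → a ≠ 3 → s.real a = s₀.real a
  clock_eq : ∀ k ≤ i, ∀ v : Fin n, s.real 1 (k * n + v) = clock g v k
  race_eq : ∀ i' < i, ∀ (v : Fin n) (x : Fin q), s.real 2 ((i' * n + v) * q + x) = e (v, i') x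
  flag_of : s.nat 5 0 ≠ 0 → i ≠ 0 → ∃ v, clock g v i ≤ T
  of_flag : s.nat 5 0 = 0 → i ≠ 0 ∧ ∀ v, T < clock g v i

variable {O : Oracle} {r : Resolver} {ω : Tape}

/-- One round of the generation. The waiting time of the next ring at `v` and the exponential variables
of its race are read off the tape at times `14 * i + 5` and `14 * i + 9`. -/
lemma triple_generate {s₀ s : Store} {t i K : ℕ} {T : ℝ} {g : Gaps n}
    {e : Fin n × ℕ → Fin q → ℝ} (hs₀ : s₀.nat 0 0 = n) (hs₁ : s₀.nat 0 1 = q)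
    (hT : s₀.real 0 0 = T) (hK : 1 ≤ K) (hKn : n ≤ K) (hKq : n * q ≤ K)
    (hg : ∀ v i, g (v, i) = -Real.log (ω (14 * i + 5, v) : ℝ))
    (he : ∀ v i (x : Fin q), e (v, i) x = -Real.log (ω (14 * i + 9, v * q + x) : ℝ))
    (h : GenInv s₀ n q T g e i s t) :
    Triple O r ω (.ofList Algorithm.generate) s (t + 1) 6 K (GenInv s₀ n q T g e (i + 1)) := by
  have hn : s.nat 0 0 = n := by rw [h.nat_eq 0 (by decide) (by decide), hs₀]
  have hq : s.nat 0 1 = q := by rw [h.nat_eq 0 (by decide) (by decide), hs₁]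
  have hT' : s.real 0 0 = T := by rw [h.real_eq 0 (by decide) (by decide) (by decide), hT]
  have ht := h.time_eq
  have hI := h.rings_eq
  unfold Algorithm.generate
  refine Triple.randE (by decide) (by simpa [hn]) ?_ fun A₁ hA₁ _ => ?_
  · intro i hi j hj _ _ hij
    simp only [PRAM.evalN_pid] at hij
    rw [hij]
  refine Triple.setR (by decide) (by simpa [hn]) ?_ fun A₂ hA₂ hA₂' => ?_
  · intro i hi j hj _ _ hij
    simp [hn] at hij
    rw [hij]
  refine Triple.randE (by decide) (by simpa [hn, hq]) ?_
    fun A₃ hA₃ hA₃' => ?_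
  · intro i hi j hj _ _ hij
    simp at hij
    rw [hij]
  refine Triple.setReg (by decide) hK fun A₄ hA₄ => ?_
  refine Triple.setReg (by decide) hK fun A₅ hA₅ => ?_
  refine Triple.raise (by decide) (by simpa [hn]) fun A₆ hA₆ hA₆' => ?_
  refine Triple.nil ?_
  simp [hn, hq, hI, hT']
    at hA₁ hA₂ hA₂' hA₃ hA₃' hA₄ hA₅ hA₆ hA₆'
  have hnew : ∀ v : Fin n, A₂ ((i + 1) * n + v) = clock g v (i + 1) := by
    intro v
    rw [hA₂ v v.2, hA₁ v v.2, h.clock_eq i le_rfl, clock, clock, Finset.sum_range_succ, hg, ht]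
  constructor
  · omega
  · intro a h4 h5
    simp [h4, h5, h.nat_eq a h4 h5]
  · simp [hA₄]
  · intro a h1 h2 h3
    simp [h1, h2, h3, h.real_eq a h1 h2 h3]
  · intro k hk v
    simp
    rcases Nat.lt_or_ge i k with hik | hik
    · obtain rfl : k = i + 1 := by omega
      exact hnew v
    · rw [hA₂' _ fun j hj hjv => ?_]
      · exact h.clock_eq k hik v
      · have := index_inj hj v.2 hjv
        omega
  · intro i' hi' v x
    simp
    rcases Nat.lt_or_ge i' i with hii | hii
    · rw [hA₃' _ fun j hj hjv => ?_]
      · exact h.race_eq i' hii v x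
      · have h1 : (i' * n + v) * q + x < i * n * q := index_lt x.2 (index_lt v.2 hii)
        have h2 : i * (n * q) = i * n * q := by ring
        omega
    · obtain rfl : i' = i := by omega
      have h1 : (v : ℕ) * q + x < n * q := index_lt x.2 v.2
      have h2 := hA₃ _ h1
      rw [show (i' * n + v) * q + x = i' * (n * q) + (v * q + x) by ring, h2, he, ht]
  · intro hf _
    simp at hf
    by_contra hcon
    push Not at hcon
    apply hf
    rw [hA₆' fun j hj => ?_]
    · exact hA₅
    · rw [hA₄, hnew ⟨j, hj⟩]
      exact hcon _
  · intro hf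
    simp at hf
    refine ⟨by omega, fun v => ?_⟩
    by_contra hcon
    push Not at hcon
    have := hA₆ v v.2 (by rw [hA₄, hnew v]; exact hcon)
    omega

/-! ### Preparation of the phases -/

/-- The memory between two phases: the rings up to time `b` are done. -/
structure PhaseInv (G : SimpleGraph (Fin n)) (q m I L : ℕ) (T : ℝ) (S : Fin n → ℕ → ℝ)
    (e : Fin n × ℕ → Fin q → ℝ) (f : Fin n → ℕ → (Fin n → Fin q) → Fin q) (X₀ : Fin n → Fin q)
    (z₀ : Fin q) (b Δ : ℝ) (s : Store) : Prop where
  env : Env G q m I L T S e s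
  done_eq : ∀ v : Fin n, s.nat 8 v = upTo S v b
  spin_eq : ∀ (k : ℕ) (v : Fin n), s.nat 10 (k * n + v) = guess S f X₀ z₀ b v k
  bound_eq : s.real 4 0 = b
  len_eq : s.real 5 0 = Δ

/-- The computation of the width by doubling a power of `2` until it reaches the number of sites. -/
lemma triple_width {s : Store} {t K : ℕ} {Q : Store → ℕ → Prop} (hn : s.nat 0 0 = n)
    (h6 : s.nat 6 0 = 1) (h14 : s.nat 14 0 = 1) (hK : 1 ≤ K)
    (h : ∀ s' t', (∀ a, a ≠ 6 → a ≠ 14 → s'.nat a = s.nat a) → s'.real = s.real →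
      s'.nat 6 0 = Nat.clog 2 n + 1 → Q s' t') :
    Triple O r ω (loop (ltN (readN 14 0) Algorithm.sites) (.ofList
      [par 1 1 (setN 14 0 (2 * readN 14 0)), par 1 1 (setN 6 0 (Algorithm.width + 1))])) s t
      (Nat.clog 2 n * 3 + 1) K Q := by
  refine Triple.loop (D := 2) (fun i s' t' => (∀ a, a ≠ 6 → a ≠ 14 → s'.nat a = s.nat a) ∧
    s'.real = s.real ∧ s'.nat 6 0 = i + 1 ∧ s'.nat 14 0 = 2 ^ i ∧ i ≤ Nat.clog 2 n)
    (Nat.clog 2 n) (by decide) ⟨fun _ _ _ => rfl, rfl, by simp [h6], by simp [h14],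
      Nat.zero_le _⟩ ?_
  rintro i s' t' ⟨ha, hr, h6', h14', hi⟩
  have hn' : s'.nat 0 0 = n := by rw [ha 0 (by decide) (by decide), hn]
  by_cases hlt : 2 ^ i < n
  · right
    refine ⟨by simp [hn', h14', hlt], (Nat.lt_clog_iff_pow_lt (by decide)).2 hlt, ?_⟩
    refine Triple.setReg (by decide) hK fun A hA => ?_
    refine Triple.setReg (by decide) hK fun A' hA' => ?_
    refine Triple.nil ⟨fun a h1 h2 => ?_, ?_, ?_, ?_, ?_⟩
    · simp [h1, h2, ha a h1 h2]
    · simp [hr]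
    · simpa [h6'] using hA'
    · simp at hA; simp [hA, h14', pow_succ]; ring
    · exact (Nat.lt_clog_iff_pow_lt (by decide)).2 hlt
  · left
    refine ⟨by simp [hn', h14', hlt], h _ _ ha hr ?_⟩
    have : Nat.clog 2 n ≤ i := Nat.clog_le_of_le_pow (not_lt.1 hlt)
    omega

lemma triple_prepare {G : SimpleGraph (Fin n)} {E : Fin m → Fin n × Fin n}
    {s₀ s : Store} {t t₀ I K : ℕ} {T : ℝ} {g : Gaps n} {e : Fin n × ℕ → Fin q → ℝ}
    {f : Fin n → ℕ → (Fin n → Fin q) → Fin q} {X₀ : Fin n → Fin q} {z₀ : Fin q}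
    (hE : IsEdgeList G E) (hS : IsClock (clock g)) (hz : (z₀ : ℕ) = 0)
    (hs₀ : ∀ a ≠ 5, s₀.nat a = (input X₀ E T).nat a) (hr₀ : s₀.real = (input X₀ E T).real)
    (hK : 1 ≤ K) (hKm : 2 * m + n ≤ K) (h : GenInv s₀ n q T g e I s t₀) :
    Triple O r ω (.ofList Algorithm.prepare) s t (Nat.clog 2 n * 3 + 11) K fun s' _ =>
      PhaseInv G q m I (Nat.clog 2 n + 1) T (clock g) e f X₀ z₀ 0 (Nat.clog 2 n + 1 : ℕ) s' := by
  have hin : ∀ a, a ≠ 4 → a ≠ 5 → s.nat a = (input X₀ E T).nat a := fun a h4 h5 => by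
    rw [h.nat_eq a h4 h5, hs₀ a h5]
  have hn : s.nat 0 0 = n := by rw [hin 0 (by decide) (by decide)]; simp [input, pad]
  have hq : s.nat 0 1 = q := by rw [hin 0 (by decide) (by decide)]; simp [input, pad]
  have hm : s.nat 0 2 = m := by rw [hin 0 (by decide) (by decide)]; simp [input, pad]
  have hX : ∀ v : Fin n, s.nat 1 v = X₀ v := fun v => by
    rw [hin 1 (by decide) (by decide)]; simp [input, pad]
  have h2 : ∀ w : Fin m, s.nat 2 w = (E w).1 := fun w => by
    rw [hin 2 (by decide) (by decide)]; simp [input, pad]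
  have h3 : ∀ w : Fin m, s.nat 3 w = (E w).2 := fun w => by
    rw [hin 3 (by decide) (by decide)]; simp [input, pad]
  have h8 : ∀ j, s.nat 8 j = 0 := fun j => by
    rw [hin 8 (by decide) (by decide)]; simp [input]
  have h10 : ∀ j, s.nat 10 j = 0 := fun j => by
    rw [hin 10 (by decide) (by decide)]; simp [input]
  have hT : s.real 0 0 = T := by
    rw [h.real_eq 0 (by decide) (by decide) (by decide), hr₀]; simp [input]
  have hb : s.real 4 0 = 0 := by
    rw [h.real_eq 4 (by decide) (by decide) (by decide), hr₀]; simp [input]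
  unfold Algorithm.prepare
  refine Triple.setReg (by decide) hK fun A₁ hA₁ => ?_
  refine Triple.setReg (by decide) hK fun A₂ hA₂ => ?_
  simp at hA₁ hA₂
  refine Triple.cons (D₂ := 8) (Q₁ := fun s' _ =>
      (∀ a, a ≠ 6 → a ≠ 14 → s'.nat a = s.nat a) ∧ s'.real = s.real ∧
      s'.nat 6 0 = Nat.clog 2 n + 1)
    (triple_width (n := n) (by simpa using hn) (by simpa using hA₁) (by simpa using hA₂) hK ?_)
    ?_ le_rfl
  · intro s' t' ha hr h6
    refine ⟨fun a ha6 ha14 => ?_, ?_, h6⟩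
    · rw [ha a ha6 ha14]; simp [ha6, ha14]
    · rw [hr]; simp
  rintro s' t' ⟨ha, hr, h6⟩
  have hn' : s'.nat 0 0 = n := by rw [ha 0 (by decide) (by decide), hn]
  have hm' : s'.nat 0 2 = m := by rw [ha 0 (by decide) (by decide), hm]
  refine Triple.setN (by decide) (by simp [hm']; omega)
    (fun i _ j _ _ _ hij => by simp at hij; rw [hij]) fun B₁ hB₁ _ => ?_
  refine Triple.setN (by decide) (by simp [hm']; omega)
    (fun i _ j _ _ _ hij => by simp at hij; rw [hij]) fun B₂ hB₂ _ => ?_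
  refine Triple.setN (by decide) (by simp [hm']; omega)
    (fun i _ j _ _ _ hij => by simp at hij; rw [hij]) fun B₃ hB₃ hB₃' => ?_
  refine Triple.setN (by decide) (by simp [hm']; omega)
    (fun i _ j _ _ _ hij => by simp at hij; rw [hij]) fun B₄ hB₄ hB₄' => ?_
  refine Triple.setN (by decide) (by simp [hn']; omega)
    (fun i _ j _ _ _ hij => by simp at hij; rw [hij]) fun B₅ hB₅ hB₅' => ?_
  refine Triple.setN (by decide) (by simp [hn']; omega)
    (fun i _ j _ _ _ hij => by simp at hij; rw [hij]) fun B₆ hB₆ hB₆' => ?_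
  refine Triple.setN (by decide) (by simp [hn']; omega)
    (fun i _ j _ _ _ hij => by simp at hij; rw [hij]) fun B₇ hB₇ hB₇' => ?_
  refine Triple.setR (by decide) (by simpa using hK) ?_ fun B₈ hB₈ _ => Triple.nil ?_
  · intro i hi j hj _ _ _
    simp
  simp [hn', hm', h6, ha] at hB₁ hB₂ hB₃ hB₃' hB₄ hB₄' hB₅ hB₅' hB₆ hB₆' hB₇ hB₇' hB₈
  have e1 : ∀ w : Fin m, B₅ w = (E w).1 ∧ B₆ w = (E w).2 := by
    intro w
    rw [hB₅' w fun i hi => by omega, hB₆' w fun i hi => by omega, hB₃' w fun i hi => by omega,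
      hB₄' w fun i hi => by omega, hB₁ w w.2, hB₂ w w.2, h2, h3]
    exact ⟨rfl, rfl⟩
  have e2 : ∀ w : Fin m, B₅ (m + w) = (E w).2 ∧ B₆ (m + w) = (E w).1 := by
    intro w
    rw [hB₅' _ fun i hi => by omega, hB₆' _ fun i hi => by omega, hB₃ w w.2, hB₄ w w.2, h2, h3]
    exact ⟨rfl, rfl⟩
  have e3 : ∀ v : Fin n, B₅ (2 * m + v) = v ∧ B₆ (2 * m + v) = v := fun v =>
    ⟨hB₅ v v.2, hB₆ v v.2⟩
  refine ⟨⟨?_, ?_, ?_, ?_, ?_, ?_, ?_, ?_, ?_, ?_⟩, ?_, ?_, ?_, ?_⟩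
  · simp [hn']
  · simp [ha, hq]
  · simp [hm']
  · simp [ha, h.rings_eq]
  · simp [h6]
  · intro w hw
    simp
    by_cases h1 : w < m
    · exact ⟨⟨_, (e1 ⟨w, h1⟩).1⟩, ⟨_, (e1 ⟨w, h1⟩).2⟩⟩
    by_cases h2 : w < 2 * m
    · obtain ⟨j, rfl⟩ := Nat.exists_eq_add_of_le (not_lt.1 h1)
      exact ⟨⟨_, (e2 ⟨j, by omega⟩).1⟩, ⟨_, (e2 ⟨j, by omega⟩).2⟩⟩
    · obtain ⟨j, rfl⟩ := Nat.exists_eq_add_of_le (not_lt.1 h2)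
      exact ⟨⟨_, (e3 ⟨j, by omega⟩).1⟩, ⟨_, (e3 ⟨j, by omega⟩).2⟩⟩
  · rintro v ⟨u, hu⟩
    simp
    rcases hu with rfl | hu
    · exact ⟨2 * m + u, by omega, e3 u⟩
    · have hmem : s(v, u) ∈ G.edgeSet := hu
      rw [← hE.2] at hmem
      obtain ⟨w, hw⟩ := hmem
      simp only [Sym2.eq_iff] at hw
      rcases hw with ⟨h1, h2⟩ | ⟨h1, h2⟩
      · exact ⟨w, by omega, by rw [(e1 w).1, h1], by rw [(e1 w).2, h2]⟩
      · exact ⟨m + w, by omega, by rw [(e2 w).1, h2], by rw [(e2 w).2, h1]⟩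
  · simp [hr, hT]
  · intro k hk v
    simpa [hr] using h.clock_eq k hk v
  · intro i hi v x
    simpa [hr] using h.race_eq i hi v x
  · intro v
    simp [ha, h8, hS.upTo_zero]
  · intro k v
    simp
    rcases k with _ | k
    · rw [guess_zero hS le_rfl, zero_mul, zero_add, hB₇ v v.2, hX]
    · rw [guess_of_lt (hS.pos v k), hB₇' _ fun i hi => ?_, hz]
      · simp [h10]
      · have : n ≤ (k + 1) * n := Nat.le_mul_of_pos_left _ (Nat.succ_pos k)
        omega
  · simp [hr, hb]
  · simp [hB₈]

end SingleSite

end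


noncomputable section

namespace SingleSite

open PRAM (Expr Action Prog Store Triple Oracle Resolver Tape evalN evalR unitCost)
open PRAM.Expr (readN readR ltN ltR ofNat query pid)
open PRAM.Prog (par loop)
open PRAM.Action (setN setR randE)

variable {n q m : ℕ}

/-! ### The phases -/

section Eval

open Algorithm

variable (O : Oracle) (s : Store) (i : ℕ) (slot x : Expr .nat)

@[simp] lemma evalN_slotSite :
    evalN O s i (slotSite slot) = evalN O s i slot % s.nat 0 0 := rfl
@[simp] lemma evalN_slotRing : evalN O s i (slotRing slot) =
    s.nat 8 (evalN O s i slot % s.nat 0 0) + evalN O s i slot / s.nat 0 0 := rfl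
@[simp] lemma evalN_slotValid : evalN O s i (slotValid slot) =
    if evalN O s i (slotRing slot) < s.nat 9 (evalN O s i slot % s.nat 0 0) then 1 else 0 := rfl
@[simp] lemma evalN_slotKey : evalN O s i (slotKey slot) =
    evalN O s i (slotRing slot) * s.nat 0 0 + evalN O s i slot % s.nat 0 0 := rfl
@[simp] lemma evalN_slotCell : evalN O s i (slotCell slot) =
    (evalN O s i (slotRing slot) + 1) * s.nat 0 0 + evalN O s i slot % s.nat 0 0 := rfl
@[simp] lemma evalN_arcSrc :
    evalN O s i arcSrc = s.nat 15 (i % (2 * s.nat 0 2 + s.nat 0 0)) := rfl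
@[simp] lemma evalN_arcDst :
    evalN O s i arcDst = s.nat 16 (i % (2 * s.nat 0 2 + s.nat 0 0)) := rfl
@[simp] lemma evalN_arcRing : evalN O s i arcRing =
    s.nat 8 (s.nat 15 (i % (2 * s.nat 0 2 + s.nat 0 0))) + i / (2 * s.nat 0 2 + s.nat 0 0) := rfl
@[simp] lemma evalN_arcValid : evalN O s i arcValid =
    if evalN O s i arcRing < s.nat 9 (s.nat 15 (i % (2 * s.nat 0 2 + s.nat 0 0)))
    then 1 else 0 := rfl
@[simp] lemma evalR_likelihood : evalR O s i (likelihood slot x) =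
    O (evalN O s i slot % s.nat 0 0)
      (fun u => s.nat 12 (evalN O s i (slotKey slot) * s.nat 0 0 + u)) (evalN O s i x) := rfl
@[simp] lemma evalR_racer : evalR O s i (racer slot x) =
    s.real 2 (evalN O s i (slotKey slot) * s.nat 0 1 + evalN O s i x) := rfl

end Eval

/-- The value of the oracle, when the memory holds the relevant part of the configuration `σ`. -/
lemma oracle_eq {G : SimpleGraph (Fin n)} (P : LocalRule G q) (v : Fin n) (τ : ℕ → ℕ)
    (σ : Fin n → Fin q) (hτ : ∀ u : Nbhd G v, τ u.1 = σ u.1) (x : Fin q) :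
    oracle P v τ x = (P v (fun u => σ u.1) x).toReal := by
  unfold oracle
  have h : ∃ (hv : (v : ℕ) < n) (_ : (x : ℕ) < q), ∀ u : Nbhd G ⟨v, hv⟩, τ u.1 < q :=
    ⟨v.2, x.2, fun u => by rw [hτ u]; exact (σ u.1).2⟩
  rw [dif_pos h]
  congr 2
  congr 1
  funext u
  exact Fin.ext (hτ u)

/-- The random numbers `e` make `z` the winner of every exponential race: the race at ring `i` of
site `v`, for configuration `τ`, is won by the spin `x` that minimizes `e (v, i) x / P v τ x`. -/
def IsWinner {G : SimpleGraph (Fin n)} (P : LocalRule G q) (e : Fin n × ℕ → Fin q → ℝ)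
    (z : Draws G q) : Prop :=
  ∀ a x, x = z a ↔ ∀ y, ¬ e (a.1, a.2.1) y * (P a.1 a.2.2 x).toReal <
    e (a.1, a.2.1) x * (P a.1 a.2.2 y).toReal

/-- The memory during a phase that treats the rings between the times `b` and `b'`, after `j` sweeps
and before the array of pointers is complete. -/
structure SweepInv (G : SimpleGraph (Fin n)) (q m I L : ℕ) (T : ℝ) (S : Fin n → ℕ → ℝ)
    (e : Fin n × ℕ → Fin q → ℝ) (f : Fin n → ℕ → (Fin n → Fin q) → Fin q) (X₀ : Fin n → Fin q)
    (z₀ : Fin q) (b b' Δ : ℝ) (j : ℕ) (s : Store) : Prop where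
  env : Env G q m I L T S e s
  done_eq : ∀ v : Fin n, s.nat 8 v = upTo S v b
  todo_eq : ∀ v : Fin n, s.nat 9 v = upTo S v b'
  spin_eq : ∀ (k : ℕ) (v : Fin n), s.nat 10 (k * n + v) =
    if k ≤ upTo S v b' then ((sweep S f)^[j] (guess S f X₀ z₀ b) v k : ℕ) else 0
  bound_eq : s.real 4 0 = b'
  len_eq : s.real 5 0 = Δ

/-- The pointers: the processor `i` of an arc knows the last ring at the target of the arc before
the ring at the source of the arc that it is in charge of. If it has only found `k` rings so far, it
knows the first `k` of them. -/
def PointersUpTo (m L : ℕ) (S : Fin n → ℕ → ℝ) (b b' : ℝ) (k : ℕ) (s : Store) : Prop :=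
  ∀ i < (2 * m + n) * L, ∀ v u : Fin n, s.nat 15 (i % (2 * m + n)) = v →
    s.nat 16 (i % (2 * m + n)) = u → upTo S v b + i / (2 * m + n) < upTo S v b' →
    s.nat 11 i = min (before S u (S v (upTo S v b + i / (2 * m + n) + 1))) (upTo S u b + k)

variable {G : SimpleGraph (Fin n)} {P : LocalRule G q} {I L : ℕ} {T : ℝ} {S : Fin n → ℕ → ℝ}
  {e : Fin n × ℕ → Fin q → ℝ} {z : Draws G q} {X₀ : Fin n → Fin q} {z₀ : Fin q} {b b' Δ : ℝ}
  {f : Fin n → ℕ → (Fin n → Fin q) → Fin q}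

section Invariants

variable {s : Store}

lemma SweepInv.putNat {j : ℕ} (h : SweepInv G q m I L T S e f X₀ z₀ b b' Δ j s) (a : ℕ)
    (A : ℕ → ℕ) (ha : 0 ≠ a ∧ 4 ≠ a ∧ 6 ≠ a ∧ 15 ≠ a ∧ 16 ≠ a) (ha' : 8 ≠ a ∧ 9 ≠ a ∧ 10 ≠ a) :
    SweepInv G q m I L T S e f X₀ z₀ b b' Δ j (s.putNat a A) := by
  refine ⟨h.env.putNat a A ha, ?_, ?_, ?_, h.bound_eq, h.len_eq⟩ <;>
    simp only [Store.putNat_nat, ha', if_false]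
  exacts [h.done_eq, h.todo_eq, h.spin_eq]

lemma PhaseInv.putNat (h : PhaseInv G q m I L T S e f X₀ z₀ b Δ s) (a : ℕ)
    (A : ℕ → ℕ) (ha : 0 ≠ a ∧ 4 ≠ a ∧ 6 ≠ a ∧ 15 ≠ a ∧ 16 ≠ a) (ha' : 8 ≠ a ∧ 10 ≠ a) :
    PhaseInv G q m I L T S e f X₀ z₀ b Δ (s.putNat a A) := by
  refine ⟨h.env.putNat a A ha, ?_, ?_, h.bound_eq, h.len_eq⟩ <;>
    simp only [Store.putNat_nat, ha', if_false]
  exacts [h.done_eq, h.spin_eq]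

lemma PointersUpTo.putNat {k : ℕ} (h : PointersUpTo m L S b b' k s) (a : ℕ)
    (A : ℕ → ℕ) (ha : 11 ≠ a ∧ 15 ≠ a ∧ 16 ≠ a) :
    PointersUpTo m L S b b' k (s.putNat a A) := by
  unfold PointersUpTo
  simp only [Store.putNat_nat, ha, if_false]
  exact h

end Invariants

lemma div_index {k a x : ℕ} (h : x < k) : (a * k + x) / k = a := by
  rw [Nat.add_comm, Nat.add_mul_div_right _ _ (by omega), Nat.div_eq_of_lt h, zero_add]

lemma mod_index {k a x : ℕ} (h : x < k) : (a * k + x) % k = x := by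
  rw [Nat.mul_add_mod', Nat.mod_eq_of_lt h]

lemma div_lt_of_lt_mul' {i a k : ℕ} (h : i < k * a) : i / a < k := by
  rcases Nat.eq_zero_or_pos a with rfl | ha
  · simp at h
  · exact (Nat.div_lt_iff_lt_mul ha).2 h

variable {O : Oracle} {r : Resolver} {ω : Tape} {s : Store} {t K : ℕ}

/-- Every ring is generated before the clocks of all sites have passed the horizon. -/
lemma upTo_lt_rings (hS : IsClock S) (hT : 0 < T) (hI : ∀ v, T < S v I) (hb : b ≤ T)
    (v : Fin n) : upTo S v b < I := by
  by_contra h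
  push Not at h
  rcases I with _ | I
  · exact absurd (hI v) (not_lt.mpr ((hS.zero v).le.trans hT.le))
  · exact absurd ((hS.lt_upTo.1 (Nat.lt_of_succ_le h)).trans hb) (not_le.mpr (hI v))

/-- The loop that shortens a phase. It ends at the latest with length `L / 2 ^ J` if phases of that
length never contain more than `L` rings of a site. -/
lemma triple_shorten {J j₀ : ℕ} (hj₀ : j₀ ≤ J)
    (hJ : ∀ v, b + L / 2 ^ J < S v (upTo S v b + L + 1)) (hK : 1 ≤ K) (hKn : n ≤ K)
    (h : PhaseInv G q m I L T S e f X₀ z₀ b (L / 2 ^ j₀) s) (hflag : s.nat 5 0 ≠ 0) :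
    Triple O r ω (loop Algorithm.flag (.ofList Algorithm.shorten)) s t ((J + 1) * 4 + 1) K
      fun s' _ => ∃ j, j₀ ≤ j ∧ j ≤ J ∧ PhaseInv G q m I L T S e f X₀ z₀ b (L / 2 ^ j) s' ∧
        ∀ v, I ≤ upTo S v b + L ∨ b + L / 2 ^ j < S v (upTo S v b + L + 1) := by
  refine Triple.loop (D := 3) (fun i s' _ => ∃ j, j₀ ≤ j ∧ j ≤ J ∧
    PhaseInv G q m I L T S e f X₀ z₀ b (L / 2 ^ j) s' ∧ (s'.nat 5 0 ≠ 0 → i + j₀ = j) ∧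
    (s'.nat 5 0 = 0 → ∀ v, I ≤ upTo S v b + L ∨ b + L / 2 ^ j < S v (upTo S v b + L + 1)))
    (J + 1) (by decide) ⟨j₀, le_rfl, hj₀, h, fun _ => zero_add _, fun h => absurd h hflag⟩ ?_
  rintro i s t ⟨j, hj, hjJ, h, hf, hf'⟩
  by_cases h0 : s.nat 5 0 = 0
  · exact Or.inl ⟨h0, j, hj, hjJ, h, hf' h0⟩
  right
  have hi := hf h0
  refine ⟨h0, by omega, ?_⟩
  have hn := h.env.sites_eq
  refine Triple.setReg (by decide) hK fun A₁ hA₁ => ?_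
  refine Triple.raise (by decide) (by simpa [hn]) fun A₂ hA₂ hA₂' => ?_
  refine Triple.setR (by decide) (by simpa using hK) ?_ fun A₃ hA₃ hA₃' => ?_
  · intro i hi j hj _ _ _
    simp
  refine Triple.nil ?_
  simp [hn, h.env.width_eq, h.env.rings_eq, h.bound_eq, h.len_eq] at hA₁ hA₂ hA₂' hA₃ hA₃'
  have hEv := (h.env.putNat 5 A₁ (by decide)).putNat 5 A₂ (by decide)
  have hread : ∀ v : Fin n, s.nat 8 v + L < I →
      s.real 1 ((s.nat 8 v + L + 1) * n + v) = S v (upTo S v b + L + 1) := by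
    intro v hv
    rw [h.env.time_eq _ hv, h.done_eq]
  by_cases hov : ∃ v : Fin n, s.nat 8 v + L < I ∧ S v (upTo S v b + L + 1) ≤ b + L / 2 ^ j
  · obtain ⟨v, hv, hle⟩ := hov
    have hA₂1 : A₂ 0 = 1 := hA₂ v v.2 (by rw [hread v hv]; exact hle) hv
    have hjlt : j < J := by
      refine lt_of_le_of_ne hjJ ?_
      rintro rfl
      exact absurd (hJ v) (not_lt.mpr hle)
    refine ⟨j + 1, by omega, by omega, ⟨hEv.putReal 5 A₃ (by decide), ?_, ?_, ?_, ?_⟩, ?_, ?_⟩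
    · simpa using h.done_eq
    · simpa using h.spin_eq
    · simpa using h.bound_eq
    · simp [hA₃ (by omega), pow_succ]
      ring
    · intro _; omega
    · simp [hA₂1]
  · push Not at hov
    have hA₂0 : A₂ 0 = 0 := by
      rw [hA₂' fun i hi hle => ?_, hA₁]
      by_contra hlt
      rw [not_le] at hlt
      have := hov ⟨i, hi⟩ hlt
      rw [← hread ⟨i, hi⟩ hlt] at this
      exact absurd hle (not_le.mpr this)
    refine ⟨j, hj, hjJ, ⟨hEv.putReal 5 A₃ (by decide), ?_, ?_, ?_, ?_⟩, ?_, ?_⟩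
    · simpa using h.done_eq
    · simpa using h.spin_eq
    · simpa using h.bound_eq
    · simpa [hA₃' 0 (fun h => by omega)] using h.len_eq
    · simp [hA₂0]
    · intro _ v
      by_cases hv : s.nat 8 v + L < I
      · exact Or.inr (hov v hv)
      · left
        rw [← h.done_eq]
        omega

/-- The search along the arcs: as no site has more than `L` rings in the phase, `L` steps suffice. -/
lemma triple_scan (hS : IsClock S) (hT : 0 < T) (hI : ∀ v, T < S v I) (hbT : b' ≤ T)
    (hL : ∀ v, upTo S v b' ≤ upTo S v b + L) (hK : 1 ≤ K) (hKm : (2 * m + n) * L ≤ K)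
    (h : SweepInv G q m I L T S e f X₀ z₀ b b' Δ 0 s)
    (hp : PointersUpTo m L S b b' 0 s) (hk : s.nat 7 0 = 0) :
    Triple O r ω (loop (ltN (readN 7 0) Algorithm.width) (.ofList Algorithm.scan)) s t
      (L * 3 + 1) K fun s' _ => SweepInv G q m I L T S e f X₀ z₀ b b' Δ 0 s' ∧
        PointersUpTo m L S b b' L s' := by
  refine Triple.loop (D := 2) (fun k s' _ => SweepInv G q m I L T S e f X₀ z₀ b b' Δ 0 s' ∧
    PointersUpTo m L S b b' k s' ∧ s'.nat 7 0 = k ∧ k ≤ L) L (by decide)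
    ⟨h, hp, hk, Nat.zero_le _⟩ ?_
  rintro k s t ⟨h, hp, hk, hkL⟩
  by_cases hlt : k < L
  swap
  · left
    obtain rfl : k = L := by omega
    exact ⟨by simp [hk, h.env.width_eq], h, hp⟩
  right
  refine ⟨by simp [hk, h.env.width_eq, hlt], hlt, ?_⟩
  have hn := h.env.sites_eq
  have hm := h.env.edges_eq
  have hLe := h.env.width_eq
  refine Triple.setN (by decide) (by simpa [hn, hm, hLe]) ?_ fun A₁ hA₁ hA₁' => ?_
  · intro i hi j hj _ _ hij
    simp at hij
    rw [hij]
  refine Triple.setReg (by decide) hK fun A₂ hA₂ => ?_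
  refine Triple.nil ⟨(h.putNat 11 _ (by decide) (by decide)).putNat 7 _ (by decide) (by decide),
    ?_, ?_, hlt⟩
  · refine PointersUpTo.putNat ?_ 7 _ (by decide)
    intro i hi v u hv hu hval
    simp at hv hu ⊢
    have hpi := hp i hi v u hv hu hval
    have hTv : S v (upTo S v b + i / (2 * m + n) + 1) ≤ b' := hS.lt_upTo.1 hval
    have hpu := hS.before_le_upTo (u := u) hTv
    have hIu := fun v => upTo_lt_rings hS hT hI hbT v
    have hIv := hIu v
    have hIu := hIu u
    have hLu := hL u
    simp [hn, hm, hLe] at hA₁ hA₁'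
    have h1 := hA₁ i hi
    have h2 := hA₁' i
    rw [hv, hu, h.done_eq, h.todo_eq, h.todo_eq, h.env.time_eq _ (by omega : _ ≤ I) v] at h1
    by_cases hg : s.nat 11 i < before S u (S v (upTo S v b + i / (2 * m + n) + 1))
    · rw [h1 ?_ (by omega) hval]
      · omega
      · rw [h.env.time_eq _ (by omega : _ ≤ I)]
        exact hS.lt_before.1 hg
    · rw [h2]
      · omega
      · rintro i' hi' hS' hlt' hval' rfl
        rw [hu, h.todo_eq] at hlt'
        rw [hv, hu, h.done_eq, h.env.time_eq _ (by omega : _ ≤ I),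
          h.env.time_eq _ (by omega : _ ≤ I)] at hS'
        exact hg (hS.lt_before.2 hS')
  · simp at hA₂
    simp [hA₂, hk]

/-- One sweep of the machine is one application of `sweep`, and the flag tells whether it has changed
anything. -/
lemma triple_round (hS : IsClock S) (hT : 0 < T) (hI : ∀ v, T < S v I) (hbT : b' ≤ T)
    (hbb : b ≤ b')
    (hL : ∀ v, upTo S v b' ≤ upTo S v b + L) (hb : 0 ≤ b) (hwin : IsWinner P e z)
    (hK : 1 ≤ K) (hKm : (2 * m + n) * L ≤ K) (hKq : n * L * q ≤ K) (hKqq : n * L * q * q ≤ K)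
    {j : ℕ} (h : SweepInv G q m I L T S e (drawRule z) X₀ z₀ b b' Δ j s)
    (hp : PointersUpTo m L S b b' L s) :
    Triple (oracle P) r ω (.ofList Algorithm.round) s t 6 K fun s' _ =>
      SweepInv G q m I L T S e (drawRule z) X₀ z₀ b b' Δ (j + 1) s' ∧
      PointersUpTo m L S b b' L s' ∧
      (s'.nat 5 0 ≠ 0 → ∃ v k, S v k ≤ b' ∧
        (sweep S (drawRule z))^[j + 1] (guess S (drawRule z) X₀ z₀ b) v k ≠
          (sweep S (drawRule z))^[j] (guess S (drawRule z) X₀ z₀ b) v k) ∧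
      (s'.nat 5 0 = 0 → ∀ v k, S v k ≤ b' →
        (sweep S (drawRule z))^[j + 1] (guess S (drawRule z) X₀ z₀ b) v k =
          (sweep S (drawRule z))^[j] (guess S (drawRule z) X₀ z₀ b) v k) := by
  set f := drawRule z with hf
  set W := fun j => (sweep S f)^[j] (guess S f X₀ z₀ b) with hW
  have hn := h.env.sites_eq
  have hm := h.env.edges_eq
  have hq := h.env.spins_eq
  have hLe := h.env.width_eq
  have hspin : ∀ (k : ℕ) (v : Fin n), k ≤ upTo S v b' → s.nat 10 (k * n + v) = W j v k := by
    intro k v hk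
    rw [h.spin_eq, if_pos hk]
  -- The pointer of an arc processor leads to the spin that its ring sees at the target of the arc.
  have harc : ∀ i < (2 * m + n) * L, ∃ v u : Fin n, s.nat 15 (i % (2 * m + n)) = v ∧
      s.nat 16 (i % (2 * m + n)) = u ∧ (upTo S v b + i / (2 * m + n) < upTo S v b' →
        s.nat 10 (s.nat 11 i * n + u) =
          W j u (before S u (S v (upTo S v b + i / (2 * m + n) + 1)))) := by
    intro i hi
    have hM : 0 < 2 * m + n := Nat.pos_of_ne_zero fun h0 => by simp [h0] at hi
    obtain ⟨v, u, hv, hu⟩ := h.env.arc (i % (2 * m + n)) (Nat.mod_lt _ hM)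
    refine ⟨v, u, hv, hu, fun hval => ?_⟩
    have hle := hS.before_le_upTo (u := u) (hS.lt_upTo.1 hval)
    rw [hp i hi v u hv hu hval, min_eq_left (hle.trans (hL u)), hspin _ _ hle]
  unfold Algorithm.round
  refine Triple.setN (by decide) (by simpa [hn, hm, hLe]) ?_ fun A₁ hA₁ _ => ?_
  · intro i hi i' hi' hg hg' hij
    simp [hn, hm, hLe] at hi hi' hg hg' hij ⊢
    obtain ⟨v, u, hv, hu, hval⟩ := harc i hi
    obtain ⟨v', u', hv', hu', hval'⟩ := harc i' hi'
    rw [hv, h.done_eq, h.todo_eq] at hg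
    rw [hv', h.done_eq, h.todo_eq] at hg'
    rw [hv, hv', hu, hu', h.done_eq, h.done_eq] at hij
    obtain ⟨h1, h2⟩ := index_inj u.2 u'.2 hij
    obtain ⟨h3, h4⟩ := index_inj v.2 v'.2 h1
    obtain rfl := Fin.ext h2
    obtain rfl := Fin.ext h4
    rw [hu, hu', hval hg, hval' hg', h3]
  simp [hn, hm, hLe] at hA₁
  have hτ : ∀ (v : Fin n) (i : ℕ), upTo S v b ≤ i → i < upTo S v b' → ∀ u : Nbhd G v,
      A₁ ((i * n + v) * n + u.1) = W j u.1 (before S u.1 (S v (i + 1))) := by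
    intro v i hi hi' u
    obtain ⟨w, hw, hv, hu⟩ := h.env.arc_of_nbhd v u
    obtain ⟨l, rfl⟩ := Nat.exists_eq_add_of_le hi
    have hl : l < L := by have := hL v; omega
    have hlt : l * (2 * m + n) + w < (2 * m + n) * L := by
      rw [mul_comm (2 * m + n) L]
      exact index_lt hw hl
    obtain ⟨v', u', hv', hu', hval⟩ := harc _ hlt
    rw [mod_index hw] at hv' hu'
    obtain rfl := Fin.ext (hv.symm.trans hv')
    obtain rfl := Fin.ext (hu.symm.trans hu')
    have h1 := hA₁ _ hlt
    rw [mod_index hw, div_index hw, hv, hu, h.done_eq, h.todo_eq] at h1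
    rw [div_index hw] at hval
    rw [h1 hi', hval hi']
  have h₁ := h.putNat 12 A₁ (by decide) (by decide)
  refine Triple.setN (by decide) (by simpa [hn, hq, hLe]) (fun _ _ _ _ _ _ _ => by simp)
    fun A₂ hA₂ _ => ?_
  simp [hn, hq, hLe] at hA₂
  refine Triple.setN (by decide) (by simpa [hn, hq, hLe]) (fun _ _ _ _ _ _ _ => by simp)
    fun A₃ hA₃ hA₃' => ?_
  simp [hn, hq, hLe] at hA₃ hA₃'
  -- The spin without a mark is the winner of the race, for the configuration that the ring sees.
  have hrace : ∀ (v : Fin n) (l : ℕ), l < L → upTo S v b + l < upTo S v b' → ∀ x : Fin q,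
      A₃ ((l * n + v) * q + x) = 0 ↔ x = W (j + 1) v (upTo S v b + l + 1) := by
    intro v l hl hval x
    have hring : upTo S v b + l < I :=
      hval.trans (upTo_lt_rings hS hT hI hbT v)
    have hslot : l * n + v < n * L := by rw [mul_comm n L]; exact index_lt v.2 hl
    have hor : ∀ y : Fin q, oracle P v (fun u => A₁ (((upTo S v b + l) * n + v) * n + u)) y =
        (P v (fun u => W j u.1 (before S u.1 (S v (upTo S v b + l + 1)))) y).toReal := fun y =>
      oracle_eq P v _ (fun u => W j u (before S u (S v (upTo S v b + l + 1))))
        (hτ v (upTo S v b + l) (Nat.le_add_right _ _) hval) y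
    have hiff := hwin ⟨v, upTo S v b + l,
      fun u => W j u.1 (before S u.1 (S v (upTo S v b + l + 1)))⟩ x
    have hstep : W (j + 1) v (upTo S v b + l + 1) = z ⟨v, upTo S v b + l,
      fun u => W j u.1 (before S u.1 (S v (upTo S v b + l + 1)))⟩ :=
      iterate_sweep_succ _ _ _ _
    rw [hstep, hiff]
    have hrd : ∀ y : Fin q, s.real 2 (((upTo S v b + l) * n + v) * q + y) =
        e (v, upTo S v b + l) y := fun y => h.env.race_eq _ hring v y
    constructor
    · intro h0 y hlt
      have hpid : ((l * n + v) * q + x) * q + y < n * L * q * q :=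
        index_lt y.2 (index_lt x.2 hslot)
      have h1 := hA₃ _ hpid
      rw [div_index y.2, div_index x.2, mod_index y.2, mod_index x.2, mod_index v.2,
        div_index v.2, h.done_eq, h.todo_eq, hor, hor, hrd, hrd] at h1
      have := h1 hlt hval
      omega
    · intro hno
      rw [hA₃', hA₂ _ (index_lt x.2 hslot)]
      intro i hi hlt hval' hix
      have hq0 : 0 < q := x.pos
      have hy : i % q < q := Nat.mod_lt _ hq0
      rw [hix, div_index x.2, mod_index x.2, mod_index v.2, div_index v.2, h.done_eq,
        hor x, hrd x, hor ⟨i % q, hy⟩, hrd ⟨i % q, hy⟩] at hlt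
      exact hno _ hlt
  have h₃ := (h₁.putNat 13 A₂ (by decide) (by decide)).putNat 13 A₃ (by decide) (by decide)
  refine Triple.setReg (by decide) hK fun A₄ hA₄ => ?_
  refine Triple.raise (by decide) (by simpa [hn, hq, hLe]) fun A₅ hA₅ hA₅' => ?_
  have hdec : ∀ i < n * L * q, ∃ (v : Fin n) (l : ℕ) (x : Fin q), l < L ∧
      i = (l * n + v) * q + x ∧ i / q = l * n + v ∧ i % q = x := by
    intro i hi
    have hq0 : 0 < q := Nat.pos_of_ne_zero fun h0 => by simp [h0] at hi
    have hn0 : 0 < n := Nat.pos_of_ne_zero fun h0 => by simp [h0] at hi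
    have h1 : i / q < L * n := by rw [mul_comm L n]; exact div_lt_of_lt_mul' hi
    refine ⟨⟨i / q % n, Nat.mod_lt _ hn0⟩, i / q / n, ⟨i % q, Nat.mod_lt _ hq0⟩,
      div_lt_of_lt_mul' h1, ?_, ?_, rfl⟩ <;> simp only [Nat.div_add_mod']
  refine Triple.setN (by decide) (by simpa [hn, hq, hLe]) ?_ fun A₆ hA₆ hA₆' => ?_
  · intro i hi i' hi' hg hg' hij
    simp [hn, hq, hLe] at hi hi' hg hg' hij ⊢
    obtain ⟨v, l, x, hl, hix, hdiv, hmod⟩ := hdec i hi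
    obtain ⟨v', l', x', hl', hix', hdiv', hmod'⟩ := hdec i' hi'
    rw [hdiv, mod_index v.2, div_index v.2, h.done_eq, h.todo_eq, hix] at hg
    rw [hdiv', mod_index v'.2, div_index v'.2, h.done_eq, h.todo_eq, hix'] at hg'
    rw [hdiv, hdiv', mod_index v.2, div_index v.2, mod_index v'.2, div_index v'.2, h.done_eq,
      h.done_eq] at hij
    obtain ⟨h1, h2⟩ := index_inj v.2 v'.2 hij
    obtain rfl := Fin.ext h2
    obtain rfl : l = l' := by omega
    rw [hmod, hmod', (hrace v l hl hg.2 x).1 hg.1, (hrace v l hl hg'.2 x').1 hg'.1]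
  refine Triple.nil ?_
  simp [hn, hq, hLe] at hA₄ hA₅ hA₅' hA₆ hA₆'
  have hfin := ((h₃.putNat 5 A₄ (by decide) (by decide)).putNat 5 A₅ (by decide) (by decide))
  refine ⟨⟨hfin.env.putNat 10 A₆ (by decide), ?_, ?_, ?_, ?_, ?_⟩, ?_, ?_, ?_⟩
  · simpa using h.done_eq
  · simpa using h.todo_eq
  · intro k v
    simp [-Function.iterate_succ]
    by_cases hk : upTo S v b < k ∧ k ≤ upTo S v b'
    · obtain ⟨hk1, hk2⟩ := hk
      rw [if_pos hk2]
      obtain ⟨l, rfl⟩ := Nat.exists_eq_add_of_lt hk1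
      have hl : l < L := by have := hL v; omega
      have hslot : l * n + v < n * L := by rw [mul_comm n L]; exact index_lt v.2 hl
      have h1 := hA₆ ((l * n + v) * q + W (j + 1) v (upTo S v b + l + 1))
        (index_lt (Fin.is_lt _) hslot)
      rw [mod_index (Fin.is_lt _), div_index (Fin.is_lt _), mod_index v.2, div_index v.2,
        h.done_eq, h.todo_eq] at h1
      exact h1 ((hrace v l hl (by omega) _).2 rfl) (by omega)
    · rw [hA₆']
      · rw [h.spin_eq]
        split_ifs with hle
        · have hle' : S v k ≤ b := (hS.le_upTo hb).1 (by omega)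
          rw [iterate_sweep_guess_of_le hS _ hle', iterate_sweep_guess_of_le hS _ hle']
        · rfl
      · intro i hi hA hval hidx
        obtain ⟨v', l', x', hl', hix', hdiv', hmod'⟩ := hdec i hi
        rw [hdiv', mod_index v'.2, div_index v'.2, h.done_eq, h.todo_eq] at hval
        rw [hdiv', mod_index v'.2, div_index v'.2, h.done_eq] at hidx
        obtain ⟨h1, h2⟩ := index_inj v'.2 v.2 hidx
        obtain rfl := Fin.ext h2
        exact hk (by omega)
  · simpa using h.bound_eq
  · simpa using h.len_eq
  · exact (((((hp.putNat 12 _ (by decide)).putNat 13 _ (by decide)).putNat 13 _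
      (by decide)).putNat 5 _ (by decide)).putNat 5 _ (by decide)).putNat 10 _ (by decide)
  · intro hne
    simp at hne
    by_contra hcon
    push Not at hcon
    apply hne
    rw [hA₅' ?_, hA₄]
    intro i hi hA hval
    obtain ⟨v, l, x, hl, hix, hdiv, hmod⟩ := hdec i hi
    rw [hdiv, mod_index v.2, div_index v.2, h.done_eq, h.todo_eq] at hval
    rw [hix] at hA
    rw [hdiv, hmod, mod_index v.2, div_index v.2, h.done_eq, hspin _ _ hval,
      (hrace v l hl hval x).1 hA]
    have := congrArg Fin.val (hcon v _ (hS.lt_upTo.1 hval))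
    exact ⟨this.le, this.ge⟩
  · intro h0 v k hk
    simp at h0
    by_cases hle : S v k ≤ b
    · rw [iterate_sweep_guess_of_le hS _ hle, iterate_sweep_guess_of_le hS _ hle]
    have hk1 : upTo S v b < k := not_le.1 fun h => hle ((hS.le_upTo hb).1 h)
    have hk2 : k ≤ upTo S v b' := (hS.le_upTo (hb.trans hbb)).2 hk
    obtain ⟨l, rfl⟩ := Nat.exists_eq_add_of_lt hk1
    have hl : l < L := by have := hL v; omega
    have hslot : l * n + v < n * L := by rw [mul_comm n L]; exact index_lt v.2 hl
    by_contra hne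
    have h1 := hA₅ ((l * n + v) * q + W (j + 1) v (upTo S v b + l + 1))
      (index_lt (Fin.is_lt _) hslot)
    rw [mod_index (Fin.is_lt _), div_index (Fin.is_lt _), mod_index v.2, div_index v.2,
      h.done_eq, h.todo_eq, hspin _ _ hk2] at h1
    have h2 : (W (j + 1) v (upTo S v b + l + 1) : ℕ) ≠ W j v (upTo S v b + l + 1) :=
      fun h => hne (Fin.ext h)
    have h3 := h1 ((hrace v l hl (by omega) _).2 rfl) (by omega) (by omega)
    omega

end SingleSite

end


noncomputable section

namespace SingleSite

open PRAM (Expr Action Prog Store Triple Oracle Resolver Tape evalN evalR unitCost HaltsIn)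
open PRAM.Expr (readN readR ltN ltR ofNat query pid)
open PRAM.Prog (par loop)
open PRAM.Action (setN setR randE)

variable {n q m : ℕ}

variable {G : SimpleGraph (Fin n)} {P : LocalRule G q} {I L : ℕ} {T : ℝ} {S : Fin n → ℕ → ℝ}
  {e : Fin n × ℕ → Fin q → ℝ} {z : Draws G q} {X₀ : Fin n → Fin q} {z₀ : Fin q} {b b' Δ : ℝ}
  {r : Resolver} {ω : Tape} {s : Store} {t K : ℕ}

/-- Sweeps until nothing changes. If the sweep `l + 1` changes nothing, the loop ends after at most that
many sweeps; and whenever it ends, the spins are correct. -/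
lemma triple_rounds (hS : IsClock S) (hT : 0 < T) (hI : ∀ v, T < S v I) (hbT : b' ≤ T)
    (hbb : b ≤ b') (hL : ∀ v, upTo S v b' ≤ upTo S v b + L) (hb : 0 ≤ b) (hwin : IsWinner P e z)
    (hK : 1 ≤ K) (hKm : (2 * m + n) * L ≤ K) (hKq : n * L * q ≤ K) (hKqq : n * L * q * q ≤ K)
    {l : ℕ} (hl : ∀ v k, S v k ≤ b' →
      (sweep S (drawRule z))^[l + 1] (guess S (drawRule z) X₀ z₀ b) v k =
        (sweep S (drawRule z))^[l] (guess S (drawRule z) X₀ z₀ b) v k)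
    (h : SweepInv G q m I L T S e (drawRule z) X₀ z₀ b b' Δ 0 s)
    (hp : PointersUpTo m L S b b' L s) (hflag : s.nat 5 0 ≠ 0) :
    Triple (oracle P) r ω (loop Algorithm.flag (.ofList Algorithm.round)) s t
      ((l + 1) * 7 + 1) K fun s' _ => ∃ j,
        SweepInv G q m I L T S e (drawRule z) X₀ z₀ b b' Δ j s' ∧ ∀ v k, S v k ≤ b' →
          (sweep S (drawRule z))^[j] (guess S (drawRule z) X₀ z₀ b) v k =
            truth S (drawRule z) X₀ v k := by
  refine Triple.loop (D := 6) (fun j s' _ =>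
    SweepInv G q m I L T S e (drawRule z) X₀ z₀ b b' Δ j s' ∧ PointersUpTo m L S b b' L s' ∧
      (s'.nat 5 0 ≠ 0 → j ≤ l) ∧ (s'.nat 5 0 = 0 → ∀ v k, S v k ≤ b' →
        (sweep S (drawRule z))^[j] (guess S (drawRule z) X₀ z₀ b) v k =
          truth S (drawRule z) X₀ v k)) (l + 1) (by decide)
    ⟨h, hp, fun _ => Nat.zero_le _, fun h => absurd h hflag⟩ ?_
  rintro j s t ⟨h, hp, hf, hf'⟩
  by_cases h0 : s.nat 5 0 = 0
  · exact Or.inl ⟨h0, j, h, hf' h0⟩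
  right
  have hjl := hf h0
  refine ⟨h0, by omega, ?_⟩
  refine (triple_round hS hT hI hbT hbb hL hb hwin hK hKm hKq hKqq h hp).mono le_rfl ?_
  rintro s' t' ⟨h', hp', hch, hst⟩
  refine ⟨h', hp', fun hne => ?_, fun h0 v k hk => ?_⟩
  · obtain ⟨v, k, hk, hne⟩ := hch hne
    rcases hjl.lt_or_eq with hlt | rfl
    · exact hlt
    · exact absurd (hl v k hk) hne
  · rw [hst h0 v k hk]
    exact iterate_sweep_guess_of_settled hS hb (hst h0) hk

/-- One phase, which may be shortened from length `L / 2 ^ j₀` to `L / 2 ^ j`. All sweeps start from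
guesses that are correct up to the beginning `b` of the phase. -/
lemma triple_phase (hS : IsClock S) (hT : 0 < T) (hI : ∀ v, T < S v I) (hbT : b < T)
    (hz : (z₀ : ℕ) = 0) (hb : 0 ≤ b) (hwin : IsWinner P e z)
    (hK : 1 ≤ K) (hKn : n ≤ K) (hKL : n * L ≤ K) (hKm : (2 * m + n) * L ≤ K)
    (hKq : n * L * q ≤ K) (hKqq : n * L * q * q ≤ K) {j₀ J l : ℕ} (hj₀ : j₀ ≤ J)
    (hJ : ∀ v, b + L / 2 ^ J < S v (upTo S v b + L + 1))
    (hl : ∀ v k, S v k ≤ T → S v k ≤ b + L →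
      (sweep S (drawRule z))^[l + 1] (guess S (drawRule z) X₀ z₀ b) v k =
        (sweep S (drawRule z))^[l] (guess S (drawRule z) X₀ z₀ b) v k)
    (h : PhaseInv G q m I L T S e (drawRule z) X₀ z₀ b (L / 2 ^ j₀) s) :
    Triple (oracle P) r ω (.ofList Algorithm.phase) s t (4 * J + 3 * L + 7 * l + 23) K
      fun s' _ => ∃ j, j₀ ≤ j ∧ j ≤ J ∧
        PhaseInv G q m I L T S e (drawRule z) X₀ z₀ (min (b + L / 2 ^ j) T) (L / 2 ^ j) s' := by
  have hD : 4 * J + 3 * L + 7 * l + 23 = (((J + 1) * 4 + 1) +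
      (((L * 3 + 1) + ((((l + 1) * 7 + 1) + (0 + 1)) + 1)) + 1 + 1 + 1 + 1 + 1 + 1)) + 1 := by ring
  rw [hD]
  unfold Algorithm.phase
  refine Triple.setReg (by decide) hK fun A₀ hA₀ => ?_
  refine Triple.cons (triple_shorten hj₀ hJ hK hKn (h.putNat 5 A₀ (by decide) (by decide))
    (by simpa using hA₀.trans_ne one_ne_zero)) ?_ le_rfl
  rintro s t ⟨j, hj, hjJ, h, hfit⟩
  set Δ : ℝ := L / 2 ^ j with hΔ
  have hΔ0 : 0 ≤ Δ := by positivity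
  have hΔL : Δ ≤ L := div_le_self (Nat.cast_nonneg _) (one_le_pow₀ (by norm_num))
  set b' := min (b + Δ) T with hb'
  have hb'T : b' ≤ T := min_le_right _ _
  have hbb' : b ≤ b' := le_min (by linarith) hbT.le
  have hlt := fun v => upTo_lt_rings hS hT hI hb'T v
  have hL : ∀ v, upTo S v b' ≤ upTo S v b + L := by
    intro v
    by_contra hcon
    push Not at hcon
    have h1 := hS.lt_upTo.1 hcon
    have h2 := hlt v
    rcases hfit v with h3 | h3
    · omega
    · exact absurd (h1.trans (min_le_left _ _)) (not_le.mpr h3)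
  have hn := h.env.sites_eq
  have hm := h.env.edges_eq
  have hLe := h.env.width_eq
  refine Triple.setR (by decide) (by simpa using hK) (fun i _ j _ _ _ _ => by simp)
    fun A₁ hA₁ _ => ?_
  refine Triple.setR (by decide) (by simpa using hK) (fun i _ j _ _ _ _ => by simp)
    fun A₂ hA₂ hA₂' => ?_
  simp [h.bound_eq, h.len_eq, h.env.horizon_eq] at hA₁ hA₂ hA₂'
  have hbound : A₂ 0 = b' := by
    rcases le_or_gt (b + Δ) T with hle | hgt
    · rw [hA₂' 0 fun h => absurd h (by rw [hA₁]; exact not_lt.mpr hle), hA₁, hb', min_eq_left hle]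
    · rw [hA₂ (by rwa [hA₁]), hb', min_eq_right hgt.le]
  refine Triple.setN (by decide) (by simpa [hn]) (fun i _ j _ _ _ hij => by simp at hij; rw [hij])
    fun A₃ hA₃ _ => ?_
  simp [hn] at hA₃
  have hguard : ∀ (v : Fin n) (i : ℕ), i < I → S v (i + 1) ≤ b' →
      b' < s.real 1 ((i + 2) * n + v) → i + 1 = upTo S v b' := by
    intro v i hi h1 h2
    have h3 := hS.lt_upTo.2 h1
    have h4 := hlt v
    rw [h.env.time_eq _ (by omega)] at h2
    have h5 : ¬ i + 1 < upTo S v b' := fun h6 => absurd (hS.lt_upTo.1 h6) (not_le.mpr h2)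
    omega
  have hsite : ∀ i < n * L, ∃ v : Fin n, i % n = v ∧ i / n < L := by
    intro i hi
    have hn0 : 0 < n := Nat.pos_of_ne_zero fun h0 => by simp [h0] at hi
    exact ⟨⟨i % n, Nat.mod_lt _ hn0⟩, rfl, div_lt_of_lt_mul' (by rwa [mul_comm])⟩
  refine Triple.setN (by decide) (by simpa [hn, hLe]) ?_ fun A₄ hA₄ hA₄' => ?_
  · intro i hi i' hi' hg hg' hij
    simp [hn, hLe, h.env.rings_eq, hbound] at hi hi' hg hg' hij ⊢
    obtain ⟨v, hv, -⟩ := hsite i hi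
    rw [← hij, hv] at hg'
    rw [hv] at hg
    rw [← hij, hv]
    rw [h.done_eq] at hg hg' ⊢
    obtain ⟨h3, h2, h1⟩ := hg
    obtain ⟨h3', h2', h1'⟩ := hg'
    rw [h.env.time_eq _ h1] at h2
    rw [h.env.time_eq _ h1'] at h2'
    have := hguard v _ h1 h2 h3
    have := hguard v _ h1' h2' h3'
    omega
  simp [hn, hLe, h.env.rings_eq, hbound] at hA₄ hA₄'
  have htodo : ∀ v : Fin n, A₄ v = upTo S v b' := by
    intro v
    rcases (hS.upTo_mono (u := v) hbb').lt_or_eq with hlt' | heq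
    · obtain ⟨i, hi⟩ := Nat.exists_eq_add_of_lt hlt'
      have hiL : i < L := by have := hL v; omega
      have h1 := hA₄ (i * n + v) (by rw [mul_comm n L]; exact index_lt v.2 hiL)
      have h2 := hlt v
      rw [mod_index v.2, div_index v.2, h.done_eq, h.env.time_eq _ (by omega),
        h.env.time_eq _ (by omega)] at h1
      rw [h1 ?_ (hS.lt_upTo.1 (by omega)) (by omega), hi]
      by_contra hcon
      push Not at hcon
      have := hS.lt_upTo.2 hcon
      omega
    · rw [hA₄', hA₃ v v.2, h.done_eq, heq]
      intro i hi h3 h2 h1 hiv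
      rw [hiv, h.done_eq] at h1 h2 h3
      rw [h.env.time_eq _ h1] at h2
      have := hguard v _ h1 h2 h3
      generalize i / n = d at this
      omega
  have hE := ((((h.env.putReal 4 A₁ (by decide)).putReal 4 A₂ (by decide)).putNat 9 A₃
    (by decide)).putNat 9 A₄ (by decide))
  have hsw : SweepInv G q m I L T S e (drawRule z) X₀ z₀ b b' Δ 0
      ((((s.putReal 4 A₁).putReal 4 A₂).putNat 9 A₃).putNat 9 A₄) := by
    refine ⟨hE, ?_, ?_, ?_, ?_, ?_⟩
    · simpa using h.done_eq
    · simpa using htodo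
    · intro k v
      simp [h.spin_eq]
      intro hk
      rw [guess_of_lt, hz]
      by_contra hcon
      push Not at hcon
      have := (hS.le_upTo hb).2 hcon
      have := hS.upTo_mono (u := v) hbb'
      omega
    · simpa using hbound
    · simpa using h.len_eq
  refine Triple.setN (by decide) (by simpa [hn, hm, hLe])
    (fun i _ j _ _ _ hij => by simp at hij; rw [hij]) fun A₅ hA₅ _ => ?_
  simp [hn, hm, hLe] at hA₅
  refine Triple.setReg (by decide) hK fun A₆ hA₆ => ?_
  refine Triple.cons (triple_scan hS hT hI hb'T hL hK hKm
    ((hsw.putNat 11 A₅ (by decide) (by decide)).putNat 7 A₆ (by decide) (by decide)) ?_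
    (by simpa using hA₆)) ?_ le_rfl
  · refine PointersUpTo.putNat ?_ 7 _ (by decide)
    intro i hi v u hv hu hval
    simp at hv hu ⊢
    rw [hA₅ i hi, hu, h.done_eq, min_eq_right]
    refine (hS.le_before (hS.pos _ _)).2 (((hS.le_upTo hb).1 le_rfl).trans_lt ?_)
    by_contra hcon
    push Not at hcon
    exact absurd (hS.lt_upTo.2 hcon) (not_lt.mpr (Nat.le_add_right _ _))
  rintro s₁ t₁ ⟨hsw₁, hp₁⟩
  refine Triple.setReg (by decide) hK fun A₇ hA₇ => ?_
  refine Triple.cons (D₂ := 1) (triple_rounds hS hT hI hb'T hbb' hL hb hwin hK hKm hKq hKqq (l := l) ?_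
    (hsw₁.putNat 5 A₇ (by decide) (by decide)) (hp₁.putNat 5 A₇ (by decide))
    (by simpa using hA₇.trans_ne one_ne_zero)) ?_ (by omega)
  · intro v k hk
    exact hl v k (hk.trans hb'T) (hk.trans ((min_le_left _ _).trans (by linarith)))
  rintro s₂ t₂ ⟨i, hsw₂, hok⟩
  have hn₂ := hsw₂.env.sites_eq
  refine Triple.setN (by decide) (by simpa [hn₂])
    (fun i _ j _ _ _ hij => by simp at hij; rw [hij]) fun A₈ hA₈ _ => Triple.nil ?_
  simp [hn₂] at hA₈
  refine ⟨j, hj, hjJ, hsw₂.env.putNat 8 A₈ (by decide), ?_, ?_, ?_, ?_⟩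
  · intro v
    simp [hA₈, hsw₂.todo_eq, hb', hΔ]
  · intro k v
    simp [hsw₂.spin_eq]
    have hiff := hS.le_upTo (u := v) (hb.trans hbb') (k := k)
    by_cases hk : S v k ≤ b'
    · rw [if_pos (hiff.2 hk), guess_of_le hk, hok v k hk]
    · rw [if_neg (fun h => hk (hiff.1 h)), guess_of_lt (not_le.1 hk), hz]
  · simpa using hsw₂.bound_eq
  · simpa using hsw₂.len_eq

/-- The algorithm started with good random numbers: `M₀` rings per site cover the time horizon, a
phase of length `s = L / 2 ^ J` never contains more than `L` rings of a site, and `l` sweeps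
settle every phase, whenever the phase starts at a multiple of `s`. -/
theorem algorithm_spec {E : Fin m → Fin n × Fin n} {g : Gaps n} (hE : IsEdgeList G E)
    (hn : 0 < n) (hq : 0 < q) (hT : 0 < T) (hS : IsClock (clock g))
    (hg : ∀ v i, g (v, i) = -Real.log (ω (14 * i + 5, v) : ℝ))
    (he : ∀ v i (x : Fin q), e (v, i) x = -Real.log (ω (14 * i + 9, v * q + x) : ℝ))
    (hwin : IsWinner P e z) (hz : (z₀ : ℕ) = 0) (hL : L = Nat.clog 2 n + 1)
    {M₀ J l N : ℕ} (hM₀ : ∀ v, T < clock g v M₀)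
    (hJ : ∀ k : ℕ, k * (L / 2 ^ J : ℝ) < T → ∀ v, k * (L / 2 ^ J : ℝ) + L / 2 ^ J <
      clock g v (upTo (clock g) v (k * (L / 2 ^ J : ℝ)) + L + 1))
    (hl : ∀ k : ℕ, k * (L / 2 ^ J : ℝ) < T → ∀ v i, clock g v i ≤ T →
      clock g v i ≤ k * (L / 2 ^ J : ℝ) + L →
      (sweep (clock g) (drawRule z))^[l + 1]
        (guess (clock g) (drawRule z) X₀ z₀ (k * (L / 2 ^ J : ℝ))) v i =
      (sweep (clock g) (drawRule z))^[l]
        (guess (clock g) (drawRule z) X₀ z₀ (k * (L / 2 ^ J : ℝ))) v i)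
    (hN : T ≤ N * (L / 2 ^ J : ℝ)) :
    ∃ c, HaltsIn algorithm (oracle P) r ω (input X₀ E T) c ∧
      Outputs c (fun v => truth (clock g) (drawRule z) X₀ v (upTo (clock g) v T)) ∧
      c.depth ≤ unitCost * (M₀ * 7 + 3 * L + 13 + N * (4 * J + 3 * L + 7 * l + 24)) ∧
      c.procs ≤ (2 * m + n * q * q) * L := by
  have hL1 : 1 ≤ L := by omega
  have hs0 : (0 : ℝ) < L / 2 ^ J := by positivity
  set s : ℝ := L / 2 ^ J with hs
  set K := (2 * m + n * q * q) * L with hKdef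
  have hqq : 1 ≤ q * q := Nat.mul_pos hq hq
  have hnqq : n ≤ n * q * q := by rw [mul_assoc]; exact Nat.le_mul_of_pos_right _ hqq
  have hnq : n * q ≤ n * q * q := Nat.le_mul_of_pos_right _ hq
  have hKm : (2 * m + n) * L ≤ K := Nat.mul_le_mul_right _ (by omega)
  have hKqq : n * L * q * q ≤ K := by
    calc n * L * q * q = (n * q * q) * L := by ring
      _ ≤ K := Nat.mul_le_mul_right _ (by omega)
  have hKq : n * L * q ≤ K := (Nat.le_mul_of_pos_right _ hq).trans hKqq
  have hKL : n * L ≤ K := (Nat.le_mul_of_pos_right _ hq).trans hKq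
  have hKm' : 2 * m + n ≤ K := (Nat.le_mul_of_pos_right _ hL1).trans hKm
  have hKn : n ≤ K := by omega
  have hKnq : n * q ≤ K := by
    calc n * q ≤ 2 * m + n * q * q := by omega
      _ ≤ K := Nat.le_mul_of_pos_right _ hL1
  have hK : 1 ≤ K := by omega
  have hM₁ : 1 ≤ M₀ := by
    by_contra h
    obtain rfl : M₀ = 0 := by omega
    exact absurd (hM₀ ⟨0, hn⟩) (not_lt.mpr ((hS.zero _).le.trans hT.le))
  suffices H : Triple (oracle P) r ω algorithm (input X₀ E T) 0
      (M₀ * 7 + 3 * L + 13 + N * (4 * J + 3 * L + 7 * l + 24)) K fun s' _ =>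
        ∀ v : Fin n, s'.nat 1 v = truth (clock g) (drawRule z) X₀ v (upTo (clock g) v T) by
    obtain ⟨c, hc, ho, hd, hp⟩ := H.haltsIn
    exact ⟨c, hc, ho, hd, hp.trans (max_le hK le_rfl)⟩
  have hD : M₀ * 7 + 3 * L + 13 + N * (4 * J + 3 * L + 7 * l + 24) =
      (M₀ * 7 + 1) + ((Nat.clog 2 n * 3 + 11) +
        ((N * (4 * J + 3 * L + 7 * l + 23 + 1) + 1) + (0 + 1))) + 1 + 1 := by
    rw [hL]; ring
  rw [hD]
  refine Triple.mono ?_ (Nat.le_succ _) fun _ _ h => h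
  unfold algorithm
  refine Triple.setReg (by decide) hK fun A hA => ?_
  set s₀ := (input X₀ E T).putNat 5 A with hs₀
  -- `GenInv` speaks of the time at which the flag is tested; the loop is left one unit of time later.
  refine Triple.cons (Q₁ := fun s' t' => ∃ I, GenInv s₀ n q T g e I s' (t' - 1) ∧
    ∀ v, T < clock g v I) (Triple.loop (D := 6) (GenInv s₀ n q T g e) M₀ (by decide) ?_ ?_)
    ?_ le_rfl
  · refine ⟨rfl, fun _ _ _ => rfl, ?_, fun _ _ _ _ => rfl, ?_, ?_, fun _ h => absurd rfl h, ?_⟩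
    · simp [hs₀, input]
    · intro k hk v
      obtain rfl : k = 0 := by omega
      simp [hs₀, input, clock]
    · intro i hi
      omega
    · intro h0
      simp [hs₀] at h0
      simp at hA
      omega
  · rintro i s t h
    by_cases h0 : s.nat 5 0 = 0
    · exact Or.inl ⟨h0, i, h, (h.of_flag h0).2⟩
    · refine Or.inr ⟨h0, ?_, ?_⟩
      · by_contra hcon
        obtain ⟨v, hv⟩ := h.flag_of h0 (by omega)
        have := (hS.mono v).monotone (not_lt.1 hcon)
        exact absurd (hM₀ v) (not_lt.mpr (this.trans hv))
      · refine triple_generate ?_ ?_ ?_ hK hKn hKnq hg he h <;> simp [hs₀, input, pad]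
  rintro s₁ t₁ ⟨I, hgen, hI⟩
  refine Triple.cons (triple_prepare (s₀ := s₀) (f := drawRule z) (X₀ := X₀) (z₀ := z₀) hE hS hz ?_ rfl hK
    hKm' hgen) ?_ le_rfl
  · intro a ha
    simp [hs₀, ha]
  rintro s₂ t₂ hph
  rw [← hL] at hph
  -- Every phase begins at a multiple of `s`, since every length of a phase is a multiple of `s`.
  refine Triple.cons (D₂ := 1) (Q₁ := fun s' _ => PhaseInv G q m I L T (clock g) e (drawRule z) X₀ z₀ T
    (s'.real 5 0) s') (Triple.loop (D := 4 * J + 3 * L + 7 * l + 23)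
    (fun i s' _ => ∃ k j : ℕ, i ≤ k ∧ j ≤ J ∧ PhaseInv G q m I L T (clock g) e (drawRule z) X₀ z₀
      (min (k * s) T) (L / 2 ^ j) s') N (by decide) ?_ ?_) ?_ le_rfl
  · refine ⟨0, 0, le_rfl, Nat.zero_le _, ?_⟩
    simpa [min_eq_left hT.le] using hph
  · rintro i s' t' ⟨k, j, hik, hjJ, h⟩
    by_cases hlt : min (k * s) T < T
    · have hks : k * s < T := by
        rcases min_lt_iff.1 hlt with h | h
        · exact h
        · exact absurd h (lt_irrefl _)
      rw [min_eq_left hks.le] at h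
      refine Or.inr ⟨by simp [h.bound_eq, h.env.horizon_eq, hks], ?_, ?_⟩
      · have : (k : ℝ) < N := lt_of_mul_lt_mul_right (hks.trans_le hN) hs0.le
        have : k < N := by exact_mod_cast this
        omega
      · refine (triple_phase hS hT hI hks hz (by positivity) hwin hK hKn hKL hKm hKq hKqq hjJ
          (hJ k hks) (hl k hks) h).mono le_rfl ?_
        rintro s'' t'' ⟨j', hjj, hjJ', h'⟩
        refine ⟨k + 2 ^ (J - j'), j', ?_, hjJ', ?_⟩
        · have := Nat.one_le_two_pow (n := J - j')
          omega
        · have : (L : ℝ) / 2 ^ j' = 2 ^ (J - j') * s := by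
            rw [hs, ← Nat.sub_add_cancel hjJ', pow_add, Nat.add_sub_cancel]
            field_simp
          rw [Nat.cast_add, add_mul, Nat.cast_pow, Nat.cast_ofNat, ← this]
          exact h'
    · have hmin : min (k * s) T = T := le_antisymm (min_le_right _ _) (not_lt.1 hlt)
      rw [hmin] at h
      refine Or.inl ⟨by simp [h.bound_eq, h.env.horizon_eq], ?_⟩
      rw [h.len_eq]
      exact h
  rintro s₃ t₃ h
  have hn₃ := h.env.sites_eq
  refine Triple.setN (by decide) (by simpa [hn₃])
    (fun i _ j _ _ _ hij => by simp at hij; rw [hij]) fun B hB _ => Triple.nil ?_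
  intro v
  simp [hn₃] at hB
  simp
  rw [hB v v.2, h.done_eq, h.spin_eq, guess_of_le]
  exact (hS.le_upTo hT.le).1 le_rfl

end SingleSite

end


/-! ### Product measures and exponential variables -/

noncomputable section

namespace MeasureTheory

section InfinitePi

variable {ι : Type*} {X : ι → Type*} [∀ i, MeasurableSpace (X i)] (μ : ∀ i, Measure (X i))
  [∀ i, IsProbabilityMeasure (μ i)]

lemma measurable_update_prod [DecidableEq ι] (a : ι) :
    Measurable fun p : (∀ i, X i) × X a => Function.update p.1 a p.2 := by
  refine measurable_pi_lambda _ fun i => ?_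
  by_cases h : i = a
  · subst h
    simpa using measurable_snd
  · simp only [Function.update_of_ne h]
    exact (measurable_pi_apply i).comp measurable_fst

/-- Resampling one coordinate preserves a product measure. -/
lemma infinitePi_map_update [DecidableEq ι] (a : ι) :
    ((Measure.infinitePi μ).prod (μ a)).map (fun p => Function.update p.1 a p.2) =
      Measure.infinitePi μ := by
  refine Measure.eq_infinitePi μ fun s t ht => ?_
  rw [Measure.map_apply (measurable_update_prod a) (.pi s.countable_toSet fun i _ => ht i)]
  have hset : (fun p : (∀ i, X i) × X a => Function.update p.1 a p.2) ⁻¹' (Set.pi s t) =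
      (Set.pi (s.erase a) t) ×ˢ (if a ∈ s then t a else Set.univ) := by
    ext ⟨x, y⟩
    simp only [Set.mem_preimage, Set.mem_pi, Finset.mem_coe, Set.mem_prod, Finset.mem_erase]
    constructor
    · intro h
      refine ⟨fun i hi => by simpa [Function.update_of_ne hi.1] using h i hi.2, ?_⟩
      split_ifs with ha
      · simpa using h a ha
      · trivial
    · rintro ⟨h1, h2⟩ i hi
      by_cases h : i = a
      · subst h
        simpa [hi] using h2
      · simpa [Function.update_of_ne h] using h1 i ⟨h, hi⟩
  rw [hset, Measure.prod_prod, Measure.infinitePi_pi _ fun i _ => ht i]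
  split_ifs with ha
  · rw [mul_comm, Finset.mul_prod_erase s (fun i => μ i (t i)) ha]
  · rw [measure_univ, mul_one, Finset.erase_eq_of_notMem ha]

lemma lintegral_infinitePi_update [DecidableEq ι] (a : ι) {F : (∀ i, X i) → ℝ≥0∞}
    (hF : Measurable F) :
    ∫⁻ x, F x ∂Measure.infinitePi μ =
      ∫⁻ x, ∫⁻ y, F (Function.update x a y) ∂μ a ∂Measure.infinitePi μ := by
  have hm := measurable_update_prod (X := X) a
  conv_lhs => rw [← infinitePi_map_update μ a]
  rw [lintegral_map hF hm]
  exact lintegral_prod _ (hF.comp hm).aemeasurable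

/-- Averaging over one coordinate of which only a discrete function matters. -/
lemma lintegral_infinitePi_of_discrete [DecidableEq ι] {β : Type*} [Fintype β]
    [MeasurableSpace β] [MeasurableSingletonClass β] (a : ι) {F : (∀ i, X i) → ℝ≥0∞}
    (hF : Measurable F) {h : X a → β} (hh : Measurable h) {H : β → (∀ i, X i) → ℝ≥0∞}
    (hH : ∀ b, Measurable (H b)) (hFH : ∀ x y, F (Function.update x a y) = H (h y) x) :
    ∫⁻ x, F x ∂Measure.infinitePi μ =
      ∑ b, μ a {y | h y = b} * ∫⁻ x, H b x ∂Measure.infinitePi μ := by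
  have hms : ∀ b, MeasurableSet {y | h y = b} := fun b => hh (measurableSet_singleton b)
  rw [lintegral_infinitePi_update μ a hF]
  have h1 : ∀ x, ∫⁻ y, F (Function.update x a y) ∂μ a = ∑ b, μ a {y | h y = b} * H b x := by
    intro x
    simp_rw [hFH]
    rw [← lintegral_map (f := fun b => H b x) (measurable_of_finite _) hh, lintegral_fintype]
    refine Finset.sum_congr rfl fun b _ => ?_
    rw [Measure.map_apply hh (measurableSet_singleton b), mul_comm]
    rfl
  simp_rw [h1]
  rw [lintegral_finsetSum _ fun b _ => (hH b).const_mul _]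
  exact Finset.sum_congr rfl fun b _ => lintegral_const_mul _ (hH b)

end InfinitePi

/-- A product measure over a disjoint union is a product of two product measures. -/
lemma infinitePi_prod_infinitePi {ι κ X : Type*} [MeasurableSpace X] (μ : Measure X)
    [IsProbabilityMeasure μ] :
    (Measure.infinitePi fun _ : ι ⊕ κ => μ).map (fun x => (fun i => x (.inl i), fun k => x (.inr k)))
      = (Measure.infinitePi fun _ : ι => μ).prod (Measure.infinitePi fun _ : κ => μ) := by
  classical
  have h : ((Measure.infinitePi fun _ : ι => μ).prod (Measure.infinitePi fun _ : κ => μ)).map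
      (fun p => Sum.elim p.1 p.2) = Measure.infinitePi fun _ : ι ⊕ κ => μ := by
    have hm : Measurable fun p : (ι → X) × (κ → X) => (Sum.elim p.1 p.2 : ι ⊕ κ → X) := by
      refine measurable_pi_lambda _ fun i => ?_
      rcases i with i | k
      · exact (measurable_pi_apply i).comp measurable_fst
      · exact (measurable_pi_apply k).comp measurable_snd
    refine Measure.eq_infinitePi _ fun s t ht => ?_
    rw [Measure.map_apply hm (.pi s.countable_toSet fun i _ => ht i)]
    have hset : (fun p : (ι → X) × (κ → X) => (Sum.elim p.1 p.2 : ι ⊕ κ → X)) ⁻¹' Set.pi s t =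
        (Set.pi s.toLeft fun i => t (.inl i)) ×ˢ (Set.pi s.toRight fun i => t (.inr i)) := by
      ext ⟨x, y⟩
      simp [Set.mem_pi]
    rw [hset, Measure.prod_prod, Measure.infinitePi_pi _ fun i _ => ht _,
      Measure.infinitePi_pi _ fun i _ => ht _]
    conv_rhs => rw [← Finset.toLeft_disjSum_toRight (u := s), Finset.prod_disjSum]
  have hm' : Measurable fun x : ι ⊕ κ → X => ((fun i => x (.inl i), fun k => x (.inr k)) :
      (ι → X) × (κ → X)) := by fun_prop
  have hm : Measurable fun p : (ι → X) × (κ → X) => (Sum.elim p.1 p.2 : ι ⊕ κ → X) := by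
    refine measurable_pi_lambda _ fun i => ?_
    rcases i with i | k
    · exact (measurable_pi_apply i).comp measurable_fst
    · exact (measurable_pi_apply k).comp measurable_snd
  rw [← h, Measure.map_map hm' hm]
  exact Measure.map_id

/-- Disjoint families of cells of an i.i.d. array, the second one arranged in blocks. -/
lemma infinitePi_map_blocks {ι α κ β X Y : Type*} [MeasurableSpace X] [MeasurableSpace Y]
    (μ : Measure X) [IsProbabilityMeasure μ] {h : X → Y} (hh : Measurable h)
    [IsProbabilityMeasure (μ.map h)] {f : α ⊕ (κ × β) → ι} (hf : Function.Injective f) :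
    (Measure.infinitePi fun _ : ι => μ).map
        (fun ω => (fun a => h (ω (f (.inl a))), fun k b => h (ω (f (.inr (k, b)))))) =
      (Measure.infinitePi fun _ : α => μ.map h).prod
        (Measure.infinitePi fun _ : κ => Measure.infinitePi fun _ : β => μ.map h) := by
  rw [← Measure.infinitePi_map_curry (fun _ : κ => fun _ : β => μ.map h)]
  have h3 : Measurable fun p : (α → Y) × (κ × β → Y) =>
      (p.1, (MeasurableEquiv.curry κ β Y) p.2) := by fun_prop
  have h1 := Measure.map_infinitePi_infinitePi_of_inj (P := fun _ : ι => μ) hf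
  have h2 := Measure.infinitePi_map_pi (fun _ : α ⊕ (κ × β) => μ) (f := fun _ => h) fun _ => hh
  have h4 := infinitePi_prod_infinitePi (ι := α) (κ := κ × β) (μ.map h)
  have h5 : (Measure.infinitePi fun _ : α => μ.map h).prod
      ((Measure.infinitePi fun _ : κ × β => μ.map h).map (MeasurableEquiv.curry κ β Y)) =
      ((Measure.infinitePi fun _ : α => μ.map h).prod
        (Measure.infinitePi fun _ : κ × β => μ.map h)).map
        (fun p => (p.1, (MeasurableEquiv.curry κ β Y) p.2)) := by
    have := Measure.map_prod_map (Measure.infinitePi fun _ : α => μ.map h)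
      (Measure.infinitePi fun _ : κ × β => μ.map h) measurable_id
      (MeasurableEquiv.curry κ β Y).measurable
    rw [Measure.map_id] at this
    exact this
  rw [h5, ← h4, ← h2, ← h1, Measure.map_map (by fun_prop) (by fun_prop),
    Measure.map_map (by fun_prop) (by fun_prop), Measure.map_map (by fun_prop) (by fun_prop)]
  rfl

end MeasureTheory

namespace ProbabilityTheory

lemma expMeasure_one_Ioi {t : ℝ} (ht : 0 ≤ t) :
    expMeasure 1 (Set.Ioi t) = ENNReal.ofReal (Real.exp (-t)) := by
  have h : IsProbabilityMeasure (expMeasure 1) := isProbabilityMeasure_expMeasure one_pos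
  have h1 : expMeasure 1 (Set.Iic t) = ENNReal.ofReal (1 - Real.exp (-t)) := by
    rw [← ofReal_cdf, cdf_expMeasure_eq one_pos, if_pos ht, one_mul]
  rw [← Set.compl_Iic, prob_compl_eq_one_sub measurableSet_Iic, h1, ← ENNReal.ofReal_one,
    ← ENNReal.ofReal_sub _ (by simp [ht])]
  congr 1
  ring

lemma expMeasure_eq_withDensity (r : ℝ) :
    expMeasure r = volume.withDensity (exponentialPDF r) := rfl

lemma expMeasure_one_singleton (x : ℝ) : expMeasure 1 {x} = 0 := by
  rw [expMeasure_eq_withDensity, withDensity_apply _ (measurableSet_singleton x)]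
  simp

lemma expMeasure_one_pos : ∀ᵐ x ∂expMeasure 1, 0 < x := by
  have h : IsProbabilityMeasure (expMeasure 1) := isProbabilityMeasure_expMeasure one_pos
  rw [ae_iff]
  have : {x : ℝ | ¬ 0 < x} = Set.Iic 0 := by ext x; simp
  rw [this, ← ofReal_cdf, cdf_expMeasure_eq one_pos]
  simp

/-- The negative logarithm of a uniform variable is exponential. -/
lemma map_neg_log_unitInterval :
    Measure.map (fun u : unitInterval => -Real.log (u : ℝ)) volume = expMeasure 1 := by
  have h : IsProbabilityMeasure (expMeasure 1) := isProbabilityMeasure_expMeasure one_pos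
  have hm : Measurable fun u : unitInterval => -Real.log (u : ℝ) :=
    (Real.measurable_log.comp measurable_subtype_coe).neg
  have h' : IsProbabilityMeasure
      (Measure.map (fun u : unitInterval => -Real.log (u : ℝ)) volume) := Measure.isProbabilityMeasure_map hm.aemeasurable
  refine Measure.ext_of_Iic _ _ fun t => ?_
  rw [Measure.map_apply hm measurableSet_Iic, ← ofReal_cdf (expMeasure 1),
    cdf_expMeasure_eq one_pos]
  have hcl : ∀ s : Set unitInterval, (volume : Measure unitInterval) s =
      volume ((↑) '' s : Set ℝ) := fun s => by
    rw [unitInterval.volume_apply]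
  rw [hcl]
  split_ifs with ht
  · have hexp : Real.exp (-t) ≤ 1 := by simpa using ht
    have hset : ((↑) '' ((fun u : unitInterval => -Real.log (u : ℝ)) ⁻¹' Set.Iic t) : Set ℝ) \ {0} =
        Set.Icc (Real.exp (-t)) 1 := by
      ext x
      simp only [Set.mem_sdiff, Set.mem_image, Set.mem_preimage, Set.mem_Iic, Set.mem_singleton_iff,
        Set.mem_Icc]
      constructor
      · rintro ⟨⟨u, hu, rfl⟩, h0⟩
        have hpos : (0 : ℝ) < u := lt_of_le_of_ne u.2.1 (Ne.symm h0)
        exact ⟨(Real.le_log_iff_exp_le hpos).1 (by linarith), u.2.2⟩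
      · rintro ⟨h1, h2⟩
        have hpos : 0 < x := (Real.exp_pos _).trans_le h1
        exact ⟨⟨⟨x, hpos.le, h2⟩, by have := (Real.le_log_iff_exp_le hpos).2 h1; simp; linarith, rfl⟩,
          hpos.ne'⟩
    rw [← measure_sdiff_null (t := {(0 : ℝ)}) (by simp), hset, Real.volume_Icc, one_mul]
  · push Not at ht
    rw [ENNReal.ofReal_zero]
    refine measure_mono_null (t := {(0 : ℝ)}) ?_ (by simp)
    rintro _ ⟨u, hu, rfl⟩
    by_contra h0
    have hpos : (0 : ℝ) < u := lt_of_le_of_ne u.2.1 (Ne.symm h0)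
    have := Real.log_nonpos u.2.1 u.2.2
    simp only [Set.mem_preimage, Set.mem_Iic] at hu
    linarith

/-- The exponential distribution has constant hazard rate `1`. -/
lemma lintegral_expMeasure_eq {h : ℝ → ℝ≥0∞} (hh : Measurable h) :
    ∫⁻ x, h x ∂expMeasure 1 = ∫⁻ y, (∫⁻ x in Set.Ioo 0 y, h x) ∂expMeasure 1 := by
  have hp : IsProbabilityMeasure (expMeasure 1) := isProbabilityMeasure_expMeasure one_pos
  have h1 : ∀ y, ∫⁻ x in Set.Ioo 0 y, h x =
      ∫⁻ x, Set.indicator {p : ℝ × ℝ | 0 < p.2 ∧ p.2 < p.1} (fun p => h p.2) (y, x) := fun y => by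
    rw [← lintegral_indicator measurableSet_Ioo]
    rfl
  have hms : MeasurableSet {p : ℝ × ℝ | 0 < p.2 ∧ p.2 < p.1} :=
    (measurableSet_lt measurable_const measurable_snd).inter
      (measurableSet_lt measurable_snd measurable_fst)
  simp_rw [h1]
  rw [lintegral_lintegral_swap
    (f := fun y x => Set.indicator {p : ℝ × ℝ | 0 < p.2 ∧ p.2 < p.1} (fun p => h p.2) (y, x))
    ((hh.comp measurable_snd).indicator hms).aemeasurable]
  have h2 : ∀ x, ∫⁻ y, Set.indicator {p : ℝ × ℝ | 0 < p.2 ∧ p.2 < p.1} (fun p => h p.2) (y, x)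
      ∂expMeasure 1 = Set.indicator (Set.Ioi 0) (fun x => exponentialPDF 1 x * h x) x := by
    intro x
    by_cases hx : 0 < x
    · rw [Set.indicator_of_mem (by exact hx)]
      have : ∀ y, Set.indicator {p : ℝ × ℝ | 0 < p.2 ∧ p.2 < p.1} (fun p => h p.2) (y, x) =
          Set.indicator (Set.Ioi x) (fun _ => h x) y := by
        intro y
        simp [Set.indicator, hx]
      simp_rw [this]
      rw [lintegral_indicator_const measurableSet_Ioi, expMeasure_one_Ioi hx.le,
        exponentialPDF_of_nonneg hx.le, mul_comm]
      simp
    · rw [Set.indicator_of_notMem (by exact hx)]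
      simp [Set.indicator, hx]
  simp_rw [h2]
  rw [lintegral_indicator measurableSet_Ioi, expMeasure_eq_withDensity,
    lintegral_withDensity_eq_lintegral_mul _ (by unfold exponentialPDF; fun_prop) hh]
  rw [← lintegral_indicator measurableSet_Ioi]
  refine lintegral_congr_ae ?_
  have : ∀ᵐ x : ℝ, x ≠ 0 := by simp [ae_iff]
  filter_upwards [this] with x hx
  by_cases h0 : 0 < x
  · rw [Set.indicator_of_mem (by exact h0)]; rfl
  · rw [Set.indicator_of_notMem (by exact h0), Pi.mul_apply,
      exponentialPDF_of_neg (lt_of_le_of_ne (not_lt.1 h0) hx), zero_mul]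

/-- The Laplace transform of the exponential distribution. -/
lemma lintegral_exp_neg_expMeasure {s : ℝ} (hs : 0 ≤ s) :
    ∫⁻ t, ENNReal.ofReal (Real.exp (-(s * t))) ∂expMeasure 1 = ENNReal.ofReal (1 / (1 + s)) := by
  have hs1 : 0 < 1 + s := by linarith
  rw [expMeasure_eq_withDensity,
    lintegral_withDensity_eq_lintegral_mul _ (by unfold exponentialPDF; fun_prop) (by fun_prop)]
  have : ∀ t, (exponentialPDF 1 * fun t => ENNReal.ofReal (Real.exp (-(s * t)))) t =
      ENNReal.ofReal (1 / (1 + s)) * exponentialPDF (1 + s) t := by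
    intro t
    rcases lt_or_ge t 0 with ht | ht
    · simp [exponentialPDF_of_neg ht]
    · rw [Pi.mul_apply, exponentialPDF_of_nonneg ht, exponentialPDF_of_nonneg ht,
        ← ENNReal.ofReal_mul (by positivity), ← ENNReal.ofReal_mul (by positivity)]
      congr 1
      rw [one_mul, ← Real.exp_add, ← mul_assoc, one_div, inv_mul_cancel₀ hs1.ne', one_mul]
      ring_nf
  simp_rw [this]
  rw [lintegral_const_mul _ (by unfold exponentialPDF; fun_prop),
    lintegral_exponentialPDF_eq_one hs1, mul_one]

end ProbabilityTheory

end


/-! ### Exponential races -/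

noncomputable section

namespace SingleSite

variable {n q : ℕ}

/-- Spin `x` strictly wins the exponential race with rates `a` and exponential variables `e`:
`e x / a x` is smaller than every other `e y / a y`. -/
def Wins (a e : Fin q → ℝ) (x : Fin q) : Prop := ∀ y, y ≠ x → e x * a y < e y * a x

/-- The winner of a race, or `z₀` if there is a tie. -/
def winner (z₀ : Fin q) (a e : Fin q → ℝ) : Fin q :=
  open Classical in if h : ∃ x, Wins a e x then h.choose else z₀

/-- The joint distribution of `q` independent exponential variables. -/
def expVector (q : ℕ) : Measure (Fin q → ℝ) := Measure.infinitePi fun _ => expMeasure 1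

instance : IsProbabilityMeasure (expVector q) := by unfold expVector; infer_instance

lemma Wins.unique {a e : Fin q → ℝ} {x y : Fin q} (hx : Wins a e x) (hy : Wins a e y) : x = y := by
  by_contra h
  exact lt_asymm (hx y (Ne.symm h)) (hy x h)

lemma Wins.winner_eq {z₀ : Fin q} {a e : Fin q → ℝ} {x : Fin q} (h : Wins a e x) :
    winner z₀ a e = x := by
  have hex : ∃ x, Wins a e x := ⟨x, h⟩
  rw [winner, dif_pos hex]
  exact hex.choose_spec.unique h

lemma measurableSet_wins (a : Fin q → ℝ) (x : Fin q) : MeasurableSet {e | Wins a e x} := by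
  have : {e : Fin q → ℝ | Wins a e x} = ⋂ y, {e | y ≠ x → e x * a y < e y * a x} := by
    ext e; simp [Wins]
  rw [this]
  refine MeasurableSet.iInter fun y => ?_
  by_cases h : y = x
  · simp [h]
  · simp only [ne_eq, h, not_false_eq_true, forall_true_left]
    exact measurableSet_lt (by fun_prop) (by fun_prop)

lemma measurable_winner (z₀ : Fin q) (a : Fin q → ℝ) : Measurable (winner z₀ a) := by
  refine measurable_to_countable' fun x => ?_
  have hex : MeasurableSet {e : Fin q → ℝ | ∃ x, Wins a e x} := by
    have : {e : Fin q → ℝ | ∃ x, Wins a e x} = ⋃ x, {e | Wins a e x} := by ext; simp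
    rw [this]
    exact MeasurableSet.iUnion fun x => measurableSet_wins a x
  have : winner z₀ a ⁻¹' {x} = {e | Wins a e x} ∪ ({e | ∃ x, Wins a e x}ᶜ ∩ {_e | x = z₀}) := by
    ext e
    simp only [Set.mem_preimage, Set.mem_singleton_iff, Set.mem_union, Set.mem_ofPred_eq,
      Set.mem_inter_iff, Set.mem_compl_iff]
    by_cases h : ∃ x, Wins a e x
    · obtain ⟨y, hy⟩ := h
      rw [hy.winner_eq]
      constructor
      · rintro rfl; exact Or.inl hy
      · rintro (h | h)
        · exact hy.unique h
        · exact absurd ⟨y, hy⟩ h.1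
    · have h' : ¬ Wins a e x := fun hx => h ⟨x, hx⟩
      rw [winner, dif_neg h]
      simp [h, h', eq_comm]
  rw [this]
  exact (measurableSet_wins a x).union (hex.compl.inter (MeasurableSet.const _))

/-- The probability to win an exponential race is proportional to the rate. -/
lemma expVector_wins {a : Fin q → ℝ} (ha : ∀ y, 0 ≤ a y) {x : Fin q} (hx : 0 < a x) :
    expVector q {e | Wins a e x} = ENNReal.ofReal (a x / ∑ y, a y) := by
  set s : ℝ := ∑ y ∈ Finset.univ.erase x, a y / a x with hs
  have hs0 : 0 ≤ s := Finset.sum_nonneg fun y _ => div_nonneg (ha y) hx.le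
  have hA := measurableSet_wins a x
  rw [← lintegral_indicator_one hA]
  unfold expVector
  rw [lintegral_infinitePi_update _ x (measurable_one.indicator hA)]
  rw [lintegral_lintegral_swap (f := fun e t => Set.indicator {e | Wins a e x}
    (1 : (Fin q → ℝ) → ℝ≥0∞) (Function.update e x t)) ((measurable_one.indicator hA).comp
    (measurable_update_prod (X := fun _ : Fin q => ℝ) x)).aemeasurable]
  have key : ∀ᵐ t ∂expMeasure 1, ∫⁻ e, Set.indicator {e | Wins a e x} 1 (Function.update e x t)
      ∂(Measure.infinitePi fun _ : Fin q => expMeasure 1) =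
      ENNReal.ofReal (Real.exp (-(s * t))) := by
    filter_upwards [expMeasure_one_pos] with t ht
    have h1 : ∀ e : Fin q → ℝ, Set.indicator {e | Wins a e x} (1 : (Fin q → ℝ) → ℝ≥0∞)
        (Function.update e x t) = Set.indicator (Set.pi (Finset.univ.erase x : Finset (Fin q))
          fun y => Set.Ioi (t * (a y / a x))) 1 e := by
      intro e
      have : Function.update e x t ∈ {e | Wins a e x} ↔
          e ∈ Set.pi (Finset.univ.erase x : Finset (Fin q)) fun y => Set.Ioi (t * (a y / a x)) := by
        simp only [Wins, Set.mem_ofPred_eq, Function.update_self, Set.mem_pi, Finset.mem_coe,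
          Finset.mem_erase, Finset.mem_univ, and_true, Set.mem_Ioi]
        refine forall_congr' fun y => forall_congr' fun hy => ?_
        rw [Function.update_of_ne hy, ← mul_div_assoc, div_lt_iff₀ hx]
      by_cases h : Function.update e x t ∈ {e | Wins a e x}
      · rw [Set.indicator_of_mem h, Set.indicator_of_mem (this.1 h)]; rfl
      · rw [Set.indicator_of_notMem h, Set.indicator_of_notMem (fun h' => h (this.2 h'))]
    simp_rw [h1]
    rw [lintegral_indicator_one (.pi (Finset.countable_toSet _) fun _ _ => measurableSet_Ioi),
      Measure.infinitePi_pi _ fun _ _ => measurableSet_Ioi]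
    have h2 : ∀ y, expMeasure 1 (Set.Ioi (t * (a y / a x))) =
        ENNReal.ofReal (Real.exp (-(t * (a y / a x)))) := fun y =>
      expMeasure_one_Ioi (mul_nonneg ht.le (div_nonneg (ha y) hx.le))
    simp_rw [h2]
    rw [← ENNReal.ofReal_prod_of_nonneg fun _ _ => (Real.exp_pos _).le, ← Real.exp_sum,
      Finset.sum_neg_distrib, ← Finset.mul_sum, mul_comm t]
  rw [lintegral_congr_ae key, lintegral_exp_neg_expMeasure hs0]
  congr 1
  have h3 : ∑ y, a y = a x * (1 + s) := by
    rw [← Finset.add_sum_erase _ _ (Finset.mem_univ x), hs, mul_add, mul_one, Finset.mul_sum]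
    congr 1
    refine Finset.sum_congr rfl fun y _ => ?_
    field_simp
  have h4 : 0 < 1 + s := by linarith
  rw [h3]
  field_simp

/-- The rates of the race that makes a draw from `p`. -/
def rates (p : PMF (Fin q)) (x : Fin q) : ℝ := (p x).toReal

lemma rates_nonneg (p : PMF (Fin q)) (x : Fin q) : 0 ≤ rates p x := ENNReal.toReal_nonneg

lemma sum_rates (p : PMF (Fin q)) : ∑ x, rates p x = 1 := by
  unfold rates
  rw [← ENNReal.toReal_sum fun x _ => p.apply_ne_top x, ← tsum_fintype (L := .unconditional _),
    p.tsum_coe, ENNReal.toReal_one]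

lemma ofReal_rates (p : PMF (Fin q)) (x : Fin q) : ENNReal.ofReal (rates p x) = p x :=
  ENNReal.ofReal_toReal (p.apply_ne_top x)

lemma le_expVector_wins (p : PMF (Fin q)) (x : Fin q) :
    p x ≤ expVector q {e | Wins (rates p) e x} := by
  rcases (rates_nonneg p x).eq_or_lt with h | h
  · rw [← ofReal_rates, ← h]; simp
  · rw [expVector_wins (rates_nonneg p) h, sum_rates, div_one, ofReal_rates]

lemma ae_exists_wins (p : PMF (Fin q)) : ∀ᵐ e ∂expVector q, ∃ x, Wins (rates p) e x := by
  have hset : {e : Fin q → ℝ | ∃ x, Wins (rates p) e x} = ⋃ x, {e | Wins (rates p) e x} := by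
    ext; simp
  have hms : MeasurableSet {e : Fin q → ℝ | ∃ x, Wins (rates p) e x} := by
    rw [hset]; exact MeasurableSet.iUnion fun x => measurableSet_wins _ x
  have h1 : 1 ≤ expVector q {e | ∃ x, Wins (rates p) e x} := by
    have hdisj : Pairwise (Function.onFun Disjoint fun x => {e | Wins (rates p) e x}) :=
      fun x y hxy => Set.disjoint_left.2 fun e (hx : Wins _ e x) (hy : Wins _ e y) =>
        hxy (hx.unique hy)
    rw [hset, measure_iUnion hdisj fun x => measurableSet_wins _ x, ← p.tsum_coe]
    exact ENNReal.tsum_le_tsum fun x => le_expVector_wins p x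
  exact (prob_compl_eq_zero_iff hms).2 (le_antisymm prob_le_one h1)

/-- The winner of an exponential race with rates `p` has distribution `p`. -/
lemma expVector_winner (z₀ : Fin q) (p : PMF (Fin q)) (x : Fin q) :
    expVector q {e | winner z₀ (rates p) e = x} = p x := by
  have hms : ∀ y, MeasurableSet {e | winner z₀ (rates p) e = y} := fun y =>
    measurable_winner z₀ (rates p) (measurableSet_singleton y)
  have hle : ∀ y, p y ≤ expVector q {e | winner z₀ (rates p) e = y} := fun y =>
    (le_expVector_wins p y).trans (measure_mono fun e he => Wins.winner_eq he)
  refine le_antisymm ?_ (hle x)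
  have hsum : ∑ y, expVector q {e | winner z₀ (rates p) e = y} = 1 := by
    rw [← measure_univ (μ := expVector q), ← measure_biUnion_finset
      (fun y _ y' _ hyy => Set.disjoint_left.2 fun e h h' => hyy (h.symm.trans h'))
      fun y _ => hms y]
    congr 1
    ext e
    simp
  have hsum' : ∑ y, p y = 1 := by rw [← tsum_fintype (L := .unconditional _), p.tsum_coe]
  rw [← Finset.add_sum_erase _ _ (Finset.mem_univ x)] at hsum hsum'
  have h2 : ∑ y ∈ Finset.univ.erase x, p y ≠ ∞ := by
    refine ne_top_of_le_ne_top ENNReal.one_ne_top (hsum' ▸ le_add_self)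
  refine (ENNReal.add_le_add_iff_right h2).1 ?_
  rw [hsum', ← hsum]
  gcongr with y _
  exact hle y

/-- Races with the same exponential variables couple two distributions almost optimally: the winners
differ with probability at most twice the total variation distance. If `x` wins even with the smaller of
its two rates against the larger rates of all others, it wins both races, and these events together have
probability at least `(1 - d) / (1 + d)`, where `d` is the distance. -/
lemma expVector_winner_ne (z₀ : Fin q) (p p' : PMF (Fin q)) :
    expVector q {e | winner z₀ (rates p) e ≠ winner z₀ (rates p') e} ≤
      ENNReal.ofReal (2 * tvDist p p') := by
  set lo : Fin q → ℝ := fun x => min (rates p x) (rates p' x) with hlo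
  set hi : Fin q → ℝ := fun x => max (rates p x) (rates p' x) with hhi
  have hlo0 : ∀ x, 0 ≤ lo x := fun x => le_min (rates_nonneg p x) (rates_nonneg p' x)
  have hhi0 : ∀ x, 0 ≤ hi x := fun x => (rates_nonneg p x).trans (le_max_left _ _)
  set d := tvDist p p' with hd
  have hd0 : 0 ≤ d := mul_nonneg (by norm_num) (Finset.sum_nonneg fun _ _ => abs_nonneg _)
  have hadd : ∑ x, lo x + ∑ x, hi x = 2 := by
    rw [← Finset.sum_add_distrib]
    simp_rw [hlo, hhi, min_add_max]
    rw [Finset.sum_add_distrib, sum_rates, sum_rates]; norm_num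
  have hsub : ∑ x, hi x - ∑ x, lo x = 2 * d := by
    rw [← Finset.sum_sub_distrib]
    simp_rw [hlo, hhi, max_sub_min_eq_abs]
    rw [hd, tvDist, ← mul_assoc]
    norm_num
    exact Finset.sum_congr rfl fun x _ => abs_sub_comm _ _
  have hhis : ∑ x, hi x = 1 + d := by linarith
  have hlos : ∑ x, lo x = 1 - d := by linarith
  have hpos : ∀ᵐ e ∂expVector q, ∀ x, 0 < e x := by
    rw [ae_all_iff]
    intro x
    have := (measurePreserving_eval_infinitePi (fun _ : Fin q => expMeasure 1) x)
    exact this.quasiMeasurePreserving.ae expMeasure_one_pos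
  -- The event that `x` wins the race in which it has its smaller rate and all others have their
  -- larger rates.
  set A : Fin q → Set (Fin q → ℝ) := fun x => {e | 0 < lo x ∧ Wins (Function.update hi x (lo x)) e x}
    with hA
  have hAms : ∀ x, MeasurableSet (A x) := fun x =>
    (MeasurableSet.const _).inter (measurableSet_wins _ x)
  have hAle : ∀ x, ENNReal.ofReal (lo x / (1 + d)) ≤ expVector q (A x) := by
    intro x
    rcases (hlo0 x).eq_or_lt with h | h
    · rw [← h]; simp
    have hAx : A x = {e | Wins (Function.update hi x (lo x)) e x} := by
      ext e; simp [hA, h]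
    have h0 : ∀ y, 0 ≤ Function.update hi x (lo x) y := by
      intro y
      by_cases hy : y = x
      · subst hy; simpa using h.le
      · simpa [hy] using hhi0 y
    rw [hAx, expVector_wins h0 (by simpa using h), Function.update_self]
    refine ENNReal.ofReal_le_ofReal (div_le_div_of_nonneg_left h.le ?_ ?_)
    · exact lt_of_lt_of_le (by simpa using h)
        (Finset.single_le_sum (fun y _ => h0 y) (Finset.mem_univ x))
    · rw [← hhis]
      refine Finset.sum_le_sum fun y _ => ?_
      by_cases hy : y = x
      · subst hy; simp [hlo, hhi]
      · simp [hy]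
  have hAwin : ∀ᵐ e ∂expVector q, ∀ x, e ∈ A x →
      Wins (rates p) e x ∧ Wins (rates p') e x := by
    filter_upwards [hpos] with e he x hx
    have hmain : ∀ y, y ≠ x → e x * hi y < e y * lo x := fun y hy => by
      simpa [hy] using hx.2 y hy
    constructor
    · intro y hy
      calc e x * rates p y ≤ e x * hi y := by gcongr; exacts [(he x).le, le_max_left _ _]
        _ < e y * lo x := hmain y hy
        _ ≤ e y * rates p x := by gcongr; exacts [(he y).le, min_le_left _ _]
    · intro y hy
      calc e x * rates p' y ≤ e x * hi y := by gcongr; exacts [(he x).le, le_max_right _ _]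
        _ < e y * lo x := hmain y hy
        _ ≤ e y * rates p' x := by gcongr; exacts [(he y).le, min_le_right _ _]
  have hlarge : ENNReal.ofReal ((1 - d) / (1 + d)) ≤ expVector q (⋃ x, A x) := by
    have hdisj : Pairwise (Function.onFun (AEDisjoint (expVector q)) A) := by
      intro x y hxy
      refine measure_mono_null ?_ (ae_iff.1 hAwin)
      rintro e ⟨hx, hy⟩ h
      exact hxy ((h x hx).1.unique (h y hy).1)
    rw [measure_iUnion₀ hdisj fun x => (hAms x).nullMeasurableSet, tsum_fintype, ← hlos,
      Finset.sum_div, ENNReal.ofReal_sum_of_nonneg fun x _ => div_nonneg (hlo0 x) (by linarith)]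
    exact Finset.sum_le_sum fun x _ => hAle x
  calc expVector q {e | winner z₀ (rates p) e ≠ winner z₀ (rates p') e}
      ≤ expVector q (⋃ x, A x)ᶜ := by
        refine measure_mono_ae ?_
        filter_upwards [hAwin] with e he hne
        rintro hmem
        obtain ⟨x, hx⟩ := Set.mem_iUnion.1 hmem
        exact hne ((he x hx).1.winner_eq.trans (he x hx).2.winner_eq.symm)
    _ = 1 - expVector q (⋃ x, A x) := prob_compl_eq_one_sub (MeasurableSet.iUnion hAms)
    _ ≤ 1 - ENNReal.ofReal ((1 - d) / (1 + d)) := tsub_le_tsub_left hlarge 1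
    _ ≤ ENNReal.ofReal (2 * d) := by
        rw [← ENNReal.ofReal_one]
        have h1 : (1 - d) / (1 + d) ≥ 1 - 2 * d := by
          rw [ge_iff_le, le_div_iff₀ (by linarith)]
          nlinarith
        rcases le_or_gt 0 ((1 - d) / (1 + d)) with h | h
        · rw [← ENNReal.ofReal_sub _ h]
          exact ENNReal.ofReal_le_ofReal (by linarith)
        · rw [ENNReal.ofReal_of_nonpos h.le, tsub_zero]
          exact ENNReal.ofReal_le_ofReal (by linarith)

/-! ### The influence matrix -/

variable {G : SimpleGraph (Fin n)} (P : LocalRule G q)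

lemma tvDist_nonneg (μ ν : PMF (Fin q)) : 0 ≤ tvDist μ ν :=
  mul_nonneg (by norm_num) (Finset.sum_nonneg fun _ _ => abs_nonneg _)

lemma tvDist_self (μ : PMF (Fin q)) : tvDist μ μ = 0 := by simp [tvDist]

lemma tvDist_triangle (μ κ ν : PMF (Fin q)) : tvDist μ ν ≤ tvDist μ κ + tvDist κ ν := by
  unfold tvDist
  rw [← mul_add, ← Finset.sum_add_distrib]
  gcongr with x _
  exact abs_sub_le _ _ _

lemma influence_nonneg (u v : Fin n) : 0 ≤ influence P u v :=
  Real.iSup_nonneg fun _ => tvDist_nonneg _ _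

lemma tvDist_le_influence {u v : Fin n} {τ τ' : Nbhd G v → Fin q}
    (h : ∀ w : Nbhd G v, (w : Fin n) ≠ u → τ w = τ' w) :
    tvDist (P v τ) (P v τ') ≤ influence P u v :=
  le_ciSup (f := fun a : {a : (Nbhd G v → Fin q) × (Nbhd G v → Fin q) //
    ∀ w : Nbhd G v, (w : Fin n) ≠ u → a.1 w = a.2 w} => tvDist (P v a.1.1) (P v a.1.2))
    (Set.finite_range _).bddAbove ⟨(τ, τ'), h⟩

/-- The total effect of changing several spins is at most the sum of their influences. -/
lemma tvDist_le_sum_influence (v : Fin n) (s : Finset (Fin n)) :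
    ∀ σ σ' : Fin n → Fin q, (∀ u, u ∉ s → σ u = σ' u) →
      tvDist (P v fun w => σ w.1) (P v fun w => σ' w.1) ≤ ∑ u ∈ s, influence P u v := by
  classical
  induction s using Finset.induction_on with
  | empty =>
    intro σ σ' h
    have : σ = σ' := funext fun u => h u (Finset.notMem_empty u)
    rw [this, tvDist_self, Finset.sum_empty]
  | insert u s hu ih =>
    intro σ σ' h
    rw [Finset.sum_insert hu]
    refine (tvDist_triangle _ (P v fun w => Function.update σ u (σ' u) w.1) _).trans
      (add_le_add (tvDist_le_influence P fun w hw => ?_) (ih _ _ fun w hw => ?_))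
    · rw [Function.update_of_ne hw]
    · by_cases hwu : w = u
      · subst hwu; simp
      · rw [Function.update_of_ne hwu]
        exact h w (by simp [hwu, hw])

end SingleSite

end


/-! ### Measurability, and the law of the final configuration -/

noncomputable section

lemma Measurable.apply_countable {α β γ : Type*} [MeasurableSpace α] [MeasurableSpace β]
    [MeasurableSpace γ] [Countable β] [MeasurableSingletonClass β] {F : β → α → γ}
    (hF : ∀ b, Measurable (F b)) {h : α → β} (hh : Measurable h) :
    Measurable fun a => F (h a) a :=
  (measurable_from_prod_countable_left (f := fun p : α × β => F p.2 p.1) hF).comp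
    (measurable_id.prodMk hh)

namespace SingleSite

variable {n q : ℕ} {Ω : Type*} [MeasurableSpace Ω]

lemma measurable_sInf_nat {A : ℕ → Set Ω} (hA : ∀ k, MeasurableSet (A k)) :
    Measurable fun ω => sInf {k | ω ∈ A k} := by
  refine measurable_of_Ioi fun j => ?_
  have : (fun ω => sInf {k | ω ∈ A k}) ⁻¹' Set.Ioi j =
      (⋃ k, A k) ∩ ⋂ k : ℕ, {ω | k ≤ j → ω ∉ A k} := by
    ext ω
    simp only [Set.mem_preimage, Set.mem_Ioi, Set.mem_inter_iff, Set.mem_iUnion, Set.mem_iInter,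
      Set.mem_ofPred_eq]
    constructor
    · intro h
      have hne : {k | ω ∈ A k}.Nonempty := by
        by_contra hne
        rw [Set.not_nonempty_iff_eq_empty] at hne
        simp [hne] at h
      exact ⟨hne, fun k hk hin => absurd (Nat.sInf_le (s := {k | ω ∈ A k}) hin) (by omega)⟩
    · rintro ⟨hne, h⟩
      by_contra hle
      exact h _ (not_lt.1 hle) (Nat.sInf_mem (s := {k | ω ∈ A k}) hne)
  rw [this]
  refine (MeasurableSet.iUnion hA).inter (MeasurableSet.iInter fun k => ?_)
  by_cases hk : k ≤ j
  · simp only [hk, forall_true_left]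
    exact (hA k).compl
  · simp [hk]

section Sweep

variable {S : Ω → Fin n → ℕ → ℝ} {f : Ω → Fin n → ℕ → (Fin n → Fin q) → Fin q}

lemma measurable_before (hS : ∀ v k, Measurable fun ω => S ω v k) (u : Fin n) {t : Ω → ℝ}
    (ht : Measurable t) : Measurable fun ω => before (S ω) u (t ω) :=
  measurable_sInf_nat (A := fun k => {ω | t ω ≤ S ω u (k + 1)}) fun _ =>
    measurableSet_le ht (hS _ _)

lemma measurable_upTo (hS : ∀ v k, Measurable fun ω => S ω v k) (u : Fin n) {t : Ω → ℝ}
    (ht : Measurable t) : Measurable fun ω => upTo (S ω) u (t ω) :=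
  measurable_sInf_nat (A := fun k => {ω | t ω < S ω u (k + 1)}) fun _ =>
    measurableSet_lt ht (hS _ _)

lemma measurable_iterate_sweep (hS : ∀ v k, Measurable fun ω => S ω v k)
    (hf : ∀ v i σ, Measurable fun ω => f ω v i σ) {F : Ω → Fin n → ℕ → Fin q}
    (hF : ∀ v k, Measurable fun ω => F ω v k) (r : ℕ) :
    ∀ v k, Measurable fun ω => (sweep (S ω) (f ω))^[r] (F ω) v k := by
  induction r with
  | zero => exact hF
  | succ r ih =>
    intro v k
    rcases k with _ | i
    · simp_rw [iterate_sweep_zero]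
      exact hF v 0
    · simp_rw [iterate_sweep_succ]
      refine Measurable.apply_countable (F := fun σ ω => f ω v i σ) (hf v i) ?_
      exact measurable_pi_lambda _ fun u =>
        Measurable.apply_countable (F := fun k ω => (sweep (S ω) (f ω))^[r] (F ω) u k) (ih u)
          (measurable_before hS u (hS v (i + 1)))

lemma measurable_truth (hS : ∀ v k, Measurable fun ω => S ω v k)
    (hf : ∀ v i σ, Measurable fun ω => f ω v i σ) (X₀ : Fin n → Fin q) (v : Fin n) (k : ℕ) :
    Measurable fun ω => truth (S ω) (f ω) X₀ v k := by
  unfold truth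
  refine Measurable.apply_countable
    (F := fun r ω => (sweep (S ω) (f ω))^[r] (fun v _ => X₀ v) v k)
    (h := fun ω => depthOf (S ω) v k + 1)
    (fun r => measurable_iterate_sweep (F := fun _ v _ => X₀ v) hS hf
      (fun _ _ => measurable_const) r v k) ?_
  unfold depthOf
  exact (Finset.measurable_sum _ fun u _ => measurable_before hS u (hS v k)).add_const 1

lemma measurable_guess (hS : ∀ v k, Measurable fun ω => S ω v k)
    (hf : ∀ v i σ, Measurable fun ω => f ω v i σ) (X₀ : Fin n → Fin q) (z₀ : Fin q) (b : ℝ)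
    (v : Fin n) (k : ℕ) : Measurable fun ω => guess (S ω) (f ω) X₀ z₀ b v k := by
  unfold guess
  exact Measurable.ite (measurableSet_le (hS v k) measurable_const)
    (measurable_truth hS hf X₀ v k) measurable_const

end Sweep

/-! #### The clocks -/

/-- The distribution of the waiting times. -/
def gapMeasure (n : ℕ) : Measure (Gaps n) := Measure.infinitePi fun _ => expMeasure 1

instance : IsProbabilityMeasure (gapMeasure n) := by unfold gapMeasure; infer_instance

@[fun_prop]
lemma measurable_clock (v : Fin n) (k : ℕ) : Measurable fun g : Gaps n => clock g v k := by
  unfold clock; fun_prop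

lemma clock_succ (g : Gaps n) (v : Fin n) (k : ℕ) : clock g v (k + 1) = clock g v k + g (v, k) :=
  Finset.sum_range_succ _ _

lemma clock_update_of_le (g : Gaps n) {v u : Fin n} {i k : ℕ} (x : ℝ) (h : u = v → k ≤ i) :
    clock (Function.update g (v, i) x) u k = clock g u k := by
  unfold clock
  refine Finset.sum_congr rfl fun j hj => Function.update_of_ne ?_ _ _
  rintro hji
  simp only [Prod.mk.injEq] at hji
  have := h hji.1
  simp at hj
  omega

lemma clock_update_self (g : Gaps n) (v : Fin n) (i : ℕ) (x : ℝ) :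
    clock (Function.update g (v, i) x) v (i + 1) = clock g v i + x := by
  rw [clock_succ, clock_update_of_le g x fun _ => le_rfl, Function.update_self]

lemma ae_gaps_pos (n : ℕ) : ∀ᵐ g ∂gapMeasure n, ∀ a, 0 < g a := by
  rw [ae_all_iff]
  exact fun a => (measurePreserving_eval_infinitePi
    (fun _ : Fin n × ℕ => expMeasure 1) a).quasiMeasurePreserving.ae expMeasure_one_pos

lemma clock_strictMono {g : Gaps n} (hg : ∀ a, 0 < g a) (v : Fin n) : StrictMono (clock g v) :=
  strictMono_nat_of_lt_succ fun k => by rw [clock_succ]; linarith [hg (v, k)]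

lemma ae_exists_gap_gt (v : Fin n) (B : ℝ) : ∀ᵐ g ∂gapMeasure n, ∃ j, B < g (v, j) := by
  set p := expMeasure 1 (Set.Iic (max B 0)) with hp
  have hp1 : p < 1 := by
    rw [hp, ← Set.compl_Ioi, prob_compl_eq_one_sub measurableSet_Ioi,
      expMeasure_one_Ioi (le_max_right _ _)]
    exact ENNReal.sub_lt_self ENNReal.one_ne_top one_ne_zero
      (ENNReal.ofReal_pos.2 (Real.exp_pos _)).ne'
  rw [ae_iff]
  refine le_antisymm (ge_of_tendsto' (ENNReal.tendsto_pow_atTop_nhds_zero_of_lt_one hp1) fun k => ?_)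
    zero_le
  have hinj : Set.InjOn (fun j => (v, j)) (Finset.range k : Set ℕ) := fun i _ j _ h => by
    simpa using h
  calc gapMeasure n {g | ¬ ∃ j, B < g (v, j)}
      ≤ gapMeasure n (Set.pi ((Finset.range k).image fun j => (v, j))
          fun _ => Set.Iic (max B 0)) := by
        refine measure_mono fun g hg => ?_
        simp only [not_exists, not_lt, Set.mem_ofPred_eq] at hg
        intro a ha
        simp only [Finset.coe_image, Set.mem_image] at ha
        obtain ⟨j, -, rfl⟩ := ha
        exact (hg j).trans (le_max_left _ _)
    _ = p ^ k := by
        unfold gapMeasure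
        rw [Measure.infinitePi_pi _ fun _ _ => measurableSet_Iic, Finset.prod_const,
          Finset.card_image_of_injOn hinj, Finset.card_range]

lemma ae_clock_ne {u v : Fin n} (h : u ≠ v) (j k : ℕ) :
    ∀ᵐ g ∂gapMeasure n, clock g u (j + 1) ≠ clock g v (k + 1) := by
  have hms : MeasurableSet {g : Gaps n | clock g u (j + 1) = clock g v (k + 1)} :=
    measurableSet_eq_fun (by fun_prop) (by fun_prop)
  rw [ae_iff]
  simp only [ne_eq, not_not]
  rw [← lintegral_indicator_one hms]
  unfold gapMeasure
  rw [lintegral_infinitePi_update _ (u, j) (measurable_one.indicator hms)]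
  refine (lintegral_congr fun g => ?_).trans lintegral_zero
  have : ∀ y, Set.indicator {g : Gaps n | clock g u (j + 1) = clock g v (k + 1)}
      (1 : Gaps n → ℝ≥0∞) (Function.update g (u, j) y) =
      Set.indicator {clock g v (k + 1) - clock g u j} 1 y := by
    intro y
    have h1 : clock (Function.update g (u, j) y) v (k + 1) = clock g v (k + 1) :=
      clock_update_of_le g y fun h' => absurd h'.symm h
    simp only [Set.indicator, Set.mem_ofPred_eq, clock_update_self, h1, Set.mem_singleton_iff,
      eq_sub_iff_add_eq']
    rfl
  simp_rw [this]
  rw [lintegral_indicator_one (measurableSet_singleton _), expMeasure_one_singleton]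

lemma ae_isClock (n : ℕ) : ∀ᵐ g ∂gapMeasure n, IsClock (clock g) := by
  have h1 : ∀ᵐ g ∂gapMeasure n, ∀ (v : Fin n) (B : ℕ), ∃ j, (B : ℝ) < g (v, j) := by
    simp_rw [ae_all_iff]
    exact fun v B => ae_exists_gap_gt v B
  have h2 : ∀ᵐ g ∂gapMeasure n, ∀ (u v : Fin n) (j k : ℕ), u ≠ v →
      clock g u (j + 1) ≠ clock g v (k + 1) := by
    simp_rw [ae_all_iff]
    exact fun u v j k h => ae_clock_ne h j k
  filter_upwards [ae_gaps_pos n, h1, h2] with g hpos hub hne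
  refine ⟨fun v => rfl, clock_strictMono hpos, fun v t => ?_, fun u v j k h => ?_⟩
  · obtain ⟨B, hB⟩ := exists_nat_ge t
    obtain ⟨j, hj⟩ := hub v B
    refine ⟨j + 1, ?_⟩
    have : 0 ≤ clock g v j := Finset.sum_nonneg fun i _ => (hpos _).le
    rw [clock_succ]
    linarith
  · by_contra huv
    exact hne u v j k huv h

/-! #### The draws -/

/-- The distribution of the exponential variables of all races. -/
def raceMeasure (n q : ℕ) : Measure (Fin n × ℕ → Fin q → ℝ) :=
  Measure.infinitePi fun _ => expVector q

instance : IsProbabilityMeasure (raceMeasure n q) := by unfold raceMeasure; infer_instance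

variable {G : SimpleGraph (Fin n)}

/-- The draws that are made by exponential races. All the draws that belong to one ring use the same
exponential variables. -/
def raceDraws (P : LocalRule G q) (z₀ : Fin q) (e : Fin n × ℕ → Fin q → ℝ) : Draws G q :=
  fun a => winner z₀ (rates (P a.1 a.2.2)) (e (a.1, a.2.1))

lemma measurable_raceDraws (P : LocalRule G q) (z₀ : Fin q) : Measurable (raceDraws P z₀) :=
  measurable_pi_lambda _ fun _ => (measurable_winner _ _).comp (measurable_pi_apply _)

lemma ae_isWinner (P : LocalRule G q) (z₀ : Fin q) :
    ∀ᵐ e ∂raceMeasure n q, IsWinner P e (raceDraws P z₀ e) := by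
  have h : ∀ᵐ e ∂raceMeasure n q, ∀ a : (Σ v : Fin n, ℕ × (Nbhd G v → Fin q)),
      ∃ x, Wins (rates (P a.1 a.2.2)) (e (a.1, a.2.1)) x := by
    rw [ae_all_iff]
    exact fun a => (measurePreserving_eval_infinitePi (fun _ : Fin n × ℕ => expVector q)
      (a.1, a.2.1)).quasiMeasurePreserving.ae (ae_exists_wins _)
  filter_upwards [h] with e he a x
  obtain ⟨w, hw⟩ := he a
  have hz : raceDraws P z₀ e a = w := hw.winner_eq
  rw [hz]
  constructor
  · rintro rfl y hy
    have hyx : y ≠ x := by rintro rfl; exact lt_irrefl _ hy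
    exact lt_asymm hy (hw y hyx)
  · intro hx
    by_contra hxw
    exact hx w (hw x hxw)

lemma measurable_foldl_redraw {z : Ω → Draws G q} (hz : Measurable z) (l : List (Fin n × ℕ)) :
    ∀ {X : Ω → Fin n → Fin q}, Measurable X →
      Measurable fun ω => l.foldl (redraw (z ω)) (X ω) := by
  induction l with
  | nil => exact fun hX => hX
  | cons a l ih =>
    intro X hX
    simp only [List.foldl_cons]
    refine ih (measurable_pi_lambda _ fun u => ?_)
    unfold redraw
    by_cases hu : u = a.1
    · subst hu
      simp only [Function.update_self]
      exact Measurable.apply_countable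
        (F := fun (σ : Fin n → Fin q) ω => z ω ⟨a.1, a.2, fun u => σ u.1⟩)
        (fun σ => (measurable_pi_apply _).comp hz) hX
    · simp only [Function.update_of_ne hu]
      exact (measurable_pi_apply u).comp hX

lemma foldl_redraw_congr {z z' : Draws G q} (l : List (Fin n × ℕ)) (X : Fin n → Fin q)
    (h : ∀ a ∈ l, ∀ τ, z ⟨a.1, a.2, τ⟩ = z' ⟨a.1, a.2, τ⟩) :
    l.foldl (redraw z) X = l.foldl (redraw z') X := by
  induction l generalizing X with
  | nil => rfl
  | cons a l ih =>
    simp only [List.foldl_cons]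
    rw [ih _ fun b hb => h b (List.mem_cons_of_mem _ hb)]
    congr 1
    unfold redraw
    rw [h a List.mem_cons_self]

/-- Independent draws for all possible neighbourhoods, and draws that are made by one race per ring,
give the same law to the result of a sequence of updates: each ring asks for one draw only. -/
lemma raceMeasure_foldl_redraw (P : LocalRule G q) (z₀ : Fin q) (σ : Fin n → Fin q)
    (l : List (Fin n × ℕ)) (hl : l.Nodup) : ∀ X : Fin n → Fin q,
    raceMeasure n q {e | l.foldl (redraw (raceDraws P z₀ e)) X = σ} =
      (Measure.infinitePi fun a : (Σ v : Fin n, ℕ × (Nbhd G v → Fin q)) =>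
        (P a.1 a.2.2).toMeasure) {z | l.foldl (redraw z) X = σ} := by
  classical
  induction l with
  | nil =>
    intro X
    by_cases h : X = σ <;> simp [h]
  | cons a l ih =>
    intro X
    obtain ⟨hal, hl⟩ := List.nodup_cons.1 hl
    have hm1 : ∀ (l : List (Fin n × ℕ)) X,
        MeasurableSet {e | l.foldl (redraw (raceDraws P z₀ e)) X = σ} := fun l X =>
      measurable_foldl_redraw (measurable_raceDraws P z₀) l measurable_const
        (measurableSet_singleton σ)
    have hm2 : ∀ (l : List (Fin n × ℕ)) X,
        MeasurableSet {z : Draws G q | l.foldl (redraw z) X = σ} := fun l X =>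
      measurable_foldl_redraw measurable_id l measurable_const (measurableSet_singleton σ)
    set τ : Nbhd G a.1 → Fin q := fun u => X u.1 with hτ
    rw [← lintegral_indicator_one (hm1 _ _), ← lintegral_indicator_one (hm2 _ _)]
    unfold raceMeasure
    rw [lintegral_infinitePi_of_discrete _ a (measurable_one.indicator (hm1 _ _))
      (measurable_winner z₀ (rates (P a.1 τ)))
      (H := fun b => Set.indicator
        {e | l.foldl (redraw (raceDraws P z₀ e)) (Function.update X a.1 b) = σ} 1)
      (fun b => measurable_one.indicator (hm1 _ _)) (fun e y => ?_),
      lintegral_infinitePi_of_discrete _ (⟨a.1, a.2, τ⟩ : Σ v : Fin n, ℕ × (Nbhd G v → Fin q))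
      (measurable_one.indicator (hm2 _ _)) measurable_id
      (H := fun b => Set.indicator
        {z | l.foldl (redraw z) (Function.update X a.1 b) = σ} 1)
      (fun b => measurable_one.indicator (hm2 _ _)) (fun z y => ?_)]
    · refine Finset.sum_congr rfl fun b _ => ?_
      rw [lintegral_indicator_one (hm1 _ _), lintegral_indicator_one (hm2 _ _)]
      have := ih hl (Function.update X a.1 b)
      unfold raceMeasure at this
      rw [this, expVector_winner]
      congr 1
      have : {y : Fin q | id y = b} = {b} := by ext; simp
      rw [this, PMF.toMeasure_apply_singleton _ _ (measurableSet_singleton b)]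
    · have hred : redraw (Function.update z ⟨a.1, a.2, τ⟩ y) X a = Function.update X a.1 y := by
        unfold redraw
        simp [hτ]
      have hcongr := foldl_redraw_congr
        (z := Function.update z (⟨a.1, a.2, τ⟩ : Σ v : Fin n, ℕ × (Nbhd G v → Fin q)) y)
        (z' := z) l (Function.update X a.1 y)
        (fun b hb τ' => by
          refine Function.update_of_ne (fun h => hal ?_) _ _
          have h1 : b.1 = a.1 := congrArg (fun s => s.1) h
          have h2 : b.2 = a.2 := congrArg (fun s => s.2.1) h
          rwa [← Prod.ext h1 h2])
      simp only [Set.indicator, Set.mem_ofPred_eq, List.foldl_cons, hred, hcongr, id,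
        Pi.one_apply]
    · have hred : redraw (raceDraws P z₀ (Function.update e a y)) X a =
          Function.update X a.1 (winner z₀ (rates (P a.1 τ)) y) := by
        unfold redraw raceDraws
        simp [hτ]
      have hcongr := foldl_redraw_congr (z := raceDraws P z₀ (Function.update e a y))
        (z' := raceDraws P z₀ e) l (Function.update X a.1 (winner z₀ (rates (P a.1 τ)) y))
        (fun b hb τ' => by
          have : b ≠ a := fun h => hal (h ▸ hb)
          unfold raceDraws
          rw [Function.update_of_ne (by simpa using this)])
      simp only [Set.indicator, Set.mem_ofPred_eq, List.foldl_cons, hred, hcongr, Pi.one_apply]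

lemma nodup_ringList (g : Gaps n) (t : ℝ) : (ringList g t).Nodup := by
  unfold ringList
  split_ifs with h
  · exact (List.perm_insertionSort _ _).nodup_iff.2 (Finset.nodup_toList _)
  · exact List.nodup_nil

/-- The final configuration is a measurable function of the random numbers, up to null sets. -/
lemma exists_measurableSet_state {z : Ω → Draws G q} (hz : Measurable z) (X₀ : Fin n → Fin q)
    (T : ℝ) (σ : Fin n → Fin q) :
    ∃ B : Set (Gaps n × Ω), MeasurableSet B ∧
      ∀ᵐ g ∂gapMeasure n, ∀ e, (g, e) ∈ B ↔ state X₀ T (g, z e) = σ := by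
  refine ⟨{w | (fun v => truth (clock w.1) (drawRule (z w.2)) X₀ v
    (upTo (clock w.1) v T)) = σ}, ?_, ?_⟩
  · refine measurableSet_eq_fun (measurable_pi_lambda _ fun v => ?_) measurable_const
    refine Measurable.apply_countable
      (F := fun k (w : Gaps n × Ω) => truth (clock w.1) (drawRule (z w.2)) X₀ v k)
      (fun k => measurable_truth (S := fun w : Gaps n × Ω => clock w.1)
        (f := fun w => drawRule (z w.2)) (fun v k => by fun_prop) (fun v i τ => ?_) X₀ v k)
      (measurable_upTo (S := fun w : Gaps n × Ω => clock w.1) (fun v k => by fun_prop) v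
        measurable_const)
    exact (measurable_pi_apply _).comp (hz.comp measurable_snd)
  · filter_upwards [ae_isClock n] with g hg e
    have : state X₀ T (g, z e) =
        fun v => truth (clock g) (drawRule (z e)) X₀ v (upTo (clock g) v T) :=
      funext fun v => state_eq_truth (w := (g, z e)) hg X₀ T v
    rw [this]

lemma nullMeasurableSet_state (ν : Measure Ω) [IsProbabilityMeasure ν] {z : Ω → Draws G q}
    (hz : Measurable z) (X₀ : Fin n → Fin q) (T : ℝ) (σ : Fin n → Fin q) :
    NullMeasurableSet {w : Gaps n × Ω | state X₀ T (w.1, z w.2) = σ} ((gapMeasure n).prod ν) := by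
  obtain ⟨B, hB, hae⟩ := exists_measurableSet_state hz X₀ T σ
  refine ⟨B, hB, ?_⟩
  filter_upwards [Measure.quasiMeasurePreserving_fst.ae hae] with w hw
  exact propext (hw w.2).symm

/-- The law of the configuration at time `T`, conditioned on the clocks first. -/
lemma prod_state_eq (ν : Measure Ω) [IsProbabilityMeasure ν] {z : Ω → Draws G q}
    (hz : Measurable z) (X₀ : Fin n → Fin q) (T : ℝ) (σ : Fin n → Fin q) :
    (gapMeasure n).prod ν {w | state X₀ T (w.1, z w.2) = σ} =
      ∫⁻ g, ν {e | (ringList g T).foldl (redraw (z e)) X₀ = σ} ∂gapMeasure n := by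
  obtain ⟨B, hB, hae⟩ := exists_measurableSet_state hz X₀ T σ
  have h1 : (gapMeasure n).prod ν {w | state X₀ T (w.1, z w.2) = σ} = (gapMeasure n).prod ν B := by
    refine measure_congr ?_
    filter_upwards [Measure.quasiMeasurePreserving_fst.ae hae] with w hw
    exact propext (hw w.2).symm
  rw [h1, Measure.prod_apply hB]
  refine lintegral_congr_ae ?_
  filter_upwards [hae] with g hg
  congr 1
  ext e
  exact hg e

/-- Draws that are made by exponential races do not change the law of the dynamics. -/
theorem prod_race_state_eq (P : LocalRule G q) (z₀ : Fin q) (X₀ : Fin n → Fin q) (T : ℝ)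
    (σ : Fin n → Fin q) :
    (gapMeasure n).prod (raceMeasure n q) {w | state X₀ T (w.1, raceDraws P z₀ w.2) = σ} =
      dynMeasure P {w | state X₀ T w = σ} := by
  rw [prod_state_eq _ (measurable_raceDraws P z₀)]
  have := prod_state_eq (Measure.infinitePi fun a : (Σ v : Fin n, ℕ × (Nbhd G v → Fin q)) =>
    (P a.1 a.2.2).toMeasure) measurable_id X₀ T σ
  refine Eq.trans ?_ this.symm
  exact lintegral_congr fun g => raceMeasure_foldl_redraw P z₀ σ _ (nodup_ringList g T) X₀

/-! #### The random numbers of the machine -/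

/-- The waiting times and the exponential variables of the races, as the algorithm reads them off
the coin tosses. -/
def fromTape (n q : ℕ) (ω : PRAM.Tape) : Gaps n × (Fin n × ℕ → Fin q → ℝ) :=
  (fun a => -Real.log (ω (14 * a.2 + 5, a.1) : ℝ),
    fun a x => -Real.log (ω (14 * a.2 + 9, a.1 * q + x) : ℝ))

lemma measurable_fromTape : Measurable (fromTape n q) := by
  unfold fromTape
  have h : ∀ a : ℕ × ℕ, Measurable fun ω : PRAM.Tape => -Real.log (ω a : ℝ) := fun a =>
    (Real.measurable_log.comp (measurable_subtype_coe.comp (measurable_pi_apply a))).neg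
  exact (measurable_pi_lambda _ fun _ => h _).prodMk
    (measurable_pi_lambda _ fun _ => measurable_pi_lambda _ fun _ => h _)

/-- The cells of the tape that the algorithm reads are distinct, so what it reads is independent. -/
lemma map_fromTape (n q : ℕ) :
    PRAM.tapeMeasure.map (fromTape n q) = (gapMeasure n).prod (raceMeasure n q) := by
  have hh : Measurable fun u : unitInterval => -Real.log (u : ℝ) :=
    (Real.measurable_log.comp measurable_subtype_coe).neg
  have hp : IsProbabilityMeasure
      (Measure.map (fun u : unitInterval => -Real.log (u : ℝ)) volume) :=
    Measure.isProbabilityMeasure_map hh.aemeasurable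
  set f : (Fin n × ℕ) ⊕ ((Fin n × ℕ) × Fin q) → ℕ × ℕ := Sum.elim
    (fun a => (14 * a.2 + 5, a.1)) (fun p => (14 * p.1.2 + 9, p.1.1 * q + p.2)) with hf
  have hinj : Function.Injective f := by
    rintro (⟨v, i⟩ | ⟨⟨v, i⟩, x⟩) (⟨v', i'⟩ | ⟨⟨v', i'⟩, x'⟩) h <;>
      simp only [hf, Sum.elim_inl, Sum.elim_inr, Prod.mk.injEq] at h
    · rw [show i = i' by omega, Fin.ext h.2]
    · omega
    · omega
    · obtain ⟨h1, h2⟩ := h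
      have hq : 0 < q := x.pos
      have hv : (v : ℕ) = v' := by
        have h3 := congrArg (· / q) h2
        simpa [Nat.add_div_of_dvd_right, Nat.mul_div_cancel, Nat.div_eq_of_lt x.2,
          Nat.div_eq_of_lt x'.2, hq, mul_comm _ q, Nat.mul_add_div] using h3
      rw [hv] at h2
      rw [show i = i' by omega, Fin.ext hv, Fin.ext (by omega : (x : ℕ) = x')]
  have := infinitePi_map_blocks (volume : Measure unitInterval) hh hinj
  rw [map_neg_log_unitInterval] at this
  exact this

end SingleSite

end


/-! ### Chains of rings -/

noncomputable section

namespace SingleSite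

variable {n q : ℕ}

/-- The total weight of the chains of `l` rings with increasing times in `(b, t)` that end at a site
which acts on `v`. A step of the chain from site `u` to site `v` has weight `R u v`. -/
def chainSum (R : Fin n → Fin n → ℝ≥0∞) (S : Fin n → ℕ → ℝ) (b : ℝ) :
    ℕ → Fin n → ℝ → ℝ≥0∞
  | 0, _, _ => 1
  | l + 1, v, t => ∑ u, R u v * ∑ j ∈ Finset.range (before S u t),
      open Classical in if b < S u (j + 1) then chainSum R S b l u (S u (j + 1)) else 0

/-- The total weight of all sequences of `l` steps that end at `v`. -/
def chainCoeff (R : Fin n → Fin n → ℝ≥0∞) : ℕ → Fin n → ℝ≥0∞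
  | 0, _ => 1
  | l + 1, v => ∑ u, R u v * chainCoeff R l u

section Predictable

variable {R : Fin n → Fin n → ℝ≥0∞} {S S' : Fin n → ℕ → ℝ} {b : ℝ}

lemma apply_lt_of_lt_before {u : Fin n} {t : ℝ} {j : ℕ} (h : j < before S u t) :
    S u (j + 1) < t := by
  simpa using Nat.notMem_of_lt_sInf h

lemma chainSum_congr {t : ℝ} (h : ∀ s ≤ t, ∀ u, before S u s = before S' u s ∧
    ∀ j < before S u s, S u (j + 1) = S' u (j + 1)) (l : ℕ) :
    ∀ s ≤ t, ∀ v, chainSum R S b l v s = chainSum R S' b l v s := by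
  induction l with
  | zero => intro s _ v; rfl
  | succ l ih =>
    intro s hs v
    simp only [chainSum]
    refine Finset.sum_congr rfl fun u _ => ?_
    rw [← (h s hs u).1]
    congr 1
    refine Finset.sum_congr rfl fun j hj => ?_
    have hj := Finset.mem_range.1 hj
    rw [← (h s hs u).2 j hj, ih _ ((apply_lt_of_lt_before hj).le.trans hs)]

lemma sInf_eq_of_agree {A A' : Set ℕ} {i : ℕ} (hi : i ∈ A) (hi' : i ∈ A')
    (h : ∀ k < i, k ∈ A ↔ k ∈ A') : sInf A = sInf A' := by
  have h1 : ∀ B : Set ℕ, i ∈ B → sInf B ∈ B ∧ sInf B ≤ i := fun B hB =>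
    ⟨Nat.sInf_mem ⟨i, hB⟩, Nat.sInf_le hB⟩
  have h2 : ∀ B B' : Set ℕ, i ∈ B → i ∈ B' → (∀ k < i, k ∈ B ↔ k ∈ B') → sInf B' ≤ sInf B := by
    intro B B' hB hB' h
    rcases (h1 B hB).2.eq_or_lt with h3 | h3
    · rw [h3]; exact (h1 B' hB').2
    · exact Nat.sInf_le ((h _ h3).1 (h1 B hB).1)
  exact le_antisymm (h2 A' A hi' hi fun k hk => (h k hk).symm) (h2 A A' hi hi' h)

/-- A chain sum at time `t` does not depend on the waiting time that is running at time `t`. -/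
lemma chainSum_update {g : Gaps n} {v : Fin n} {i : ℕ} {x y t : ℝ} (hx : t ≤ clock g v i + x)
    (hy : t ≤ clock g v i + y) (l : ℕ) (w : Fin n) :
    chainSum R (clock (Function.update g (v, i) x)) b l w t =
      chainSum R (clock (Function.update g (v, i) y)) b l w t := by
  refine chainSum_congr (t := t) (fun s hs u => ?_) l t le_rfl w
  by_cases huv : u = v
  · subst huv
    have hle : ∀ z, s ≤ clock g u i + z →
        i ∈ {k | s ≤ clock (Function.update g (u, i) z) u (k + 1)} := fun z hz => by
      simpa [clock_update_self] using hz
    have heq : ∀ k ≤ i, clock (Function.update g (u, i) x) u k =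
        clock (Function.update g (u, i) y) u k := fun k hk => by
      rw [clock_update_of_le _ _ fun _ => hk, clock_update_of_le _ _ fun _ => hk]
    refine ⟨sInf_eq_of_agree (hle x (hs.trans hx)) (hle y (hs.trans hy)) fun k hk => ?_,
      fun j hj => heq _ ?_⟩
    · rw [Set.mem_ofPred_eq, Set.mem_ofPred_eq, heq _ hk]
    · exact hj.trans_le (Nat.sInf_le (hle x (hs.trans hx)))
  · have heq : ∀ k z, clock (Function.update g (v, i) z) u k = clock g u k := fun k z =>
      clock_update_of_le _ _ fun h => absurd h huv
    unfold before
    simp [heq]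

lemma measurable_sum_range {Ω : Type*} [MeasurableSpace Ω] {N : Ω → ℕ} (hN : Measurable N)
    {F : ℕ → Ω → ℝ≥0∞} (hF : ∀ j, Measurable (F j)) :
    Measurable fun ω => ∑ j ∈ Finset.range (N ω), F j ω :=
  Measurable.apply_countable (F := fun N ω => ∑ j ∈ Finset.range N, F j ω)
    (fun _ => Finset.measurable_sum _ fun j _ => hF j) hN

lemma measurable_chainSum {Ω : Type*} [MeasurableSpace Ω] {S : Ω → Fin n → ℕ → ℝ}
    (hS : ∀ v k, Measurable fun ω => S ω v k) (l : ℕ) :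
    ∀ (v : Fin n) {t : Ω → ℝ}, Measurable t →
      Measurable fun ω => chainSum R (S ω) b l v (t ω) := by
  induction l with
  | zero => intro v t _; exact measurable_const
  | succ l ih =>
    intro v t ht
    simp only [chainSum]
    refine Finset.measurable_sum _ fun u _ => Measurable.const_mul ?_ _
    refine measurable_sum_range (measurable_before hS u ht) fun j => ?_
    exact Measurable.ite (measurableSet_lt measurable_const (hS u (j + 1)))
      (ih u (hS u (j + 1))) measurable_const

end Predictable

/-- The rings of a clock have rate `1`: a sum over the rings of `v` in the window `(b, B)` is on
average at most the integral over that window. The summand at time `t` must not depend on the waiting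
time of `v` that is running at time `t`. -/
lemma lintegral_sum_rings_le {Y : ℝ → Gaps n → ℝ≥0∞} (hY : Measurable fun p : ℝ × Gaps n => Y p.1 p.2)
    {v : Fin n} (hpred : ∀ g i x y t, t ≤ clock g v i + x → t ≤ clock g v i + y →
      Y t (Function.update g (v, i) x) = Y t (Function.update g (v, i) y)) (b B : ℝ) :
    ∫⁻ g, ∑ j ∈ Finset.range (before (clock g) v B),
        (open Classical in if b < clock g v (j + 1) then Y (clock g v (j + 1)) g else 0)
      ∂gapMeasure n ≤ ∫⁻ t in Set.Ioo b B, ∫⁻ g, Y t g ∂gapMeasure n := by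
  classical
  set F : ℕ → Gaps n → ℝ≥0∞ := fun j g =>
    if clock g v (j + 1) ∈ Set.Ioo b B then Y (clock g v (j + 1)) g else 0 with hF
  set K : ℕ → Gaps n → ℝ → ℝ≥0∞ := fun j g t =>
    if t ∈ Set.Ioo (clock g v j) (clock g v (j + 1)) ∧ t ∈ Set.Ioo b B then Y t g else 0 with hK
  have hFm : ∀ j, Measurable (F j) := fun j =>
    Measurable.ite ((measurable_clock v (j + 1)) measurableSet_Ioo)
      (hY.comp ((measurable_clock v (j + 1)).prodMk measurable_id)) measurable_const
  have hKm : ∀ j, Measurable fun p : Gaps n × ℝ => K j p.1 p.2 := fun j => by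
    refine Measurable.ite ?_ (hY.comp measurable_swap) measurable_const
    refine MeasurableSet.inter (MeasurableSet.inter ?_ ?_) (measurable_snd measurableSet_Ioo)
    · exact measurableSet_lt ((measurable_clock v j).comp measurable_fst) measurable_snd
    · exact measurableSet_lt measurable_snd ((measurable_clock v (j + 1)).comp measurable_fst)
  have hKm1 : ∀ j, Measurable fun g => ∫⁻ t, K j g t := fun j => (hKm j).lintegral_prod_right'
  -- One ring: resample the waiting time that ends with it.
  have hone : ∀ j, ∫⁻ g, F j g ∂gapMeasure n = ∫⁻ g, (∫⁻ t, K j g t) ∂gapMeasure n := by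
    intro j
    unfold gapMeasure
    rw [lintegral_infinitePi_update _ (v, j) (hFm j),
      lintegral_infinitePi_update _ (v, j) (hKm1 j)]
    refine lintegral_congr fun g => ?_
    have hupd : Measurable fun x => Function.update g (v, j) x := measurable_update g
    rw [lintegral_expMeasure_eq (h := fun x => F j (Function.update g (v, j) x))
      ((hFm j).comp hupd)]
    refine lintegral_congr fun y => ?_
    rw [← lintegral_indicator measurableSet_Ioo, ← lintegral_add_left_eq_self
      (fun t => K j (Function.update g (v, j) y) t) (clock g v j)]
    refine lintegral_congr fun x => ?_
    have hc : clock (Function.update g (v, j) y) v j = clock g v j :=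
      clock_update_of_le _ _ fun _ => le_rfl
    simp only [Set.indicator, hF, hK, clock_update_self, hc]
    have hiff : clock g v j + x ∈ Set.Ioo (clock g v j) (clock g v j + y) ↔ x ∈ Set.Ioo 0 y := by
      simp
    by_cases h1 : x ∈ Set.Ioo 0 y
    · by_cases h2 : clock g v j + x ∈ Set.Ioo b B
      · rw [if_pos h1, if_pos h2, if_pos ⟨hiff.2 h1, h2⟩]
        exact hpred g j x y _ le_rfl (by linarith [h1.2])
      · rw [if_pos h1, if_neg h2, if_neg fun h => h2 h.2]
    · rw [if_neg h1, if_neg fun h => h1 (hiff.1 h.1)]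
  calc ∫⁻ g, ∑ j ∈ Finset.range (before (clock g) v B),
        (if b < clock g v (j + 1) then Y (clock g v (j + 1)) g else 0) ∂gapMeasure n
      ≤ ∫⁻ g, ∑' j, F j g ∂gapMeasure n := by
        refine lintegral_mono fun g => ?_
        refine le_trans (Finset.sum_le_sum fun j hj => ?_)
          (ENNReal.sum_le_tsum (f := fun j => F j g) (Finset.range (before (clock g) v B)))
        have hlt := apply_lt_of_lt_before (Finset.mem_range.1 hj)
        split_ifs with h
        · rw [hF]
          simp only
          rw [if_pos ⟨h, hlt⟩]
        · exact zero_le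
    _ = ∑' j, ∫⁻ g, (∫⁻ t, K j g t) ∂gapMeasure n := by
        rw [lintegral_tsum fun j => (hFm j).aemeasurable]
        exact tsum_congr hone
    _ = ∫⁻ g, (∫⁻ t, ∑' j, K j g t) ∂gapMeasure n := by
        rw [← lintegral_tsum fun j => (hKm1 j).aemeasurable]
        refine lintegral_congr fun g => ?_
        rw [lintegral_tsum (f := fun j t => K j g t)
          fun j => ((hKm j).comp (measurable_prodMk_left (x := g))).aemeasurable]
    _ ≤ ∫⁻ g, (∫⁻ t in Set.Ioo b B, Y t g) ∂gapMeasure n := by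
        refine lintegral_mono_ae ?_
        filter_upwards [ae_gaps_pos n] with g hg
        have hmono := (clock_strictMono hg v).monotone
        rw [← lintegral_indicator measurableSet_Ioo]
        refine lintegral_mono fun t => ?_
        by_cases hex : ∃ j, K j g t ≠ 0
        · obtain ⟨j, hj⟩ := hex
          have hj' : t ∈ Set.Ioo (clock g v j) (clock g v (j + 1)) ∧ t ∈ Set.Ioo b B := by
            by_contra h
            exact hj (if_neg h)
          rw [tsum_eq_single j, Set.indicator_of_mem hj'.2]
          · exact (if_pos hj').le
          · intro i hij
            refine if_neg fun h => ?_
            rcases lt_or_gt_of_ne hij with h' | h'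
            · exact absurd (h.1.2.trans_le (hmono h')) (not_lt.2 hj'.1.1.le)
            · exact absurd (hj'.1.2.trans_le (hmono h')) (not_lt.2 h.1.1.le)
        · push Not at hex
          simp [hex]
    _ = ∫⁻ t in Set.Ioo b B, ∫⁻ g, Y t g ∂gapMeasure n :=
        lintegral_lintegral_swap (f := fun g t => Y t g) (hY.comp measurable_swap).aemeasurable

lemma lintegral_pow_div_factorial {b t : ℝ} (h : b ≤ t) (l : ℕ) :
    ∫⁻ s in Set.Ioo b t, ENNReal.ofReal ((s - b) ^ l / l.factorial) =
      ENNReal.ofReal ((t - b) ^ (l + 1) / (l + 1).factorial) := by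
  have hc : Continuous fun s : ℝ => (s - b) ^ l / (l.factorial : ℝ) := by fun_prop
  rw [← ofReal_integral_eq_lintegral_ofReal]
  · congr 1
    rw [← integral_Ioc_eq_integral_Ioo, ← intervalIntegral.integral_of_le h,
      intervalIntegral.integral_div, intervalIntegral.integral_comp_sub_right (fun s => s ^ l) b,
      integral_pow, Nat.factorial_succ]
    push_cast
    have : (l.factorial : ℝ) ≠ 0 := by positivity
    field_simp
    simp
  · exact (hc.integrableOn_Icc).mono_set Set.Ioo_subset_Icc_self
  · refine (ae_restrict_iff' measurableSet_Ioo).2 (Filter.Eventually.of_forall fun s hs => ?_)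
    have : 0 ≤ s - b := by linarith [hs.1]
    positivity

lemma lintegral_sum_chainSum_le {R : Fin n → Fin n → ℝ≥0∞} {b : ℝ} {l : ℕ} {v : Fin n}
    (ih : ∀ t, b ≤ t → ∫⁻ g, chainSum R (clock g) b l v t ∂gapMeasure n ≤
      ENNReal.ofReal ((t - b) ^ l / l.factorial) * chainCoeff R l v) {t : ℝ} (ht : b ≤ t) :
    ∫⁻ g, ∑ j ∈ Finset.range (before (clock g) v t),
        (open Classical in if b < clock g v (j + 1)
          then chainSum R (clock g) b l v (clock g v (j + 1)) else 0) ∂gapMeasure n ≤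
      ENNReal.ofReal ((t - b) ^ (l + 1) / (l + 1).factorial) * chainCoeff R l v := by
  refine (lintegral_sum_rings_le (Y := fun t g => chainSum R (clock g) b l v t)
    (measurable_chainSum (S := fun p : ℝ × Gaps n => clock p.2) (fun u k => by fun_prop) l v
      measurable_fst) (fun g i x y t hx hy => chainSum_update hx hy l v) b t).trans ?_
  rw [← lintegral_pow_div_factorial ht, ← lintegral_mul_const _ (by fun_prop)]
  exact setLIntegral_mono (by fun_prop) fun s hs => ih s hs.1.le

/-- The expected weight of the chains in a time window: the times are increasing, which makes the volume
of their range the length of the window to the power `l` divided by `l!`. -/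
lemma lintegral_chainSum_le (R : Fin n → Fin n → ℝ≥0∞) (b : ℝ) (l : ℕ) :
    ∀ (v : Fin n) (t : ℝ), b ≤ t → ∫⁻ g, chainSum R (clock g) b l v t ∂gapMeasure n ≤
      ENNReal.ofReal ((t - b) ^ l / l.factorial) * chainCoeff R l v := by
  induction l with
  | zero => intro v t _; simp [chainSum, chainCoeff]
  | succ l ih =>
    intro v t ht
    simp only [chainSum, chainCoeff]
    have hm : ∀ u, Measurable fun g : Gaps n => ∑ j ∈ Finset.range (before (clock g) u t),
        (open Classical in if b < clock g u (j + 1)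
          then chainSum R (clock g) b l u (clock g u (j + 1)) else 0) := fun u => by
      refine measurable_sum_range (measurable_before (fun v k => by fun_prop) u measurable_const)
        fun j => Measurable.ite (measurableSet_lt measurable_const (by fun_prop)) ?_
          measurable_const
      exact measurable_chainSum (S := fun g : Gaps n => clock g) (fun v k => by fun_prop) l u
        (by fun_prop)
    rw [lintegral_finsetSum _ fun u _ => (hm u).const_mul _, Finset.mul_sum]
    refine Finset.sum_le_sum fun u _ => ?_
    rw [lintegral_const_mul _ (hm u), mul_left_comm]
    gcongr
    exact lintegral_sum_chainSum_le (ih u) ht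

/-! ### The number of rings in a time window -/

lemma one_le_chainSum {S : Fin n → ℕ → ℝ} (hS : IsClock S) {b : ℝ} {v : Fin n} (l : ℕ) :
    ∀ t, upTo S v b + l ≤ before S v t →
      1 ≤ chainSum (fun u v => if u = v then 1 else 0) S b l v t := by
  induction l with
  | zero => intro t _; exact le_rfl
  | succ l ih =>
    intro t ht
    obtain ⟨j, hj⟩ : ∃ j, before S v t = j + 1 := Nat.exists_eq_succ_of_ne_zero (by omega)
    have hbj : b < S v (j + 1) := not_le.1 fun h => by
      have := hS.lt_upTo.2 h
      omega
    simp only [chainSum, ite_mul, one_mul, zero_mul, Finset.sum_ite_eq', Finset.mem_univ, if_true]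
    rw [hj]
    refine le_trans ?_ (Finset.single_le_sum (fun _ _ => zero_le) (Finset.self_mem_range_succ j))
    rw [if_pos hbj]
    exact ih _ (by rw [hS.before_self]; omega)

lemma chainCoeff_one (l : ℕ) (v : Fin n) :
    chainCoeff (fun u v => if u = v then 1 else 0) l v = 1 := by
  induction l generalizing v with
  | zero => rfl
  | succ l ih => simp [chainCoeff, ih]

/-- It is unlikely that a clock rings `l` times in a short window: with the identity matrix as weights,
the chains consist of rings of one clock, and there is one as soon as there are `l` rings. -/
lemma gapMeasure_rings_le (v : Fin n) {b t : ℝ} (h : b ≤ t) (l : ℕ) :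
    gapMeasure n {g | upTo (clock g) v b + l ≤ before (clock g) v t} ≤
      ENNReal.ofReal ((t - b) ^ l / l.factorial) := by
  set Y : Gaps n → ℝ≥0∞ := fun g =>
    chainSum (fun u v => if u = v then 1 else 0) (clock g) b l v t with hY
  have hYm : Measurable Y := measurable_chainSum (S := fun g : Gaps n => clock g)
    (fun v k => by fun_prop) l v measurable_const
  calc gapMeasure n {g | upTo (clock g) v b + l ≤ before (clock g) v t}
      ≤ gapMeasure n {g | 1 ≤ Y g} := by
        refine measure_mono_ae ?_
        filter_upwards [ae_isClock n] with g hg h'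
        exact one_le_chainSum hg l t h'
    _ ≤ ∫⁻ g, Y g ∂gapMeasure n := by
        have := mul_meas_ge_le_lintegral (μ := gapMeasure n) hYm 1
        rwa [one_mul] at this
    _ ≤ _ := by
        have := lintegral_chainSum_le (fun u v : Fin n => if u = v then 1 else 0) b l v t h
        rwa [chainCoeff_one, mul_one] at this

/-! ### Disagreement between successive sweeps -/

section Disagreement

lemma measure_setOf_false {Ω : Type*} [MeasurableSpace Ω] {μ : Measure Ω} {p : Ω → Prop}
    (h : ∀ ω, ¬ p ω) : μ {ω | p ω} = 0 := by
  simp [h]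

variable {G : SimpleGraph (Fin n)} (P : LocalRule G q)

/-- The weight of a step of a chain of disagreements. The factor `2` is what the coupling by races
loses compared to an optimal coupling. -/
def stepWeight (u v : Fin n) : ℝ≥0∞ := ENNReal.ofReal (2 * influence P u v)

variable (X₀ : Fin n → Fin q) (z₀ : Fin q)

/-- The guesses after `r` sweeps that start from the correct configuration at time `b`, as a function
of the clocks and of the random numbers of the races. -/
def guesses (b : ℝ) (r : ℕ) (g : Gaps n) (e : Fin n × ℕ → Fin q → ℝ) : Fin n → ℕ → Fin q :=
  (sweep (clock g) (drawRule (raceDraws P z₀ e)))^[r]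
    (guess (clock g) (drawRule (raceDraws P z₀ e)) X₀ z₀ b)

lemma measurable_guesses (b : ℝ) (r : ℕ) (v : Fin n) (k : ℕ) :
    Measurable fun w : Gaps n × (Fin n × ℕ → Fin q → ℝ) => guesses P X₀ z₀ b r w.1 w.2 v k := by
  have hS : ∀ v k, Measurable fun w : Gaps n × (Fin n × ℕ → Fin q → ℝ) => clock w.1 v k :=
    fun v k => by fun_prop
  have hf : ∀ v i σ, Measurable fun w : Gaps n × (Fin n × ℕ → Fin q → ℝ) =>
      drawRule (raceDraws P z₀ w.2) v i σ := fun v i σ =>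
    (measurable_pi_apply _).comp ((measurable_raceDraws P z₀).comp measurable_snd)
  exact measurable_iterate_sweep hS hf (fun v k => measurable_guess hS hf X₀ z₀ b v k) r v k

variable {P X₀ z₀}

lemma measurableSet_guesses_ne (g : Gaps n) (b : ℝ) (r : ℕ) (v : Fin n) (k : ℕ) :
    MeasurableSet {e | guesses P X₀ z₀ b (r + 1) g e v k ≠ guesses P X₀ z₀ b r g e v k} := by
  have h : ∀ r, Measurable fun e => guesses P X₀ z₀ b r g e v k := fun r => by
    have := (measurable_guesses P X₀ z₀ b r v k).comp (measurable_prodMk_left (x := g))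
    simpa only [Function.comp_def] using this
  exact (measurableSet_eq_fun (h (r + 1)) (h r)).compl

lemma guesses_update {g : Gaps n} (hg : IsClock (clock g)) {b : ℝ} {r : ℕ} {v u : Fin n} {i k : ℕ}
    (h : clock g u k < clock g v (i + 1)) (e : Fin n × ℕ → Fin q → ℝ) (y : Fin q → ℝ) :
    guesses P X₀ z₀ b r g (Function.update e (v, i) y) u k = guesses P X₀ z₀ b r g e u k := by
  refine iterate_sweep_guess_congr hg (t := clock g u k) (fun w j hj => ?_) r le_rfl
  funext σ
  unfold drawRule raceDraws
  rw [Function.update_of_ne]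
  rintro hwj
  simp only [Prod.mk.injEq] at hwj
  obtain ⟨rfl, rfl⟩ := hwj
  exact absurd h (not_lt.2 hj)

/-- A disagreement between two successive sweeps propagates along chains of rings. Given what happens
before a ring, its race is fresh, and it separates the two sweeps with at most the influence of the sites
on which the sweeps before them disagree. -/
lemma raceMeasure_guesses_ne_le {g : Gaps n} (hg : IsClock (clock g)) (b : ℝ) (r : ℕ) :
    ∀ (v : Fin n) (i : ℕ), raceMeasure n q
      {e | guesses P X₀ z₀ b (r + 1) g e v (i + 1) ≠ guesses P X₀ z₀ b r g e v (i + 1)} ≤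
      (open Classical in if b < clock g v (i + 1)
        then chainSum (stepWeight P) (clock g) b r v (clock g v (i + 1)) else 0) := by
  classical
  induction r with
  | zero =>
    intro v i
    split_ifs with hb
    · exact prob_le_one
    · refine (measure_setOf_false fun e => not_not.2 ?_).le
      unfold guesses
      rw [iterate_sweep_guess_of_le hg _ (not_lt.1 hb), iterate_sweep_guess_of_le hg _ (not_lt.1 hb)]
  | succ r ih =>
    intro v i
    split_ifs with hb
    swap
    · refine (measure_setOf_false fun e => not_not.2 ?_).le
      unfold guesses
      rw [iterate_sweep_guess_of_le hg _ (not_lt.1 hb), iterate_sweep_guess_of_le hg _ (not_lt.1 hb)]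
    set t := clock g v (i + 1) with ht
    set k : Fin n → ℕ := fun u => before (clock g) u t with hk
    have hkt : ∀ u, clock g u (k u) < t := fun u => hg.apply_before_lt (hg.pos v i)
    set σ : (Fin n × ℕ → Fin q → ℝ) → ℕ → Fin n → Fin q := fun e r u =>
      guesses P X₀ z₀ b r g e u (k u) with hσ
    have hσu : ∀ e y r, σ (Function.update e (v, i) y) r = σ e r := fun e y r =>
      funext fun u => guesses_update hg (hkt u) e y
    have hstep : ∀ e r, guesses P X₀ z₀ b (r + 1) g e v (i + 1) =
        winner z₀ (rates (P v fun u => σ e r u.1)) (e (v, i)) := fun e r => iterate_sweep_succ _ _ _ _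
    have hms := measurableSet_guesses_ne (P := P) (X₀ := X₀) (z₀ := z₀) g b
    have hprop : ∀ u, raceMeasure n q {e | σ e (r + 1) u ≠ σ e r u} ≤
        ∑ j ∈ Finset.range (k u), (if b < clock g u (j + 1)
          then chainSum (stepWeight P) (clock g) b r u (clock g u (j + 1)) else 0) := by
      intro u
      rcases hku : k u with _ | j
      · refine (measure_setOf_false fun e => not_not.2 ?_).le.trans zero_le
        simp only [hσ, hku]
        unfold guesses
        rw [iterate_sweep_zero, iterate_sweep_zero]
      · simp only [hσ, hku]
        exact (ih u j).trans (Finset.single_le_sum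
          (f := fun j => if b < clock g u (j + 1)
            then chainSum (stepWeight P) (clock g) b r u (clock g u (j + 1)) else 0)
          (fun _ _ => zero_le) (Finset.self_mem_range_succ j))
    rw [← lintegral_indicator_one (hms _ _ _)]
    unfold raceMeasure at hprop ⊢
    rw [lintegral_infinitePi_update _ (v, i) (measurable_one.indicator (hms _ _ _))]
    calc ∫⁻ e, ∫⁻ y, Set.indicator {e | guesses P X₀ z₀ b (r + 1 + 1) g e v (i + 1) ≠
            guesses P X₀ z₀ b (r + 1) g e v (i + 1)} 1 (Function.update e (v, i) y) ∂expVector q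
            ∂(Measure.infinitePi fun _ : Fin n × ℕ => expVector q)
        ≤ ∫⁻ e, ∑ u, stepWeight P u v * Set.indicator {e | σ e (r + 1) u ≠ σ e r u} 1 e
            ∂(Measure.infinitePi fun _ : Fin n × ℕ => expVector q) := by
          refine lintegral_mono fun e => ?_
          have h1 : ∀ y, Set.indicator {e | guesses P X₀ z₀ b (r + 1 + 1) g e v (i + 1) ≠
              guesses P X₀ z₀ b (r + 1) g e v (i + 1)} (1 : (Fin n × ℕ → Fin q → ℝ) → ℝ≥0∞)
              (Function.update e (v, i) y) = Set.indicator
              {y | winner z₀ (rates (P v fun u => σ e (r + 1) u.1)) y ≠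
                winner z₀ (rates (P v fun u => σ e r u.1)) y} 1 y := fun y => by
            simp only [Set.indicator, Set.mem_ofPred_eq, hstep, hσu, Function.update_self,
              Pi.one_apply]
          simp_rw [h1]
          have h3 : MeasurableSet {y | winner z₀ (rates (P v fun u => σ e (r + 1) u.1)) y ≠
              winner z₀ (rates (P v fun u => σ e r u.1)) y} :=
            (measurableSet_eq_fun (measurable_winner _ _) (measurable_winner _ _)).compl
          rw [lintegral_indicator_one h3]
          refine (expVector_winner_ne z₀ _ _).trans ?_
          have h2 := tvDist_le_sum_influence P v
            (Finset.univ.filter fun u => σ e (r + 1) u ≠ σ e r u) (σ e (r + 1)) (σ e r)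
            (fun u hu => by simpa using hu)
          refine (ENNReal.ofReal_le_ofReal (mul_le_mul_of_nonneg_left h2 zero_le_two)).trans ?_
          rw [Finset.mul_sum, ENNReal.ofReal_sum_of_nonneg
            fun u _ => mul_nonneg zero_le_two (influence_nonneg P u v), Finset.sum_filter]
          refine Finset.sum_le_sum fun u _ => ?_
          by_cases hu : σ e (r + 1) u ≠ σ e r u
          · rw [if_pos hu, Set.indicator_of_mem (by exact hu), Pi.one_apply, mul_one]
            rfl
          · rw [if_neg hu]
            exact zero_le
      _ = ∑ u, stepWeight P u v * (Measure.infinitePi fun _ : Fin n × ℕ => expVector q)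
            {e | σ e (r + 1) u ≠ σ e r u} := by
          rw [lintegral_finsetSum _ fun u _ =>
            (measurable_one.indicator (hms r u (k u))).const_mul _]
          refine Finset.sum_congr rfl fun u _ => ?_
          rw [lintegral_const_mul _ (measurable_one.indicator (hms r u (k u))),
            lintegral_indicator_one (hms r u (k u))]
      _ ≤ _ := by
          simp only [chainSum]
          gcongr with u _
          exact hprop u

/-- It is unlikely that the sweeps `r` and `r + 1` disagree anywhere in a time window: the bound is the
expected weight of the chains of `r + 1` rings. -/
lemma prod_guesses_ne_le {b B : ℝ} (h : b ≤ B) (r : ℕ) :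
    (gapMeasure n).prod (raceMeasure n q) {w | ∃ v i, i < before (clock w.1) v B ∧
      guesses P X₀ z₀ b (r + 1) w.1 w.2 v (i + 1) ≠ guesses P X₀ z₀ b r w.1 w.2 v (i + 1)} ≤
      ENNReal.ofReal ((B - b) ^ (r + 1) / (r + 1).factorial) *
        ∑ v, chainCoeff (stepWeight P) r v := by
  classical
  set D : Fin n → ℕ → Set (Gaps n × (Fin n × ℕ → Fin q → ℝ)) := fun v i =>
    {w | i < before (clock w.1) v B ∧ guesses P X₀ z₀ b (r + 1) w.1 w.2 v (i + 1) ≠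
      guesses P X₀ z₀ b r w.1 w.2 v (i + 1)} with hD
  have hDm : ∀ v i, MeasurableSet (D v i) := fun v i => by
    refine MeasurableSet.inter ?_ ?_
    · exact measurableSet_lt measurable_const (measurable_before
        (S := fun w : Gaps n × (Fin n × ℕ → Fin q → ℝ) => clock w.1) (fun v k => by fun_prop) v
        measurable_const)
    · exact (measurableSet_eq_fun (measurable_guesses P X₀ z₀ b (r + 1) v (i + 1))
        (measurable_guesses P X₀ z₀ b r v (i + 1))).compl
  have hset : {w : Gaps n × (Fin n × ℕ → Fin q → ℝ) | ∃ v i, i < before (clock w.1) v B ∧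
      guesses P X₀ z₀ b (r + 1) w.1 w.2 v (i + 1) ≠ guesses P X₀ z₀ b r w.1 w.2 v (i + 1)} =
      ⋃ v, ⋃ i, D v i := by
    ext w; simp [hD]
  rw [hset, Measure.prod_apply (MeasurableSet.iUnion fun v => MeasurableSet.iUnion fun i => hDm v i)]
  have hm : ∀ v, Measurable fun g : Gaps n => ∑ j ∈ Finset.range (before (clock g) v B),
      (if b < clock g v (j + 1)
        then chainSum (stepWeight P) (clock g) b r v (clock g v (j + 1)) else 0) := fun v => by
    refine measurable_sum_range (measurable_before (fun v k => by fun_prop) v measurable_const)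
      fun j => Measurable.ite (measurableSet_lt measurable_const (by fun_prop)) ?_
        measurable_const
    exact measurable_chainSum (S := fun g : Gaps n => clock g) (fun v k => by fun_prop) r v
      (by fun_prop)
  calc ∫⁻ g, raceMeasure n q (Prod.mk g ⁻¹' ⋃ v, ⋃ i, D v i) ∂gapMeasure n
      ≤ ∫⁻ g, ∑ v, ∑ j ∈ Finset.range (before (clock g) v B), (if b < clock g v (j + 1)
        then chainSum (stepWeight P) (clock g) b r v (clock g v (j + 1)) else 0)
          ∂gapMeasure n := by
        refine lintegral_mono_ae ?_
        filter_upwards [ae_isClock n] with g hg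
        have hsub : Prod.mk g ⁻¹' (⋃ v, ⋃ i, D v i) ⊆ ⋃ v ∈ (Finset.univ : Finset (Fin n)),
            ⋃ j ∈ Finset.range (before (clock g) v B),
              {e | guesses P X₀ z₀ b (r + 1) g e v (j + 1) ≠
                guesses P X₀ z₀ b r g e v (j + 1)} := by
          intro e he
          simp only [Set.mem_preimage, Set.mem_iUnion, hD] at he
          obtain ⟨v, i, hi, hne⟩ := he
          simp only [Set.mem_iUnion]
          exact ⟨v, Finset.mem_univ v, i, Finset.mem_range.2 hi, hne⟩
        refine (measure_mono hsub).trans ((measure_biUnion_finset_le _ _).trans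
          (Finset.sum_le_sum fun v _ => (measure_biUnion_finset_le _ _).trans
            (Finset.sum_le_sum fun j _ => ?_)))
        exact raceMeasure_guesses_ne_le hg b r v j
    _ ≤ _ := by
        rw [lintegral_finsetSum _ fun v _ => hm v, Finset.mul_sum]
        exact Finset.sum_le_sum fun v _ =>
          lintegral_sum_chainSum_le (fun t => lintegral_chainSum_le _ b r v t) h

end Disagreement

end SingleSite

end


/-! ### Powers of the influence matrix -/

noncomputable section

namespace SingleSite

variable {n q m : ℕ} {G : SimpleGraph (Fin n)} {P : LocalRule G q}

lemma norm_mulVec_le {p : ℝ≥0∞} {M : Matrix (Fin n) (Fin n) ℝ} {C : ℝ≥0}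
    (h : lpOpNorm p M ≤ C) (hp : 1 ≤ p) (x : Fin n → ℝ) :
    ‖(WithLp.toLp p (M.mulVec x) : PiLp p fun _ : Fin n => ℝ)‖ ≤
      C * ‖(WithLp.toLp p x : PiLp p fun _ : Fin n => ℝ)‖ := by
  have : Fact (1 ≤ p) := ⟨hp⟩
  by_cases hx : x = 0
  · subst hx
    simp
  have h1 : ENNReal.ofReal (‖(WithLp.toLp p (M.mulVec x) : PiLp p fun _ : Fin n => ℝ)‖ /
      ‖(WithLp.toLp p x : PiLp p fun _ : Fin n => ℝ)‖) ≤ C :=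
    (le_iSup (fun x : {x : Fin n → ℝ // x ≠ 0} => ENNReal.ofReal
      (‖(WithLp.toLp p (M.mulVec x.1) : PiLp p fun _ : Fin n => ℝ)‖ /
        ‖(WithLp.toLp p x.1 : PiLp p fun _ : Fin n => ℝ)‖)) ⟨x, hx⟩).trans h
  have hpos : 0 < ‖(WithLp.toLp p x : PiLp p fun _ : Fin n => ℝ)‖ := by
    rw [norm_pos_iff]
    simpa using hx
  rw [← ENNReal.ofReal_coe_nnreal, ENNReal.ofReal_le_ofReal_iff C.coe_nonneg, div_le_iff₀ hpos] at h1
  exact h1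

lemma norm_iterate_mulVec_le {p : ℝ≥0∞} {M : Matrix (Fin n) (Fin n) ℝ} {C : ℝ≥0}
    (h : lpOpNorm p M ≤ C) (hp : 1 ≤ p) (l : ℕ) (u : Fin n) :
    (M.mulVec)^[l] (fun _ => 1) u ≤ C ^ l * n := by
  have : Fact (1 ≤ p) := ⟨hp⟩
  have h1 : ‖(WithLp.toLp p ((M.mulVec)^[l] fun _ => 1) : PiLp p fun _ : Fin n => ℝ)‖ ≤
      C ^ l * ‖(WithLp.toLp p (fun _ => 1) : PiLp p fun _ : Fin n => ℝ)‖ := by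
    induction l with
    | zero => simp
    | succ l ih =>
      rw [Function.iterate_succ_apply', pow_succ', mul_assoc]
      exact (norm_mulVec_le h hp _).trans (by gcongr)
  have h2 : ‖(WithLp.toLp p (fun _ => 1) : PiLp p fun _ : Fin n => ℝ)‖ ≤ n := by
    have : (WithLp.toLp p (fun _ => 1) : PiLp p fun _ : Fin n => ℝ) =
        ∑ i, PiLp.single p i (1 : ℝ) := by
      ext j
      simp
    rw [this]
    refine (norm_sum_le _ _).trans ?_
    simp
  calc (M.mulVec)^[l] (fun _ => 1) u
      ≤ ‖(WithLp.toLp p ((M.mulVec)^[l] fun _ => 1) : PiLp p fun _ : Fin n => ℝ)‖ :=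
        (le_abs_self _).trans (PiLp.norm_apply_le
          (WithLp.toLp p ((M.mulVec)^[l] fun _ => 1) : PiLp p fun _ : Fin n => ℝ) u)
    _ ≤ C ^ l * n := h1.trans (by gcongr)

/-- The total weight of all chains of steps with influence weights is controlled by any of the
operator norms of the influence matrix. The norm only enters through powers of the matrix applied to the
constant vector, so the loss from comparing it with other norms is a factor `n`, whatever `l` is. -/
lemma sum_chainCoeff_le {p : ℝ≥0∞} {C : ℝ≥0} (h : lpOpNorm p (influence P) ≤ C) (hp : 1 ≤ p)
    (l : ℕ) : ∑ v, chainCoeff (stepWeight P) l v ≤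
      ENNReal.ofReal ((n : ℝ) ^ 2 * (2 * C) ^ l) := by
  obtain ⟨d, hd, hd0, hdl⟩ : ∃ d : ℕ → Fin n → ℝ, (∀ v, d 0 v = 1) ∧
      (∀ l v, 0 ≤ d l v ∧ chainCoeff (stepWeight P) l v = ENNReal.ofReal (d l v)) ∧
      ∀ l v, d (l + 1) v = ∑ u, 2 * influence P u v * d l u := by
    refine ⟨fun l => Nat.rec (fun _ => 1) (fun _ d v => ∑ u, 2 * influence P u v * d u) l,
      fun v => rfl, fun l => ?_, fun l v => rfl⟩
    induction l with
    | zero => intro v; simp [chainCoeff]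
    | succ l ih =>
      intro v
      have h0 : ∀ u, 0 ≤ 2 * influence P u v := fun u =>
        mul_nonneg zero_le_two (influence_nonneg P u v)
      refine ⟨Finset.sum_nonneg fun u _ => mul_nonneg (h0 u) (ih u).1, ?_⟩
      rw [chainCoeff, ENNReal.ofReal_sum_of_nonneg fun u _ => mul_nonneg (h0 u) (ih u).1]
      refine Finset.sum_congr rfl fun u _ => ?_
      rw [ENNReal.ofReal_mul (h0 u), (ih u).2]
      rfl
  have hdual : ∀ l (x : Fin n → ℝ), ∑ v, d l v * x v =
      2 ^ l * ∑ u, ((influence P).mulVec)^[l] x u := by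
    intro l
    induction l with
    | zero => intro x; simp [hd]
    | succ l ih =>
      intro x
      rw [Function.iterate_succ_apply, pow_succ, mul_assoc, mul_left_comm, ← ih, Finset.mul_sum]
      simp_rw [hdl, Matrix.mulVec, dotProduct, Finset.sum_mul, Finset.mul_sum]
      rw [Finset.sum_comm]
      refine Finset.sum_congr rfl fun u _ => Finset.sum_congr rfl fun v _ => ?_
      ring
  have h1 : ∑ v, d l v ≤ (n : ℝ) ^ 2 * (2 * C) ^ l := by
    have h2 := hdual l fun _ => 1
    simp only [mul_one] at h2
    rw [h2]
    calc 2 ^ l * ∑ u, ((influence P).mulVec)^[l] (fun _ => 1) u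
        ≤ 2 ^ l * ∑ _u : Fin n, ((C : ℝ) ^ l * n) := by
          gcongr with u _
          exact norm_iterate_mulVec_le h hp l u
      _ = (n : ℝ) ^ 2 * (2 * C) ^ l := by
          rw [Finset.sum_const, Finset.card_univ, Fintype.card_fin, nsmul_eq_mul, mul_pow]
          ring
  calc ∑ v, chainCoeff (stepWeight P) l v = ENNReal.ofReal (∑ v, d l v) := by
        rw [ENNReal.ofReal_sum_of_nonneg fun v _ => (hd0 l v).1]
        exact Finset.sum_congr rfl fun v _ => (hd0 l v).2
    _ ≤ _ := ENNReal.ofReal_le_ofReal h1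

/-! ### Exactness -/

open PRAM

section Exact

variable {S : Fin n → ℕ → ℝ} {f : Fin n → ℕ → (Fin n → Fin q) → Fin q}

/-- For every good realization of the clocks, the phases can be made so short, and the sweeps so many,
that the algorithm succeeds. -/
lemma exists_parameters (hS : IsClock S) (X₀ : Fin n → Fin q) (z₀ : Fin q) {L : ℕ} (hL : 1 ≤ L)
    (T : ℝ) : ∃ M₀ J l N : ℕ, (∀ v, T < S v M₀) ∧
      (∀ k : ℕ, k * (L / 2 ^ J : ℝ) < T → ∀ v, k * (L / 2 ^ J : ℝ) + L / 2 ^ J <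
        S v (upTo S v (k * (L / 2 ^ J : ℝ)) + L + 1)) ∧
      (∀ b : ℝ, 0 ≤ b → ∀ v i, S v i ≤ T →
        (sweep S f)^[l + 1] (guess S f X₀ z₀ b) v i =
        (sweep S f)^[l] (guess S f X₀ z₀ b) v i) ∧
      T ≤ N * (L / 2 ^ J : ℝ) := by
  choose M hM using fun v => hS.unbounded v (T + L)
  set M₀ := ∑ v, M v with hM₀
  have hMle : ∀ v, T + L < S v M₀ := fun v => (hM v).trans_le ((hS.mono v).monotone
    (Finset.single_le_sum (fun _ _ => Nat.zero_le _) (Finset.mem_univ v)))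
  have hL0 : (0 : ℝ) < L := by exact_mod_cast hL
  -- A positive lower bound for the waiting times of the finitely many rings that matter.
  obtain ⟨δ, hδ, hgap⟩ : ∃ δ : ℝ, 0 < δ ∧ ∀ v, ∀ i < M₀, δ ≤ S v (i + 1) - S v i := by
    have : ∀ v : Fin n, ∀ i : ℕ, 0 < S v (i + 1) - S v i := fun v i =>
      sub_pos.2 (hS.mono v (Nat.lt_succ_self i))
    rcases (Finset.univ ×ˢ Finset.range M₀ : Finset (Fin n × ℕ)).eq_empty_or_nonempty with he | hne
    · refine ⟨1, one_pos, fun v i hi => ?_⟩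
      have : (v, i) ∈ (Finset.univ ×ˢ Finset.range M₀ : Finset (Fin n × ℕ)) := by simp [hi]
      rw [he] at this
      simp at this
    · obtain ⟨a, -, ha⟩ := Finset.exists_min_image _ (fun a => S a.1 (a.2 + 1) - S a.1 a.2) hne
      exact ⟨_, this a.1 a.2, fun v i hi => ha (v, i) (by simp [hi])⟩
  obtain ⟨J, hJ⟩ : ∃ J : ℕ, (L : ℝ) / δ < 2 ^ J := pow_unbounded_of_one_lt _ one_lt_two
  have h2 : (0 : ℝ) < 2 ^ J := by positivity
  have hs : (L : ℝ) / 2 ^ J < δ := by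
    rw [div_lt_iff₀ hδ] at hJ
    rw [div_lt_iff₀ h2]
    linarith
  have hs0 : (0 : ℝ) < L / 2 ^ J := by positivity
  have hsL : (L : ℝ) / 2 ^ J ≤ L := div_le_self hL0.le (one_le_pow₀ one_le_two)
  obtain ⟨N, hN⟩ := exists_nat_ge (T / (L / 2 ^ J : ℝ))
  refine ⟨M₀, J, (∑ u, upTo S u T) + 1, N, fun v => by linarith [hMle v], fun k hk v => ?_,
    fun b hb v i hi => ?_, by rwa [div_le_iff₀ hs0] at hN⟩
  · set b : ℝ := k * (L / 2 ^ J : ℝ)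
    set u := upTo S v b
    have h1 : b < S v (u + 1) := not_le.1 fun h => lt_irrefl _ (hS.lt_upTo.2 h)
    have hmono := (hS.mono v).monotone (by omega : u + 2 ≤ u + L + 1)
    by_cases hu : u + 1 < M₀
    · linarith [hgap v (u + 1) hu]
    · have := (hS.mono v).monotone (by omega : M₀ ≤ u + L + 1)
      linarith [hMle v]
  · have hdepth : depthOf S v i ≤ ∑ u, upTo S u T :=
      Finset.sum_le_sum fun u _ => hS.before_le_upTo hi
    rw [iterate_sweep_guess_of_depth hS hb (by omega), iterate_sweep_guess_of_depth hS hb (by omega)]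

end Exact

instance : IsProbabilityMeasure tapeMeasure := by unfold tapeMeasure; infer_instance

lemma ae_fromTape {p : Gaps n × (Fin n × ℕ → Fin q → ℝ) → Prop}
    (h : ∀ᵐ w ∂(gapMeasure n).prod (raceMeasure n q), p w) : ∀ᵐ ω ∂tapeMeasure, p (fromTape n q ω) :=
  ae_of_ae_map measurable_fromTape.aemeasurable (by rwa [map_fromTape])

/-- Almost all coin tosses give clocks and races without ties. -/
lemma ae_good (P : LocalRule G q) (z₀ : Fin q) :
    ∀ᵐ ω ∂tapeMeasure, IsClock (clock (fromTape n q ω).1) ∧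
      IsWinner P (fromTape n q ω).2 (raceDraws P z₀ (fromTape n q ω).2) :=
  ae_fromTape (p := fun w => IsClock (clock w.1) ∧ IsWinner P w.2 (raceDraws P z₀ w.2))
    ((Measure.quasiMeasurePreserving_fst.ae (ae_isClock n)).and
      (Measure.quasiMeasurePreserving_snd.ae (ae_isWinner P z₀)))

variable {X₀ : Fin n → Fin q} {T : ℝ}

/-- The algorithm almost surely halts with the configuration at time `T`. -/
lemma ae_haltsIn {E : Fin m → Fin n × Fin n} (hE : IsEdgeList G E) (hn : 0 < n) (hq : 0 < q)
    (hT : 0 < T) (r : Tape → Resolver) :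
    ∀ᵐ ω ∂tapeMeasure, ∃ c, HaltsIn algorithm (oracle P) (r ω) ω (input X₀ E T) c ∧
      Outputs c (state X₀ T ((fromTape n q ω).1, raceDraws P ⟨0, hq⟩ (fromTape n q ω).2)) := by
  filter_upwards [ae_good P ⟨0, hq⟩] with ω ⟨hS, hwin⟩
  obtain ⟨M₀, J, l, N, hM₀, hJ, hl, hN⟩ := exists_parameters
    (f := drawRule (raceDraws P ⟨0, hq⟩ (fromTape n q ω).2)) hS X₀ ⟨0, hq⟩
    (Nat.le_add_left 1 (Nat.clog 2 n)) T
  obtain ⟨c, hc, hout, -⟩ := algorithm_spec (r := r ω) (ω := ω) (X₀ := X₀) (z₀ := ⟨0, hq⟩)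
    hE hn hq hT hS (fun _ _ => rfl) (fun _ _ _ => rfl) hwin rfl rfl hM₀ hJ
    (fun k _ v i hi _ => hl _ (by positivity) v i hi) hN
  refine ⟨c, hc, ?_⟩
  convert hout using 1
  exact funext fun v => state_eq_truth (w := (_, _)) hS X₀ T v

/-- The output of the algorithm is distributed exactly as the configuration at time `T`. -/
theorem tapeMeasure_outputs {E : Fin m → Fin n × Fin n} (hE : IsEdgeList G E) (hn : 0 < n)
    (hq : 0 < q) (hT : 0 < T) (r : Tape → Resolver) (σ : Fin n → Fin q) :
    tapeMeasure {ω | ∃ c, HaltsIn algorithm (oracle P) (r ω) ω (input X₀ E T) c ∧ Outputs c σ} =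
      dynMeasure P {w | state X₀ T w = σ} := by
  rw [← prod_race_state_eq P ⟨0, hq⟩, ← map_fromTape, Measure.map_apply₀
    measurable_fromTape.aemeasurable (by
      rw [map_fromTape]
      exact nullMeasurableSet_state _ (measurable_raceDraws P ⟨0, hq⟩) X₀ T σ)]
  refine measure_congr ?_
  filter_upwards [ae_haltsIn (P := P) (X₀ := X₀) hE hn hq hT r] with ω ⟨c, hc, hout⟩
  refine propext ⟨?_, fun h => ⟨c, hc, ?_⟩⟩
  · rintro ⟨c', hc', hout'⟩
    obtain rfl := HaltsIn.unique hc hc'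
    exact funext fun v => Fin.ext ((hout v).symm.trans (hout' v))
  · have h : state X₀ T ((fromTape n q ω).1, raceDraws P ⟨0, hq⟩ (fromTape n q ω).2) = σ := h
    rwa [h] at hout

end SingleSite

end


/-! ### Depth and number of processors -/

noncomputable section

namespace SingleSite

open PRAM

variable {n q m : ℕ} {G : SimpleGraph (Fin n)} {P : LocalRule G q} {X₀ : Fin n → Fin q} {T : ℝ}

/-- A union bound for the three ways in which the resource bounds with parameters `M₀`, `J`, `l` can
fail: a clock rings more than `M₀` times, a clock rings too often during a phase, or some phase needs
more than `l` sweeps. -/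
lemma tapeMeasure_not_haltsIn_le {E : Fin m → Fin n × Fin n} (hE : IsEdgeList G E) (hn : 0 < n)
    (hq : 0 < q) (hT : 0 < T) (r : Tape → Resolver) {L : ℕ} (hL : L = Nat.clog 2 n + 1)
    (M₀ J l : ℕ) {N : ℕ} (hN : N = ⌈T / (L / 2 ^ J : ℝ)⌉₊) :
    tapeMeasure {ω | ¬ ∃ c, HaltsIn algorithm (oracle P) (r ω) ω (input X₀ E T) c ∧
        c.depth ≤ unitCost * (M₀ * 7 + 3 * L + 13 + N * (4 * J + 3 * L + 7 * l + 24)) ∧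
        c.procs ≤ (2 * m + n * q * q) * L} ≤
      n * ENNReal.ofReal ((T + 1) ^ M₀ / M₀.factorial) +
      N * (n * ENNReal.ofReal ((2 * (L / 2 ^ J : ℝ)) ^ (L + 1) / (L + 1).factorial)) +
      N * (ENNReal.ofReal ((L + 1 : ℝ) ^ (l + 1) / (l + 1).factorial) *
        ∑ v, chainCoeff (stepWeight P) l v) := by
  set s : ℝ := L / 2 ^ J with hs
  have hL1 : 1 ≤ L := by omega
  have hs0 : 0 < s := by positivity
  set z₀ : Fin q := ⟨0, hq⟩
  -- The three failure events.
  set A₁ : Fin n → Set (Gaps n) := fun v => {g | upTo (clock g) v 0 + M₀ ≤ before (clock g) v (T + 1)}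
    with hA₁
  set A₂ : ℕ → Fin n → Set (Gaps n) := fun k v =>
    {g | upTo (clock g) v (k * s) + (L + 1) ≤ before (clock g) v (k * s + 2 * s)} with hA₂
  set A₃ : ℕ → Set (Gaps n × (Fin n × ℕ → Fin q → ℝ)) := fun k =>
    {w | ∃ v i, i < before (clock w.1) v (k * s + (L + 1)) ∧
      guesses P X₀ z₀ (k * s) (l + 1) w.1 w.2 v (i + 1) ≠
        guesses P X₀ z₀ (k * s) l w.1 w.2 v (i + 1)} with hA₃
  set B : Set (Gaps n × (Fin n × ℕ → Fin q → ℝ)) :=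
    (⋃ v ∈ (Finset.univ : Finset (Fin n)), Prod.fst ⁻¹' A₁ v) ∪
    (⋃ k ∈ Finset.range N, ⋃ v ∈ (Finset.univ : Finset (Fin n)), Prod.fst ⁻¹' A₂ k v) ∪
    (⋃ k ∈ Finset.range N, A₃ k) with hB
  have hsub : ∀ᵐ ω ∂tapeMeasure,
      (¬ ∃ c, HaltsIn algorithm (oracle P) (r ω) ω (input X₀ E T) c ∧
        c.depth ≤ unitCost * (M₀ * 7 + 3 * L + 13 + N * (4 * J + 3 * L + 7 * l + 24)) ∧
        c.procs ≤ (2 * m + n * q * q) * L) → fromTape n q ω ∈ B := by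
    filter_upwards [ae_good P z₀] with ω ⟨hS, hwin⟩ hfail
    by_contra hB'
    simp only [hB, Set.mem_union, Set.mem_iUnion, Finset.mem_univ, Finset.mem_range, not_or, not_exists, Set.mem_preimage, hA₁, hA₂, hA₃, Set.mem_ofPred_eq, not_le, exists_prop,
      not_and, not_not] at hB'
    obtain ⟨⟨h1, h2⟩, h3⟩ := hB'
    have hkN : ∀ k : ℕ, k * s < T → k < N := fun k hk => by
      rw [hN]
      exact Nat.lt_ceil.2 ((lt_div_iff₀ hs0).2 hk)
    set S := clock (fromTape n q ω).1
    have hM : ∀ v, T < S v M₀ := fun v => by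
      by_contra hle
      have h4 := (hS.le_before (u := v) (by linarith : 0 < T + 1) (k := M₀)).2
        (by linarith [not_lt.1 hle])
      have := h1 v trivial
      rw [hS.upTo_zero] at this
      omega
    have hwindow : ∀ k : ℕ, k * s < T → ∀ v, k * s + s < S v (upTo S v (k * s) + L + 1) :=
      fun k hk v => by
        by_contra hle
        have h4 := (hS.le_before (u := v) (t := k * s + 2 * s) (by positivity)
          (k := upTo S v (k * s) + L + 1)).2 (by linarith [not_lt.1 hle])
        have := h2 k (hkN k hk) v trivial
        omega
    have hsweeps : ∀ k : ℕ, k * s < T → ∀ v i, S v i ≤ T → S v i ≤ k * s + L →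
        guesses P X₀ z₀ (k * s) (l + 1) (fromTape n q ω).1 (fromTape n q ω).2 v i =
        guesses P X₀ z₀ (k * s) l (fromTape n q ω).1 (fromTape n q ω).2 v i := by
      intro k hk v i _ hi
      rcases i with _ | i
      · unfold guesses
        rw [iterate_sweep_zero, iterate_sweep_zero]
      · exact h3 k (hkN k hk) v i (hS.lt_before.2 (by linarith))
    have hNT : T ≤ N * s := by
      rw [← div_le_iff₀ hs0, hN]
      exact Nat.le_ceil _
    obtain ⟨c, hc, -, hdepth, hprocs⟩ := algorithm_spec (r := r ω) (ω := ω) (X₀ := X₀) (z₀ := z₀)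
      hE hn hq hT hS (fun _ _ => rfl) (fun _ _ _ => rfl) hwin rfl hL hM hwindow hsweeps hNT
    exact hfail ⟨c, hc, hdepth, hprocs⟩
  have hfst : ∀ A : Set (Gaps n), (gapMeasure n).prod (raceMeasure n q) (Prod.fst ⁻¹' A) ≤
      gapMeasure n A := fun A => by
    rw [← Set.prod_univ, Measure.prod_prod, measure_univ, mul_one]
  calc tapeMeasure {ω | ¬ ∃ c, HaltsIn algorithm (oracle P) (r ω) ω (input X₀ E T) c ∧
        c.depth ≤ unitCost * (M₀ * 7 + 3 * L + 13 + N * (4 * J + 3 * L + 7 * l + 24)) ∧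
        c.procs ≤ (2 * m + n * q * q) * L}
      ≤ tapeMeasure (fromTape n q ⁻¹' B) := measure_mono_ae hsub
    _ ≤ (gapMeasure n).prod (raceMeasure n q) B := by
        rw [← map_fromTape]
        exact Measure.le_map_apply measurable_fromTape.aemeasurable B
    _ ≤ _ := by
        refine (measure_union_le _ _).trans (add_le_add ((measure_union_le _ _).trans
          (add_le_add ?_ ?_)) ?_)
        · refine (measure_biUnion_finset_le _ _).trans
            ((Finset.sum_le_card_nsmul _ _ _ fun v _ => ?_).trans
              (by rw [Finset.card_univ, Fintype.card_fin, nsmul_eq_mul]))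
          have := gapMeasure_rings_le v (by linarith : (0 : ℝ) ≤ T + 1) M₀
          rw [sub_zero] at this
          exact (hfst _).trans this
        · refine (measure_biUnion_finset_le _ _).trans
            ((Finset.sum_le_card_nsmul _ _ _ fun k _ => ?_).trans
              (by rw [Finset.card_range, nsmul_eq_mul]))
          refine (measure_biUnion_finset_le _ _).trans
            ((Finset.sum_le_card_nsmul _ _ _ fun v _ => ?_).trans
              (by rw [Finset.card_univ, Fintype.card_fin, nsmul_eq_mul]))
          have := gapMeasure_rings_le v (by linarith : (k * s : ℝ) ≤ k * s + 2 * s) (L + 1)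
          rw [add_sub_cancel_left] at this
          exact (hfst _).trans this
        · refine (measure_biUnion_finset_le _ _).trans
            ((Finset.sum_le_card_nsmul _ _ _ fun k _ => ?_).trans
              (by rw [Finset.card_range, nsmul_eq_mul]))
          have := prod_guesses_ne_le (P := P) (X₀ := X₀) (z₀ := z₀)
            (by linarith : (k * s : ℝ) ≤ k * s + (L + 1)) l
          rwa [add_sub_cancel_left] at this

lemma pow_div_factorial_le {x : ℝ} (hx : 0 ≤ x) {k : ℕ} (hk : 0 < k) :
    x ^ k / k.factorial ≤ (3 * x / k) ^ k := by
  have hk' : (0 : ℝ) < k := by exact_mod_cast hk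
  have h1 : (k : ℝ) ^ k / k.factorial ≤ 3 ^ k := by
    refine (Real.pow_div_factorial_le_exp (k : ℝ) hk'.le k).trans ?_
    rw [← Real.exp_one_pow]
    exact pow_le_pow_left₀ (Real.exp_pos _).le (by linarith [Real.exp_one_lt_d9]) k
  calc x ^ k / k.factorial = (x / k) ^ k * ((k : ℝ) ^ k / k.factorial) := by
        rw [div_pow]; field_simp
    _ ≤ (x / k) ^ k * 3 ^ k := by gcongr
    _ = (3 * x / k) ^ k := by rw [← mul_pow]; congr 1; ring

lemma pow_div_factorial_le_half {x : ℝ} (hx : 0 ≤ x) {k : ℕ} (hk : 6 * x ≤ k) (hk0 : 0 < k) :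
    x ^ k / k.factorial ≤ (1 / 2) ^ k := by
  have hk' : (0 : ℝ) < k := by exact_mod_cast hk0
  refine (pow_div_factorial_le hx hk0).trans (pow_le_pow_left₀ (by positivity) ?_ k)
  rw [div_le_iff₀ hk']
  linarith

lemma half_pow_le {L A k : ℕ} (h : A * L ≤ k) : (1 / 2 : ℝ) ^ k ≤ 1 / ((2 : ℝ) ^ L) ^ A := by
  rw [← pow_mul, one_div_pow]
  exact one_div_le_one_div_of_le (by positivity)
    (pow_le_pow_right₀ one_le_two (by rwa [mul_comm]))

/-- The failure probability for logarithmic parameters. The three terms bound the probabilities of the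
three failure events, in terms of `U = 2 ^ L`, which is at least `2 * n`. -/
lemma failure_le {n L a M₀ l N : ℕ} {D T U : ℝ} (hL : 2 ≤ L) (hU : U = 2 ^ L)
    (hnU : (n : ℝ) ≤ U) (hT : 0 < T) (hTU : T ≤ U ^ a) {B : ℕ} (hB : B = 3 * a + 8)
    (hM₀ : 6 * (T + 1) ≤ M₀) (hM₀L : (a + 2) * L ≤ M₀) (hD : 1 ≤ D)
    (hl : 6 * (D * (L + 1)) ≤ l) (hlL : B * L ≤ l) {J : ℕ} (hJ : J = 2 * a + 7)
    (hN : (N : ℝ) ≤ T / (L / 2 ^ J) + 1) :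
    n * ((T + 1) ^ M₀ / M₀.factorial) +
      N * (n * ((2 * (L / 2 ^ J : ℝ)) ^ (L + 1) / (L + 1).factorial)) +
      N * ((L + 1 : ℝ) ^ (l + 1) / (l + 1).factorial * ((n : ℝ) ^ 2 * D ^ l)) ≤ 1 / U ^ a := by
  have hU4 : 4 ≤ U := by
    rw [hU]
    calc (4 : ℝ) = 2 ^ 2 := by norm_num
      _ ≤ 2 ^ L := pow_le_pow_right₀ one_le_two hL
  have hU0 : 0 < U := by linarith
  have hUa : 0 < U ^ a := by positivity
  have hLr : (2 : ℝ) ≤ L := by exact_mod_cast hL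
  have hL0 : (0 : ℝ) < L := by linarith
  have h2J : (0 : ℝ) < 2 ^ J := by positivity
  have hNle : (N : ℝ) ≤ 2 ^ (J + 1) * U ^ a := by
    have h1 : T / (L / 2 ^ J) ≤ U ^ a * 2 ^ J := by
      rw [div_div_eq_mul_div, div_le_iff₀ hL0]
      have : T * 2 ^ J ≤ U ^ a * 2 ^ J := by gcongr
      nlinarith [mul_pos hUa h2J]
    have h2 : (1 : ℝ) ≤ U ^ a * 2 ^ J :=
      one_le_mul_of_one_le_of_one_le (one_le_pow₀ (by linarith)) (one_le_pow₀ one_le_two)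
    rw [pow_succ]
    linarith
  have hM₀pos : 0 < M₀ := by
    have : (0 : ℝ) < M₀ := by linarith
    exact_mod_cast this
  -- Too many rings of one clock.
  have t1 : n * ((T + 1) ^ M₀ / M₀.factorial) ≤ 1 / U ^ a * (1 / 4) := by
    calc (n : ℝ) * ((T + 1) ^ M₀ / M₀.factorial) ≤ U * (1 / U ^ (a + 2)) := by
          refine mul_le_mul hnU ?_ (by positivity) hU0.le
          rw [hU]
          exact (pow_div_factorial_le_half (by linarith) hM₀ hM₀pos).trans (half_pow_le hM₀L)
      _ = 1 / U ^ a * (1 / U) := by rw [pow_add]; field_simp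
      _ ≤ 1 / U ^ a * (1 / 4) := by gcongr
  -- Too many rings during one phase.
  have t2 : N * (n * ((2 * (L / 2 ^ J : ℝ)) ^ (L + 1) / (L + 1).factorial)) ≤
      1 / U ^ a * (1 / 4) := by
    have h1 : (2 * (L / 2 ^ J : ℝ)) ^ (L + 1) / (L + 1).factorial ≤
        1 / (U ^ (2 * a + 4) * 2 ^ (2 * a + 4)) := by
      refine (pow_div_factorial_le (by positivity) (Nat.succ_pos L)).trans ?_
      calc (3 * (2 * (L / 2 ^ J : ℝ)) / ((L + 1 : ℕ) : ℝ)) ^ (L + 1)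
          ≤ (1 / 2 ^ (2 * a + 4)) ^ (L + 1) := by
            refine pow_le_pow_left₀ (by positivity) ?_ _
            rw [hJ, show 2 * a + 7 = (2 * a + 4) + 3 by ring, pow_add, div_le_iff₀ (by positivity)]
            push_cast
            have h5 : (0 : ℝ) < 2 ^ (2 * a + 4) := by positivity
            rw [show 3 * (2 * ((L : ℝ) / (2 ^ (2 * a + 4) * 2 ^ 3))) =
              (6 / 8 * L) * (1 / 2 ^ (2 * a + 4)) by field_simp; norm_num, mul_comm]
            gcongr
            linarith
        _ = 1 / (U ^ (2 * a + 4) * 2 ^ (2 * a + 4)) := by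
            rw [one_div_pow, hU, ← pow_mul, ← pow_mul, ← pow_add]
            congr 2
            ring
    calc N * (n * ((2 * (L / 2 ^ J : ℝ)) ^ (L + 1) / (L + 1).factorial))
        ≤ (2 ^ (J + 1) * U ^ a) * (U * (1 / (U ^ (2 * a + 4) * 2 ^ (2 * a + 4)))) := by gcongr
      _ = 1 / U ^ a * (16 / U ^ 3) := by
          rw [hJ, show 2 * a + 7 + 1 = (2 * a + 4) + 4 by ring, pow_add 2 (2 * a + 4),
            show U ^ (2 * a + 4) = U ^ a * U ^ a * U * U ^ 3 by ring]
          field_simp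
          norm_num
      _ ≤ 1 / U ^ a * (1 / 4) := by
          have : (64 : ℝ) ≤ U ^ 3 := by
            calc (64 : ℝ) = 4 ^ 3 := by norm_num
              _ ≤ U ^ 3 := by gcongr
          refine mul_le_mul_of_nonneg_left ?_ (by positivity)
          rw [div_le_div_iff₀ (by positivity) (by norm_num)]
          linarith
  -- Too many sweeps during one phase.
  have t3 : N * ((L + 1 : ℝ) ^ (l + 1) / (l + 1).factorial * ((n : ℝ) ^ 2 * D ^ l)) ≤
      1 / U ^ a * (1 / 4) := by
    have h1 : (L + 1 : ℝ) ^ (l + 1) / (l + 1).factorial * D ^ l ≤ 1 / U ^ B := by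
      calc (L + 1 : ℝ) ^ (l + 1) / (l + 1).factorial * D ^ l
          ≤ (L + 1 : ℝ) ^ (l + 1) / (l + 1).factorial * D ^ (l + 1) := by
            gcongr
            exact Nat.le_succ l
        _ = (D * (L + 1)) ^ (l + 1) / (l + 1).factorial := by rw [mul_pow]; ring
        _ ≤ (1 / 2) ^ (l + 1) := by
            refine pow_div_factorial_le_half (by positivity) ?_ (Nat.succ_pos l)
            push_cast
            linarith
        _ ≤ 1 / U ^ B := by
            rw [hU]
            exact half_pow_le (by omega)
    have h2 : (2 : ℝ) ^ (J + 1) ≤ U ^ (a + 4) := by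
      calc (2 : ℝ) ^ (J + 1) = 4 ^ (a + 4) := by
            rw [hJ, show (4 : ℝ) = 2 ^ 2 by norm_num, ← pow_mul]
            ring_nf
        _ ≤ U ^ (a + 4) := by gcongr
    calc N * ((L + 1 : ℝ) ^ (l + 1) / (l + 1).factorial * ((n : ℝ) ^ 2 * D ^ l))
        = N * (n : ℝ) ^ 2 * ((L + 1 : ℝ) ^ (l + 1) / (l + 1).factorial * D ^ l) := by ring
      _ ≤ (U ^ (a + 4) * U ^ a) * U ^ 2 * (1 / U ^ B) := by
          gcongr
          exact hNle.trans (by gcongr)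
      _ = 1 / U ^ a * (1 / U ^ 2) := by
          rw [hB, show U ^ (3 * a + 8) = U ^ (a + 4) * U ^ a * U ^ 2 * U ^ a * U ^ 2 by ring]
          field_simp
      _ ≤ 1 / U ^ a * (1 / 4) := by
          gcongr
          nlinarith
  have : 0 ≤ 1 / U ^ a := by positivity
  linarith

lemma clog_bounds {n : ℕ} (hn : 2 ≤ n) :
    2 ≤ Nat.clog 2 n + 1 ∧ (n : ℝ) ≤ 2 ^ (Nat.clog 2 n + 1) ∧
      ((Nat.clog 2 n + 1 : ℕ) : ℝ) ≤ 5 * Real.log n := by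
  have hn0 : (0 : ℝ) < n := by positivity
  have hc1 : 1 ≤ Nat.clog 2 n := Nat.clog_pos one_lt_two hn
  have hle : n ≤ 2 ^ Nat.clog 2 n := Nat.le_pow_clog one_lt_two n
  have hlt : 2 ^ (Nat.clog 2 n - 1) < n := Nat.pow_pred_clog_lt_self one_lt_two hn
  refine ⟨by omega, ?_, ?_⟩
  · calc (n : ℝ) ≤ ((2 ^ Nat.clog 2 n : ℕ) : ℝ) := by exact_mod_cast hle
      _ ≤ 2 ^ (Nat.clog 2 n + 1) := by
          push_cast
          exact pow_le_pow_right₀ one_le_two (Nat.le_succ _)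
  · have h1 : ((Nat.clog 2 n - 1 : ℕ) : ℝ) * Real.log 2 ≤ Real.log n := by
      rw [← Real.log_pow]
      exact Real.log_le_log (by positivity) (by exact_mod_cast hlt.le)
    have h2 : Real.log 2 ≤ Real.log n := Real.log_le_log two_pos (by exact_mod_cast hn)
    have h3 := Real.log_two_gt_d9
    rw [Nat.cast_sub hc1] at h1
    push_cast at h1 ⊢
    have h4 : (0 : ℝ) ≤ Nat.clog 2 n - 1 := by
      have : (1 : ℝ) ≤ Nat.clog 2 n := by exact_mod_cast hc1
      linarith
    nlinarith

/-- The depth is logarithmic, up to the contribution of `T`. -/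
lemma depth_le {n L a M₀ l N D B J W : ℕ} {T : ℝ} (hT : 0 < T) (hL : 2 ≤ L)
    (hLlog : (L : ℝ) ≤ 5 * Real.log n) (hn : (1 : ℝ) ≤ n)
    (hM₀ : M₀ = 6 * (⌈T⌉₊ + 1) + (a + 2) * L) (hl : l = (6 * D + B) * (L + 1))
    (hW : W = 4 * J + 3 + 14 * (6 * D + B) + 24) (hN : (N : ℝ) ≤ T / (L / 2 ^ J) + 1) :
    ((unitCost * (M₀ * 7 + 3 * L + 13 + N * (4 * J + 3 * L + 7 * l + 24)) : ℕ) : ℝ) ≤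
      1000 * (42 + W * 2 ^ J + 5 * (7 * a + 114 + W)) * (T + Real.log n) := by
  have hLr : (2 : ℝ) ≤ L := by exact_mod_cast hL
  have hL0 : (0 : ℝ) < L := by linarith
  have hceil : (⌈T⌉₊ : ℝ) ≤ T + 1 := (Nat.ceil_lt_add_one hT.le).le
  have hM₀r : (M₀ : ℝ) ≤ 6 * (T + 2) + (a + 2) * L := by
    rw [hM₀]
    push_cast
    linarith
  have hinner : (4 * J + 3 * L + 7 * l + 24 : ℝ) ≤ W * L := by
    have : 4 * J + 3 * L + 7 * l + 24 ≤ W * L := by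
      calc 4 * J + 3 * L + 7 * l + 24
          ≤ 4 * J * L + 3 * L + 14 * (6 * D + B) * L + 24 * L := by
            have h1 : 4 * J ≤ 4 * J * L := Nat.le_mul_of_pos_right _ (by omega)
            have h2 : 7 * l ≤ 14 * (6 * D + B) * L := by
              rw [hl]
              calc 7 * ((6 * D + B) * (L + 1)) ≤ 7 * ((6 * D + B) * (2 * L)) := by
                    gcongr
                    omega
                _ = 14 * (6 * D + B) * L := by ring
            omega
        _ = W * L := by rw [hW]; ring
    exact_mod_cast this
  have hNW : (N : ℝ) * (4 * J + 3 * L + 7 * l + 24) ≤ W * 2 ^ J * T + W * L := by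
    calc (N : ℝ) * (4 * J + 3 * L + 7 * l + 24) ≤ (T / (L / 2 ^ J) + 1) * (W * L) :=
          mul_le_mul hN hinner (by positivity) (by positivity)
      _ = W * 2 ^ J * T + W * L := by field_simp
  have hlog : 0 ≤ Real.log n := Real.log_nonneg hn
  have hcoef : (0 : ℝ) ≤ 7 * a + 114 + W := by positivity
  have hcoef2 : (0 : ℝ) ≤ 42 + W * 2 ^ J := by positivity
  have hsum : (M₀ * 7 + 3 * L + 13 + N * (4 * J + 3 * L + 7 * l + 24) : ℝ) ≤
      (42 + W * 2 ^ J) * T + (7 * a + 114 + W) * L := by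
    linarith
  have hfin : (42 + W * 2 ^ J) * T + (7 * a + 114 + W) * L ≤
      (42 + W * 2 ^ J + 5 * (7 * a + 114 + W)) * (T + Real.log n) := by
    linarith [mul_le_mul_of_nonneg_left hLlog hcoef, mul_nonneg hcoef hT.le,
      mul_nonneg hcoef2 hlog]
  unfold unitCost
  push_cast
  linarith

/-- With high probability, the algorithm is fast and needs few processors. -/
theorem tapeMeasure_resources (c₁ : ℝ) (C : ℝ≥0) (c₀ : ℝ) : ∃ K₂ : ℝ,
    ∀ (n q m : ℕ) (G : SimpleGraph (Fin n)) (E : Fin m → Fin n × Fin n)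
      (P : LocalRule G q) (X₀ : Fin n → Fin q) (T : ℝ) (r : Tape → Resolver),
      1 ≤ n → 2 ≤ q → IsEdgeList G E → 0 < T → T ≤ (n : ℝ) ^ c₀ →
      (∃ p : ℝ≥0∞, 1 ≤ p ∧ lpOpNorm p (influence P) ≤ (C : ℝ≥0∞)) →
      tapeMeasure {ω | ¬ ∃ c,
          HaltsIn algorithm (oracle P) (r ω) ω (input X₀ E T) c ∧
          (c.depth : ℝ) ≤ K₂ * (T + Real.log n) ∧
          (c.procs : ℝ) ≤
            15 * (((m : ℝ) + n * (q : ℝ) ^ 2 * Real.log n ^ 2) * Real.log n)} ≤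
        ENNReal.ofReal ((n : ℝ) ^ (-c₁)) := by
  obtain ⟨a₀, ha₀⟩ := exists_nat_ge c₀
  obtain ⟨a₁, ha₁⟩ := exists_nat_ge c₁
  obtain ⟨D, hD⟩ := exists_nat_ge (max 1 (2 * (C : ℝ)))
  have hD1 : (1 : ℝ) ≤ D := (le_max_left _ _).trans hD
  obtain ⟨a, ha⟩ : ∃ a, a = a₀ + a₁ := ⟨_, rfl⟩
  obtain ⟨J, hJ⟩ : ∃ J, J = 2 * a + 7 := ⟨_, rfl⟩
  obtain ⟨B, hB⟩ : ∃ B, B = 3 * a + 8 := ⟨_, rfl⟩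
  obtain ⟨W, hW⟩ : ∃ W, W = 4 * J + 3 + 14 * (6 * D + B) + 24 := ⟨_, rfl⟩
  refine ⟨1000 * (42 + W * 2 ^ J + 5 * (7 * a + 114 + W)), ?_⟩
  intro n q m G E P X₀ T r hn hq hE hT hTn ⟨p, hp, hC⟩
  rcases hn.eq_or_lt with rfl | hn2
  · simpa using prob_le_one
  have hn2 : 2 ≤ n := hn2
  obtain ⟨hL2, hnL, hLlog⟩ := clog_bounds hn2
  obtain ⟨L, hL⟩ : ∃ L, L = Nat.clog 2 n + 1 := ⟨_, rfl⟩
  rw [← hL] at hL2 hnL hLlog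
  have hn1 : (1 : ℝ) ≤ n := by exact_mod_cast hn
  have hn0 : (0 : ℝ) < n := by linarith
  have hLr : (2 : ℝ) ≤ L := by exact_mod_cast hL2
  have hL0 : (0 : ℝ) < L := by linarith
  obtain ⟨M₀, hM₀⟩ : ∃ M₀, M₀ = 6 * (⌈T⌉₊ + 1) + (a + 2) * L := ⟨_, rfl⟩
  obtain ⟨l, hl⟩ : ∃ l, l = (6 * D + B) * (L + 1) := ⟨_, rfl⟩
  obtain ⟨N, hN⟩ : ∃ N, N = ⌈T / (L / 2 ^ J : ℝ)⌉₊ := ⟨_, rfl⟩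
  have hNle : (N : ℝ) ≤ T / (L / 2 ^ J) + 1 := by
    rw [hN]
    exact (Nat.ceil_lt_add_one (by positivity)).le
  have hUn : (n : ℝ) ^ (a : ℝ) ≤ ((2 : ℝ) ^ L) ^ a := by
    rw [Real.rpow_natCast]
    gcongr
  have hTU : T ≤ ((2 : ℝ) ^ L) ^ a := by
    refine hTn.trans (le_trans (Real.rpow_le_rpow_of_exponent_le hn1 ?_) hUn)
    rw [ha]
    push_cast
    linarith [(Nat.cast_nonneg a₁ : (0 : ℝ) ≤ a₁)]
  have hfail := failure_le (n := n) (L := L) (a := a) (M₀ := M₀) (l := l) (N := N) (D := D) (T := T)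
    hL2 rfl hnL hT hTU hB
    (by
      rw [hM₀]
      push_cast
      have := Nat.le_ceil T
      nlinarith [mul_nonneg (by positivity : (0 : ℝ) ≤ a + 2) hL0.le])
    (by rw [hM₀]; omega) hD1
    (by
      rw [hl]
      push_cast
      nlinarith [mul_nonneg (Nat.cast_nonneg B : (0 : ℝ) ≤ B) (by linarith : (0 : ℝ) ≤ (L : ℝ) + 1)])
    (by rw [hl]; nlinarith [Nat.zero_le D]) hJ hNle
  have hdepth := depth_le (n := n) hT hL2 hLlog hn1 hM₀ hl hW hNle
  have hprocs : (((2 * m + n * q * q) * L : ℕ) : ℝ) ≤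
      15 * (((m : ℝ) + n * (q : ℝ) ^ 2 * Real.log n ^ 2) * Real.log n) := by
    have hlog : 0.69 ≤ Real.log n := by
      have h2 : Real.log 2 ≤ Real.log n := Real.log_le_log two_pos (by exact_mod_cast hn2)
      linarith [Real.log_two_gt_d9]
    have hsq : (1 : ℝ) ≤ 3 * Real.log n ^ 2 := by nlinarith
    have hnq : (0 : ℝ) ≤ n * (q : ℝ) ^ 2 := by positivity
    have hm0 : (0 : ℝ) ≤ m := by positivity
    push_cast
    calc (2 * (m : ℝ) + n * q * q) * L
        ≤ (3 * m + 3 * (n * (q : ℝ) ^ 2 * Real.log n ^ 2)) * (5 * Real.log n) := by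
          refine mul_le_mul ?_ hLlog hL0.le (by positivity)
          nlinarith
      _ = 15 * (((m : ℝ) + n * (q : ℝ) ^ 2 * Real.log n ^ 2) * Real.log n) := by ring
  refine (measure_mono fun ω hω => ?_).trans
    ((tapeMeasure_not_haltsIn_le (P := P) (X₀ := X₀) hE hn (by omega) hT r hL M₀ J l hN).trans ?_)
  · rintro ⟨c, hc, hcd, hcp⟩
    exact hω ⟨c, hc, le_trans (by exact_mod_cast hcd) hdepth,
      le_trans (by exact_mod_cast hcp) hprocs⟩
  · have hchain : ∑ v, chainCoeff (stepWeight P) l v ≤ ENNReal.ofReal ((n : ℝ) ^ 2 * (D : ℝ) ^ l) := by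
      refine (sum_chainCoeff_le hC hp l).trans (ENNReal.ofReal_le_ofReal ?_)
      gcongr
      exact (le_max_right _ _).trans hD
    calc _ ≤ ENNReal.ofReal n * ENNReal.ofReal ((T + 1) ^ M₀ / M₀.factorial) +
          ENNReal.ofReal N * (ENNReal.ofReal n *
            ENNReal.ofReal ((2 * (L / 2 ^ J : ℝ)) ^ (L + 1) / (L + 1).factorial)) +
          ENNReal.ofReal N * (ENNReal.ofReal ((L + 1 : ℝ) ^ (l + 1) / (l + 1).factorial) *
            ENNReal.ofReal ((n : ℝ) ^ 2 * (D : ℝ) ^ l)) := by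
          simp only [ENNReal.ofReal_natCast]
          gcongr
      _ = ENNReal.ofReal (n * ((T + 1) ^ M₀ / M₀.factorial) +
          N * (n * ((2 * (L / 2 ^ J : ℝ)) ^ (L + 1) / (L + 1).factorial)) +
          N * ((L + 1 : ℝ) ^ (l + 1) / (l + 1).factorial * ((n : ℝ) ^ 2 * (D : ℝ) ^ l))) := by
          rw [ENNReal.ofReal_add (by positivity) (by positivity),
            ENNReal.ofReal_add (by positivity) (by positivity),
            ENNReal.ofReal_mul hn0.le, ENNReal.ofReal_mul (Nat.cast_nonneg N),
            ENNReal.ofReal_mul hn0.le, ENNReal.ofReal_mul (Nat.cast_nonneg N),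
            ENNReal.ofReal_mul (q := (n : ℝ) ^ 2 * (D : ℝ) ^ l) (by positivity)]
      _ ≤ ENNReal.ofReal ((n : ℝ) ^ (-c₁)) := by
          refine ENNReal.ofReal_le_ofReal (hfail.trans ?_)
          rw [Real.rpow_neg hn0.le, ← one_div]
          refine one_div_le_one_div_of_le (by positivity)
            (le_trans (Real.rpow_le_rpow_of_exponent_le hn1 ?_) hUn)
          rw [ha]
          push_cast
          linarith [(Nat.cast_nonneg a₀ : (0 : ℝ) ≤ a₀)]

end SingleSite

end

theorem theorem4p3 :
    ∃ A : PRAM.Prog,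
      -- the output is exact
      (∀ c₀ : ℝ, 0 < c₀ →
        ∀ (n q m : ℕ) (G : SimpleGraph (Fin n)) (E : Fin m → Fin n × Fin n)
          (P : SingleSite.LocalRule G q) (X₀ : Fin n → Fin q) (T : ℝ)
          (r : PRAM.Tape → PRAM.Resolver),
          1 ≤ n → 2 ≤ q → SingleSite.IsEdgeList G E → 0 < T → T ≤ (n : ℝ) ^ c₀ →
          (∀ᵐ ω ∂PRAM.tapeMeasure, ∃ c,
            PRAM.HaltsIn A (SingleSite.oracle P) (r ω) ω (SingleSite.input X₀ E T) c) ∧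
          ∀ σ : Fin n → Fin q,
            PRAM.tapeMeasure {ω | ∃ c,
              PRAM.HaltsIn A (SingleSite.oracle P) (r ω) ω (SingleSite.input X₀ E T) c ∧
              SingleSite.Outputs c σ} =
            SingleSite.dynMeasure P {w | SingleSite.state X₀ T w = σ}) ∧
      -- depth and number of processors
      (∀ c₁ : ℝ, 0 < c₁ → ∃ K₁ : ℝ, ∀ C : ℝ≥0, ∀ c₀ : ℝ, 0 < c₀ → ∃ K₂ : ℝ,
        ∀ (n q m : ℕ) (G : SimpleGraph (Fin n)) (E : Fin m → Fin n × Fin n)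
          (P : SingleSite.LocalRule G q) (X₀ : Fin n → Fin q) (T : ℝ)
          (r : PRAM.Tape → PRAM.Resolver),
          1 ≤ n → 2 ≤ q → SingleSite.IsEdgeList G E → 0 < T → T ≤ (n : ℝ) ^ c₀ →
          (∃ p : ℝ≥0∞, 1 ≤ p ∧
            SingleSite.lpOpNorm p (SingleSite.influence P) ≤ (C : ℝ≥0∞)) →
          PRAM.tapeMeasure {ω | ¬ ∃ c,
              PRAM.HaltsIn A (SingleSite.oracle P) (r ω) ω (SingleSite.input X₀ E T) c ∧
              (c.depth : ℝ) ≤ K₂ * (T + Real.log n) ∧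
              (c.procs : ℝ) ≤
                K₁ * (((m : ℝ) + n * (q : ℝ) ^ 2 * Real.log n ^ 2) * Real.log n)} ≤
            ENNReal.ofReal ((n : ℝ) ^ (-c₁))) := by

  refine ⟨SingleSite.algorithm, fun c₀ _ n q m G E P X₀ T r hn hq hE hT _ => ⟨?_, fun σ => ?_⟩,
    fun c₁ _ => ⟨15, fun C c₀ _ => SingleSite.tapeMeasure_resources c₁ C c₀⟩⟩
  · filter_upwards [SingleSite.ae_haltsIn (P := P) (X₀ := X₀) hE hn (by omega) hT r] with ω ⟨c, hc, _⟩
    exact ⟨c, hc⟩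
  · exact SingleSite.tapeMeasure_outputs hE hn (by omega) hT r σ
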